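/- **Proposition (covariance structure).** Let $A,B\in\mathbb{R}^{d\times d}$, let $\lambda_0,\lambda\in\mathbb{R}^d$ with $0\le\lambda_0\le\lambda$ componentwise, and let $\nu_1,\dots,\nu_d$ be probability measures on $\mathbb{R}$ with $\int x^2\,\nu_k(dx)<\infty$. Let $(T_n,X_n,Y_n)_{n\ge1}$ be a marked point process adapted to a filtration $(\mathcal F_t)_{t\ge 0}$, with event times $0<T_1<T_2<\cdots$ (strictly increasing while finite, $T_n\to\infty$ almost surely), event types $X_n\in\{1,\dots,d\}$ and jump sizes $Y_n\ge 0$. Put $N_k(t)=\sum_n 1_{\{X_n=k,\,T_n\le t\}}$, $U_k(t)=\sum_n Y_n1_{\{X_n=k,\,T_n\le t\}}$, $U=(U_1,\dots,U_d)^\top$. Let $\lambda(t)=(\lambda_1(t),\dots,\lambda_d(t))^\top\ge0$ be a càdlàg adapted process which almost surely solves $$d\lambda(t)=A(\lambda(t)-\lambda_0)\,dt+B\,dU(t),\qquad \lambda(0)=\lambda,$$ such that for each $k$ and each predictable $f\ge0$ $$\mathbb{E}\Big[\int_0^\infty f(s)\,dN_k(s)\Big]=\mathbb{E}\Big[\int_0^\infty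 f(s)\lambda_k(s)\,ds\Big],$$ and such that the jump size of an event of type $k$ has, given the strict past of the event, the law $\nu_k$ (homogeneous jump sizes), i.e. for each $k$, each predictable $f\ge0$ and each Borel set $D$, $$\mathbb{E}\Big[\sum_{n:\,X_n=k,\,T_n<\infty} f(T_n)1_D(Y_n)\Big]=\nu_k(D)\,\mathbb{E}\Big[\int_0^\infty f(s)\,dN_k(s)\Big].$$ Let $M=A+BJ$, where $J$ is the diagonal matrix with diagonal entries $\int x\,\nu_k(dx)$, $k=1,\dots,d$. Then $\lambda(t)$ is square integrable for every $t\ge0$. Write $y(t)=\mathbb{E}[\lambda(t)]$, $V(t)=\mathbb{E}[\lambda(t)\lambda(t)^\top]$ and $C_\lambda(t,h)=\mathbb{E}[(\lambda(t+h)-y(t+h))(\lambda(t)-y(t))^\top]$. 1. If $M$ is invertible, then for all $t,h\ge0$ $$C_\lambda(t,h)=e^{hM}\Big(V(t)-e^{tM}\lambda\, y(t)^\top+(e^{tM}-I)M^{-1}A\lambda_0\,y(t)^\top\Big).$$ 2. If all eigenvalues of $M+M^\top$ are negative, then $M$ is invertible, $\lim_{t\to\infty}V(t)$ exists (and is finite),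 and for all $h\ge0$ $$\lim_{t\to\infty}C_\lambda(t,h)=e^{hM}\Big(\lim_{t\to\infty}V(t)-(M^{-1}A\lambda_0)(M^{-1}A\lambda_0)^\top\Big).$$ -/

import Mathlib

open MeasureTheory ProbabilityTheory Filter Topology
open scoped NNReal ENNReal Matrix

noncomputable section

namespace SelfExciting

variable {Ω : Type*} {d : ℕ}

/-- The `n`-th event occurs at a finite time and is of type `k`. -/
def IsEvent (T : ℕ → Ω → ℝ≥0∞) (X : ℕ → Ω → Fin d) (k : Fin d) (n : ℕ) (ω : Ω) : Prop :=
  T n ω ≠ ⊤ ∧ X n ω = k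

open Classical in
/-- The integral `∫ f(s) dN_k(s)` of a nonnegative process against the counting process of the
events of type `k`, where the `n`-th event is moreover weighted by `w n`: it is the sum of
`f(T_n) w n` over the events of type `k`. -/
def eventSum (T : ℕ → Ω → ℝ≥0∞) (X : ℕ → Ω → Fin d) (k : Fin d)
    (f : ℝ≥0 × Ω → ℝ≥0∞) (w : ℕ → Ω → ℝ≥0∞) (ω : Ω) : ℝ≥0∞ :=
  ∑' n, if IsEvent T X k n ω then f ((T n ω).toNNReal, ω) * w n ω else 0

open Classical in
/-- The compound process `U(t)`: its `k`-th component is the sum of the sizes `Y_n` of the events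
of type `k` up to and including time `t`. -/
def compound (T : ℕ → Ω → ℝ≥0∞) (X : ℕ → Ω → Fin d) (Y : ℕ → Ω → ℝ) (t : ℝ≥0) (ω : Ω) :
    Fin d → ℝ :=
  fun k => ∑' n, if T n ω ≤ t ∧ X n ω = k then Y n ω else 0

/-- `(T, X, Y)` is a simple, non-explosive marked point process (times, types in `{1, …, d}`,
jump sizes; the events are numbered from `0` and `T n ω = ∞` means that there are at most `n`
events) and `lam` is its intensity process, started at `l` and solving
`dλ(t) = μ(t, λ(t)) dt + B dU(t)`, where the jump sizes of the events of type `k` are distributed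
according to `κ k (λ(T_n-))`. -/
structure IsSelfExcitingProcess [mΩ : MeasurableSpace Ω] (P : Measure Ω)
    (𝓕 : Filtration ℝ≥0 mΩ) (μ : ℝ≥0 → (Fin d → ℝ) → (Fin d → ℝ))
    (B : Matrix (Fin d) (Fin d) ℝ) (κ : Fin d → Kernel (Fin d → ℝ) ℝ) (l : Fin d → ℝ)
    (T : ℕ → Ω → ℝ≥0∞) (X : ℕ → Ω → Fin d) (Y : ℕ → Ω → ℝ)
    (lam : ℝ≥0 → Ω → Fin d → ℝ) : Prop where
  /-- The event times are positive. -/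
  time_pos : ∀ᵐ ω ∂P, 0 < T 0 ω
  /-- The event times are nondecreasing. -/
  time_mono : ∀ᵐ ω ∂P, Monotone fun n => T n ω
  /-- There are no simultaneous events. -/
  time_strict : ∀ᵐ ω ∂P, ∀ n, T n ω ≠ ⊤ → T n ω < T (n + 1) ω
  /-- There are finitely many events in bounded time. -/
  nonexplosive : ∀ᵐ ω ∂P, Tendsto (fun n => T n ω) atTop (𝓝 ⊤)
  /-- The jump sizes are nonnegative. -/
  size_nonneg : ∀ᵐ ω ∂P, ∀ n, 0 ≤ Y n ω
  /-- The marked point process is adapted to the filtration. -/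
  adapted_events : ∀ (n : ℕ) (t : ℝ≥0) (k : Fin d) (D : Set ℝ), MeasurableSet D →
    MeasurableSet[𝓕 t] {ω | T n ω ≤ t ∧ X n ω = k ∧ Y n ω ∈ D}
  /-- The intensity process is adapted to the filtration. -/
  adapted_intensity : ∀ t : ℝ≥0, Measurable[𝓕 t] (lam t)
  /-- The paths of the intensity process are right-continuous … -/
  right_continuous : ∀ ω t, ContinuousWithinAt (fun s => lam s ω) (Set.Ici t) t
  /-- … and have left limits. -/
  left_limits : ∀ ω t, ∃ x, Tendsto (fun s => lam s ω) (𝓝[<] t) (𝓝 x)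
  /-- The intensities are nonnegative. -/
  intensity_nonneg : ∀ᵐ ω ∂P, ∀ t k, 0 ≤ lam t ω k
  /-- The drift is integrable along the paths. -/
  drift_integrable : ∀ᵐ ω ∂P, ∀ t : ℝ≥0,
    IntervalIntegrable (fun s : ℝ => μ s.toNNReal (lam s.toNNReal ω)) volume 0 t
  /-- The integrated form of `dλ(t) = μ(t, λ(t)) dt + B dU(t)`, `λ(0) = l`. -/
  equation : ∀ᵐ ω ∂P, ∀ t : ℝ≥0,
    lam t ω = l + (∫ s in (0 : ℝ)..t, μ s.toNNReal (lam s.toNNReal ω)) + B *ᵥ compound T X Y t ω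
  /-- `λ_k` is the intensity of the counting process `N_k`:
  `E[∫ f(s) dN_k(s)] = E[∫ f(s) λ_k(s) ds]` for every predictable `f ≥ 0`. -/
  intensity : ∀ (k : Fin d) (f : ℝ≥0 × Ω → ℝ≥0∞), Measurable[𝓕.predictable] f →
    ∫⁻ ω, eventSum T X k f (fun _ _ => 1) ω ∂P =
      ∫⁻ ω, (∫⁻ s in Set.Ici (0 : ℝ),
        f (s.toNNReal, ω) * ENNReal.ofReal (lam s.toNNReal ω k)) ∂P
  /-- Given the strict past of an event of type `k` at time `T_n`, the jump size `Y_n` has the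
  distribution `κ k (λ(T_n-))`. -/
  size_law : ∀ (k : Fin d) (f : ℝ≥0 × Ω → ℝ≥0∞), Measurable[𝓕.predictable] f →
    ∀ D : Set ℝ, MeasurableSet D →
      ∫⁻ ω, eventSum T X k f (fun n ω => D.indicator 1 (Y n ω)) ω ∂P =
        ∫⁻ ω, eventSum T X k f
          (fun n ω => κ k (Function.leftLim (fun s => lam s ω) (T n ω).toNNReal) D) ω ∂P

/-- The matrix `M = A + B J`, where `J` is diagonal with the means of the `ν k` on the diagonal. -/
def driftMatrix (A B : Matrix (Fin d) (Fin d) ℝ) (ν : Fin d → Measure ℝ) :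
    Matrix (Fin d) (Fin d) ℝ :=
  A + B * Matrix.diagonal fun k => ∫ x, x ∂(ν k)

section Moments

variable [MeasurableSpace Ω]

/-- `y(t) = E[λ(t)]`. -/
def firstMoment (P : Measure Ω) (lam : ℝ≥0 → Ω → Fin d → ℝ) (t : ℝ≥0) : Fin d → ℝ :=
  fun i => ∫ ω, lam t ω i ∂P

/-- `V(t) = E[λ(t) λ(t)ᵀ]`. -/
def secondMoment (P : Measure Ω) (lam : ℝ≥0 → Ω → Fin d → ℝ) (t : ℝ≥0) :
    Matrix (Fin d) (Fin d) ℝ :=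
  Matrix.of fun i j => ∫ ω, lam t ω i * lam t ω j ∂P

/-- `C(t, h) = E[(λ(t+h) - E[λ(t+h)]) (λ(t) - E[λ(t)])ᵀ]`. -/
def autocovariance (P : Measure Ω) (lam : ℝ≥0 → Ω → Fin d → ℝ) (t h : ℝ≥0) :
    Matrix (Fin d) (Fin d) ℝ :=
  Matrix.of fun i j => ∫ ω, (lam (t + h) ω i - firstMoment P lam (t + h) i) *
    (lam t ω j - firstMoment P lam t j) ∂P

end Moments

end SelfExciting

end

noncomputable section
namespace SelfExciting

/-! ### Deterministic linear systems and dissipative matrices. -/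

section Deterministic

/-! Everything reduces to linear differential equations for moments, obtained by compensating the
jumps. For a nonnegative, square integrable, `𝓕 r`-measurable weight `Z`, the equation of λ,
multiplied by `Z` and averaged, gives for z(t) = E[Z λ(t)], t ≥ r, the system z' = M z - E[Z] A λ₀:
the events of type k arrive with intensity λ_k and have mean size ∫ x dν_k, so the jump term adds B
J to the drift matrix A (`integral_mul_intensity`). If M c = A λ₀, then z - E[Z] c evolves by the
exponential of M. The weight 1 yields y, and the weight λ_j(t) yields column j of E[λ(t+h) λ(t)ᵀ];
subtracting the product of the means gives the autocovariance formula.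

For the limit, the product formula for paths of finite variation gives, after compensation, a
Lyapunov equation V' = M V + V Mᵀ + (terms linear in y) (`integral_intensity_mul_intensity`).
Negative eigenvalues of M + Mᵀ mean that x · M x ≤ -a |x|² for some a > 0. This makes both M and the
operator V ↦ M V + V Mᵀ dissipative, and a dissipative linear system with convergent forcing
converges (`exists_tendsto_of_dissipative`). So y tends to c, V converges, and the limit may be
taken in the autocovariance formula.

Two points need care. The compensation formula holds for predictable integrands, so λ(s) is replaced
throughout by its left limit λ(s-). The two agree almost surely at each fixed time
(`ae_leftIntensity_eq`) and on almost every path for almost all times (`ae_ae_leftIntensity_eq`).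
Moreover, expectations may be taken only once λ is known to be square integrable. For this, the
squared norm is restricted to the predictable set where the past of λ is bounded by m. There it is
bounded, and it satisfies a Gronwall inequality whose constants do not depend on m; Fatou's lemma
removes the restriction (`exists_lintegral_energy_le`). -/

theorem continuousOn_of_integral_eq {x F : ℝ → ℝ} {x₀ : ℝ}
    (hF : ∀ t, 0 ≤ t → IntervalIntegrable F volume 0 t)
    (hx : ∀ t, 0 ≤ t → x t = x₀ + ∫ s in (0 : ℝ)..t, F s) : ContinuousOn x (Set.Ici 0) := by
  intro t ht
  have ht' : (0 : ℝ) ≤ t := ht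
  have h1 : ContinuousOn (fun t => x₀ + ∫ s in (0 : ℝ)..t, F s) (Set.Icc 0 (t + 1)) := by
    have := intervalIntegral.continuousOn_primitive_interval (μ := volume) (f := F) (a := 0)
      (b := t + 1) (by
        rw [Set.uIcc_of_le (by linarith)]
        exact (intervalIntegrable_iff_integrableOn_Icc_of_le (by linarith)).1
          (hF _ (by linarith)))
    rw [Set.uIcc_of_le (by linarith)] at this
    exact continuousOn_const.add this
  have h2 : ContinuousWithinAt x (Set.Icc 0 (t + 1)) t :=
    (h1 t ⟨ht', by linarith⟩).congr (fun s hs => hx s hs.1) (hx t ht')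
  refine h2.mono_of_mem_nhdsWithin ?_
  rw [← Set.Ici_inter_Iic]
  exact inter_mem_nhdsWithin _ (Iic_mem_nhds (by linarith))

theorem hasDerivWithinAt_of_integral_eq {x F : ℝ → ℝ} {x₀ : ℝ}
    (hF : ContinuousOn F (Set.Ici 0))
    (hx : ∀ t, 0 ≤ t → x t = x₀ + ∫ s in (0 : ℝ)..t, F s) {t : ℝ} (ht : 0 ≤ t) :
    HasDerivWithinAt x (F t) (Set.Ici t) t := by
  have hI : IntervalIntegrable F volume 0 t := by
    apply ContinuousOn.intervalIntegrable
    rw [Set.uIcc_of_le ht]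
    exact hF.mono Set.Icc_subset_Ici_self
  have h1 : HasDerivWithinAt (fun u => ∫ s in (0 : ℝ)..u, F s) (F t) (Set.Ici t) t := by
    refine intervalIntegral.integral_hasDerivWithinAt_right hI (t := Set.Ioi t) ?_ ?_
    · exact ⟨Set.Ioi t, self_mem_nhdsWithin, (hF.mono fun s hs => ht.trans
        (le_of_lt hs)).aestronglyMeasurable measurableSet_Ioi⟩
    · exact (hF t ht).mono fun s hs => ht.trans (le_of_lt hs)
  exact (h1.const_add x₀).congr (fun s hs => hx s (ht.trans hs)) (hx t ht)

/-- The function e^{-tM} z(t) is continuous with right derivative zero, hence constant.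
Integrability of z suffices as hypothesis because the integral equation itself upgrades z to a
continuous function, and then to a right differentiable one. -/
theorem eq_exp_mulVec_of_integral_eq {d : ℕ} (M : Matrix (Fin d) (Fin d) ℝ)
    (z : ℝ → Fin d → ℝ) (z₀ : Fin d → ℝ)
    (hI : ∀ t, 0 ≤ t → ∀ i, IntervalIntegrable (fun s => z s i) volume 0 t)
    (hz : ∀ t, 0 ≤ t → ∀ i, z t i = z₀ i + ∫ s in (0 : ℝ)..t, (M *ᵥ z s) i)
    {t : ℝ} (ht : 0 ≤ t) : z t = NormedSpace.exp (t • M) *ᵥ z₀ := by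
  -- A submultiplicative norm is chosen only to differentiate the exponential; its value depends on
  -- the topology alone.
  let _ : NormedRing (Matrix (Fin d) (Fin d) ℝ) := Matrix.linftyOpNormedRing
  let _ : NormedAlgebra ℝ (Matrix (Fin d) (Fin d) ℝ) := Matrix.linftyOpNormedAlgebra
  have hMI : ∀ i t, 0 ≤ t → IntervalIntegrable (fun s => (M *ᵥ z s) i) volume 0 t := by
    intro i t ht
    have : (fun s => (M *ᵥ z s) i) = fun s => ∑ j, M i j * z s j := by
      ext s; simp [Matrix.mulVec, dotProduct]
    rw [this]
    have := IntervalIntegrable.sum (μ := volume) (a := (0 : ℝ)) (b := t) Finset.univ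
      (f := fun j s => M i j * z s j) (fun j _ => (hI t ht j).const_mul (M i j))
    refine this.congr fun s _ => ?_
    simp
  have hzc : ∀ i, ContinuousOn (fun s => z s i) (Set.Ici 0) := fun i =>
    continuousOn_of_integral_eq (hMI i) (fun t ht => hz t ht i)
  have hzc' : ContinuousOn z (Set.Ici 0) := continuousOn_pi.2 hzc
  have hMc : ∀ i, ContinuousOn (fun s => (M *ᵥ z s) i) (Set.Ici 0) := fun i => by
    have : Continuous fun v : Fin d → ℝ => (M *ᵥ v) i := by fun_prop
    exact this.comp_continuousOn hzc'
  have hd : ∀ s, 0 ≤ s → HasDerivWithinAt z (M *ᵥ z s) (Set.Ici s) s := fun s hs =>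
    hasDerivWithinAt_pi.2 fun i =>
      hasDerivWithinAt_of_integral_eq (hMc i) (fun t ht => hz t ht i) hs
  have hcomm : ∀ s : ℝ, NormedSpace.exp (s • -M) * -M = -(NormedSpace.exp (s • -M) * M) := by
    intro s; rw [mul_neg]
  have hE : ∀ s : ℝ, HasDerivAt (fun u : ℝ => NormedSpace.exp (u • -M))
      (-(NormedSpace.exp (s • -M) * M)) s := fun s => by
    rw [← hcomm]
    exact hasDerivAt_exp_smul_const (-M) s
  let e : Matrix (Fin d) (Fin d) ℝ →L[ℝ] (Fin d → ℝ) →L[ℝ] (Fin d → ℝ) :=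
    LinearMap.toContinuousLinearMap
      ((LinearMap.toContinuousLinearMap : ((Fin d → ℝ) →ₗ[ℝ] (Fin d → ℝ)) ≃ₗ[ℝ] _).toLinearMap ∘ₗ
        (Matrix.toLin' : Matrix (Fin d) (Fin d) ℝ ≃ₗ[ℝ] _).toLinearMap)
  have he : ∀ A v, e A v = A *ᵥ v := fun A v => rfl
  have hw : ∀ s, 0 ≤ s → HasDerivWithinAt (fun u => e (NormedSpace.exp (u • -M)) (z u)) 0
      (Set.Ici s) s := by
    intro s hs
    have h1 : HasDerivWithinAt (fun u : ℝ => e (NormedSpace.exp (u • -M)))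
        (e (-(NormedSpace.exp (s • -M) * M))) (Set.Ici s) s :=
      (e.hasFDerivAt.comp_hasDerivAt s (hE s)).hasDerivWithinAt
    have h2 := h1.clm_apply (hd s hs)
    refine h2.congr_deriv ?_
    rw [he, he]
    simp [Matrix.neg_mulVec, Matrix.mulVec_mulVec]
  have hwc : ContinuousOn (fun u => e (NormedSpace.exp (u • -M)) (z u)) (Set.Icc 0 t) := by
    refine ContinuousOn.clm_apply ?_ (hzc'.mono Set.Icc_subset_Ici_self)
    refine e.continuous.comp_continuousOn ?_
    exact fun s _ => (hE s).continuousAt.continuousWithinAt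
  have hconst := constant_of_has_deriv_right_zero hwc (fun s hs => hw s hs.1) t ⟨ht, le_rfl⟩
  have hz0 : z 0 = z₀ := by
    ext i; simpa using hz 0 le_rfl i
  simp only [he, zero_smul, NormedSpace.exp_zero, Matrix.one_mulVec, hz0] at hconst
  rw [← hconst, Matrix.mulVec_mulVec, ← Matrix.exp_add_of_commute]
  · simp
  · simp [Commute, SemiconjBy]

/-- Energy estimate: the derivative of |z|² is at most -c|z|² + |g|²/c. Gronwall's inequality,
started at a time after which g is small, makes |z|² eventually small. -/
theorem tendsto_zero_of_dissipative {ι : Type*} [Fintype ι] (L : (ι → ℝ) → ι → ℝ) {c : ℝ}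
    (hc : 0 < c) (hL : ∀ x, x ⬝ᵥ L x ≤ -c * (x ⬝ᵥ x)) (z g : ℝ → ι → ℝ)
    (hzc : ∀ i, ContinuousOn (fun t => z t i) (Set.Ici 0))
    (hz : ∀ t, 0 ≤ t → ∀ i, HasDerivWithinAt (fun t => z t i) (L (z t) i + g t i) (Set.Ici t) t)
    (hg : ∀ i, Tendsto (fun t => g t i) atTop (𝓝 0)) (i : ι) :
    Tendsto (fun t => z t i) atTop (𝓝 0) := by
  have hgg : Tendsto (fun t => g t ⬝ᵥ g t) atTop (𝓝 0) := by
    have := tendsto_finsetSum (Finset.univ : Finset ι) (fun i _ => (hg i).mul (hg i))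
    simpa [dotProduct] using this
  have hzz : ContinuousOn (fun t => z t ⬝ᵥ z t) (Set.Ici 0) := by
    unfold dotProduct
    exact continuousOn_finsetSum _ fun i _ => (hzc i).mul (hzc i)
  have hder : ∀ t, 0 ≤ t → HasDerivWithinAt (fun t => z t ⬝ᵥ z t)
      (2 * (z t ⬝ᵥ (L (z t) + g t))) (Set.Ici t) t := by
    intro t ht
    unfold dotProduct
    have := HasDerivWithinAt.fun_sum (u := Finset.univ) fun i _ => (hz t ht i).mul (hz t ht i)
    refine (this.congr_deriv ?_ : HasDerivWithinAt (fun t => ∑ i, z t i * z t i) _ _ _)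
    rw [Finset.mul_sum]
    refine Finset.sum_congr rfl fun i _ => ?_
    simp; ring
  -- Young's inequality 2 z·g ≤ c|z|² + |g|²/c spends half of the available decay 2c|z|².
  have hbound : ∀ t, 2 * (z t ⬝ᵥ (L (z t) + g t)) ≤ -c * (z t ⬝ᵥ z t) + (g t ⬝ᵥ g t) / c := by
    intro t
    have h1 : 2 * (z t ⬝ᵥ g t) ≤ c * (z t ⬝ᵥ z t) + (g t ⬝ᵥ g t) / c := by
      have : 0 ≤ ∑ i, (c * z t i - g t i) ^ 2 / c :=
        Finset.sum_nonneg fun i _ => by positivity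
      have h2 : ∑ i, (c * z t i - g t i) ^ 2 / c =
          c * (z t ⬝ᵥ z t) + (g t ⬝ᵥ g t) / c - 2 * (z t ⬝ᵥ g t) := by
        simp only [dotProduct, Finset.mul_sum, Finset.sum_div, ← Finset.sum_add_distrib,
          ← Finset.sum_sub_distrib]
        refine Finset.sum_congr rfl fun i _ => ?_
        field_simp; ring
      linarith
    rw [dotProduct_add]
    have := hL (z t)
    linarith
  have hzz0 : Tendsto (fun t => z t ⬝ᵥ z t) atTop (𝓝 0) := by
    rw [Metric.tendsto_atTop]
    intro ε hε
    -- The threshold makes |g|²/c at most c(ε/2), so that the Gronwall bound with rate -c tends to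
    -- ε/2.
    obtain ⟨t₁, ht₁⟩ := Filter.eventually_atTop.1
      (hgg.eventually (gt_mem_nhds (show 0 < c ^ 2 * (ε / 2) by positivity)))
    set t₂ := max t₁ 0
    have hmain : ∀ t, t₂ ≤ t → z t ⬝ᵥ z t ≤
        gronwallBound (z t₂ ⬝ᵥ z t₂) (-c) (c * (ε / 2)) (t - t₂) := by
      intro t ht
      refine le_gronwallBound_of_liminf_deriv_right_le (f := fun t => z t ⬝ᵥ z t)
        (f' := fun t => 2 * (z t ⬝ᵥ (L (z t) + g t)))
        (hzz.mono fun s hs => (le_max_right t₁ 0).trans hs.1) ?_ le_rfl ?_ t ⟨ht, le_rfl⟩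
      · intro x hx r hr
        have := (hder x ((le_max_right t₁ 0).trans hx.1)).liminf_right_slope_le hr
        simpa [slope, vsub_eq_sub, smul_eq_mul] using this
      · intro x hx
        refine (hbound x).trans ?_
        have h1 := ht₁ x ((le_max_left t₁ 0).trans hx.1)
        have : (g x ⬝ᵥ g x) / c ≤ c * (ε / 2) := by
          rw [div_le_iff₀ hc]; nlinarith
        simpa using this
    have hlim : Tendsto (fun t => gronwallBound (z t₂ ⬝ᵥ z t₂) (-c) (c * (ε / 2)) (t - t₂))
        atTop (𝓝 (ε / 2)) := by
      have h0 : Tendsto (fun t => Real.exp (-c * (t - t₂))) atTop (𝓝 0) := by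
        refine Real.tendsto_exp_atBot.comp ?_
        refine Tendsto.const_mul_atTop_of_neg (by linarith) ?_
        exact tendsto_atTop_add_const_right _ _ tendsto_id
      have h1 := (h0.const_mul (z t₂ ⬝ᵥ z t₂)).add
        ((h0.sub_const 1).const_mul (c * (ε / 2) / -c))
      have h2 : (z t₂ ⬝ᵥ z t₂) * 0 + c * (ε / 2) / -c * (0 - 1) = ε / 2 := by
        field_simp; ring
      rw [h2] at h1
      refine h1.congr fun t => ?_
      rw [gronwallBound_of_K_ne_0 (by linarith)]
    obtain ⟨t₃, ht₃⟩ := Filter.eventually_atTop.1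
      (hlim.eventually (gt_mem_nhds (show ε / 2 < ε by linarith)))
    refine ⟨max t₂ t₃, fun t ht => ?_⟩
    have h1 := hmain t ((le_max_left _ _).trans ht)
    have h2 := ht₃ t ((le_max_right _ _).trans ht)
    have h3 : 0 ≤ z t ⬝ᵥ z t := Finset.sum_nonneg fun i _ => mul_self_nonneg _
    rw [Real.dist_eq, sub_zero, abs_of_nonneg h3]
    linarith
  have hsq : Tendsto (fun t => z t i * z t i) atTop (𝓝 0) :=
    squeeze_zero (fun t => mul_self_nonneg _)
      (fun t => Finset.single_le_sum (f := fun i => z t i * z t i)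
        (fun i _ => mul_self_nonneg _) (Finset.mem_univ i)) hzz0
  have := (Real.continuous_sqrt.tendsto 0).comp hsq
  rw [Real.sqrt_zero] at this
  refine (tendsto_zero_iff_abs_tendsto_zero _).2 (this.congr fun t => ?_)
  simp [Real.sqrt_mul_self_eq_abs]

/-- The quadratic forms of M and Mᵀ coincide, so x · M x is half the form of the symmetric matrix M
+ Mᵀ, whose negative is positive definite. Compactness of the unit sphere turns strict negativity
into a uniform constant, and homogeneity extends it to all vectors. -/
theorem exists_pos_dotProduct_mulVec_le {d : ℕ} (M : Matrix (Fin d) (Fin d) ℝ)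
    (h : ∀ γ : ℝ, Module.End.HasEigenvalue (Matrix.toLin' (M + Mᵀ)) γ → γ < 0) :
    ∃ c : ℝ, 0 < c ∧ ∀ x : Fin d → ℝ, x ⬝ᵥ (M *ᵥ x) ≤ -c * (x ⬝ᵥ x) := by
  have hS : (-(M + Mᵀ)).IsHermitian := by
    simp [Matrix.IsHermitian, add_comm]
  have hpd : (-(M + Mᵀ)).PosDef := by
    rw [hS.posDef_iff_eigenvalues_pos]
    intro i
    have h1 := hS.eigenvalues_mem_spectrum_real i
    rw [← spectrum.neg_eq, Set.mem_neg, ← Matrix.spectrum_toLin',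
      ← Module.End.hasEigenvalue_iff_mem_spectrum] at h1
    have := h _ h1
    linarith
  have hpos : ∀ x : Fin d → ℝ, x ≠ 0 → x ⬝ᵥ (M *ᵥ x) < 0 := by
    intro x hx
    have h1 := hpd.dotProduct_mulVec_pos hx
    have h2 : x ⬝ᵥ (Mᵀ *ᵥ x) = x ⬝ᵥ (M *ᵥ x) := by
      rw [Matrix.mulVec_transpose, dotProduct_comm, ← Matrix.dotProduct_mulVec]
    simp only [star_trivial, Matrix.neg_mulVec, Matrix.add_mulVec, dotProduct_neg,
      dotProduct_add, h2] at h1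
    linarith
  have hself : ∀ x : Fin d → ℝ, x ≠ 0 → 0 < x ⬝ᵥ x := fun x hx => by
    have h0 : 0 ≤ x ⬝ᵥ x := Finset.sum_nonneg fun i _ => mul_self_nonneg _
    exact lt_of_le_of_ne h0 fun h => hx (dotProduct_self_eq_zero.1 h.symm)
  have hcd : Continuous fun x : Fin d → ℝ => x ⬝ᵥ x := by unfold dotProduct; fun_prop
  have hcM : Continuous fun x : Fin d → ℝ => x ⬝ᵥ (M *ᵥ x) := by
    unfold dotProduct; fun_prop
  have hK : IsCompact {x : Fin d → ℝ | x ⬝ᵥ x = 1} := by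
    refine Metric.isCompact_of_isClosed_isBounded (isClosed_eq hcd continuous_const) ?_
    refine Metric.isBounded_closedBall (x := (0 : Fin d → ℝ)) (r := 1) |>.subset ?_
    intro x hx
    rw [mem_closedBall_zero_iff, pi_norm_le_iff_of_nonneg zero_le_one]
    intro i
    have h1 : x i * x i ≤ x ⬝ᵥ x :=
      Finset.single_le_sum (f := fun i => x i * x i) (fun i _ => mul_self_nonneg _)
        (Finset.mem_univ i)
    rw [Set.mem_ofPred_eq] at hx
    rw [Real.norm_eq_abs]
    exact abs_le_one_iff_mul_self_le_one.2 (h1.trans hx.le)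
  obtain ⟨c, hc, hcb⟩ : ∃ c : ℝ, 0 < c ∧ ∀ x : Fin d → ℝ, x ⬝ᵥ x = 1 → x ⬝ᵥ (M *ᵥ x) ≤ -c := by
    -- The sphere is empty when d = 0; any positive constant then works.
    rcases Set.eq_empty_or_nonempty {x : Fin d → ℝ | x ⬝ᵥ x = 1} with he | hne
    · refine ⟨1, one_pos, fun x hx => ?_⟩
      have : x ∈ (∅ : Set (Fin d → ℝ)) := he ▸ hx
      exact this.elim
    · obtain ⟨u, hu, hmax⟩ := hK.exists_isMaxOn hne hcM.continuousOn
      refine ⟨-(u ⬝ᵥ (M *ᵥ u)), ?_, fun x hx => ?_⟩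
      · have : u ≠ 0 := by
          rintro rfl
          simp at hu
        linarith [hpos u this]
      · simpa using hmax hx
  refine ⟨c, hc, fun x => ?_⟩
  rcases eq_or_ne x 0 with rfl | hx
  · simp
  · have hp := hself x hx
    set r := Real.sqrt (x ⬝ᵥ x) with hr
    have hr2 : r * r = x ⬝ᵥ x := Real.mul_self_sqrt hp.le
    have hrpos : 0 < r := Real.sqrt_pos.2 hp
    have h1 := hcb (r⁻¹ • x) (by
      simp only [dotProduct_smul, smul_dotProduct, smul_eq_mul, ← hr2]
      field_simp)
    simp only [Matrix.mulVec_smul, dotProduct_smul, smul_dotProduct, smul_eq_mul] at h1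
    have h2 : x ⬝ᵥ (M *ᵥ x) = (r * r) * (r⁻¹ * (r⁻¹ * (x ⬝ᵥ (M *ᵥ x)))) := by
      field_simp
    rw [h2, ← hr2]
    nlinarith [mul_pos hrpos hrpos]

end Deterministic

/-! ### Product formula for piecewise absolutely continuous paths. -/

section PathwiseProduct

theorem intervalIntegrable_step_mul {t σ c : ℝ} {q : ℝ → ℝ} (hq : IntervalIntegrable q volume 0 t) :
    IntervalIntegrable (fun s => (if σ ≤ s then c else 0) * q s) volume 0 t := by
  have h : (fun s => (if σ ≤ s then c else 0) * q s) = (Set.Ici σ).indicator fun s => c * q s := by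
    ext s; simp [Set.indicator_apply]
  rw [h]
  have := hq.const_mul c
  exact ⟨this.1.indicator measurableSet_Ici, this.2.indicator measurableSet_Ici⟩

theorem integral_step_mul {t σ c : ℝ} {q : ℝ → ℝ} (hq : IntervalIntegrable q volume 0 t)
    (h0 : 0 ≤ σ) (h1 : σ ≤ t) :
    ∫ s in (0 : ℝ)..t, (if σ ≤ s then c else 0) * q s =
      c * ((∫ s in (0 : ℝ)..t, q s) - ∫ s in (0 : ℝ)..σ, q s) := by
  have hσt : σ ∈ Set.uIcc 0 t := by rw [Set.uIcc_of_le (h0.trans h1)]; exact ⟨h0, h1⟩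
  have hq1 : IntervalIntegrable q volume 0 σ :=
    hq.mono_set (Set.uIcc_subset_uIcc_left hσt)
  have hs := intervalIntegrable_step_mul (σ := σ) (c := c) hq
  rw [intervalIntegral.integral_interval_sub_left hq hq1,
    ← intervalIntegral.integral_add_adjacent_intervals
      (hs.mono_set (Set.uIcc_subset_uIcc_left hσt)) (hs.mono_set (Set.uIcc_subset_uIcc_right hσt))]
  have e1 : ∫ s in (0 : ℝ)..σ, (if σ ≤ s then c else 0) * q s = 0 := by
    rw [intervalIntegral.integral_of_le h0, integral_Ioc_eq_integral_Ioo]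
    exact setIntegral_eq_zero_of_forall_eq_zero fun s hs => by simp [not_le.2 hs.2]
  have e2 : ∫ s in σ..t, (if σ ≤ s then c else 0) * q s = ∫ s in σ..t, c * q s := by
    refine intervalIntegral.integral_congr fun s hs => ?_
    rw [Set.uIcc_of_le h1] at hs
    simp [hs.1]
  rw [e1, e2, intervalIntegral.integral_const_mul, zero_add]

/-- Integration by parts for absolutely continuous functions. The integrands are merely integrable,
so the primitives have the expected derivatives only almost everywhere. -/
theorem mul_eq_of_primitives {t : ℝ} {p q : ℝ → ℝ} {x y : ℝ}
    (hp : IntervalIntegrable p volume 0 t) (hq : IntervalIntegrable q volume 0 t) :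
    (x + ∫ s in (0 : ℝ)..t, p s) * (y + ∫ s in (0 : ℝ)..t, q s) = x * y +
      ∫ s in (0 : ℝ)..t, ((x + ∫ r in (0 : ℝ)..s, p r) * q s +
        p s * (y + ∫ r in (0 : ℝ)..s, q r)) := by
  have hc : ∀ {x : ℝ} {p : ℝ → ℝ}, IntervalIntegrable p volume 0 t →
      AbsolutelyContinuousOnInterval (fun s => x + ∫ r in (0 : ℝ)..s, p r) 0 t := by
    intro x p hp
    have h1 : AbsolutelyContinuousOnInterval (fun _ : ℝ => x) 0 t :=
      (LipschitzWith.const x).lipschitzOnWith.absolutelyContinuousOnInterval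
    exact h1.add (hp.absolutelyContinuousOnInterval_intervalIntegral Set.left_mem_uIcc)
  have hd : ∀ {x : ℝ} {p : ℝ → ℝ}, IntervalIntegrable p volume 0 t →
      ∀ᵐ s : ℝ, s ∈ Set.uIoc 0 t → deriv (fun s => x + ∫ r in (0 : ℝ)..s, p r) s = p s := by
    intro x p hp
    filter_upwards [hp.ae_hasDerivAt_integral] with s hs hst
    exact ((hs (Set.uIoc_subset_uIcc hst) 0 Set.left_mem_uIcc).const_add x).deriv
  have h := (hc (x := x) hp).integral_deriv_mul_eq_sub (hc (x := y) hq)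
  rw [intervalIntegral.integral_congr_ae (g := fun s => (x + ∫ r in (0 : ℝ)..s, p r) * q s +
        p s * (y + ∫ r in (0 : ℝ)..s, q r))] at h
  · rw [h]; simp
  · filter_upwards [hd (x := x) hp, hd (x := y) hq] with s h1 h2 hs
    rw [h1 hs, h2 hs]; ring

/-- The value at time `s` of a path with initial value `x`, drift `p` and jumps `c n` at the
times `τ n`, `n ∈ S`. -/
def jumpPath (x : ℝ) (p : ℝ → ℝ) (S : Finset ℕ) (τ c : ℕ → ℝ) (s : ℝ) : ℝ :=
  x + (∫ r in (0 : ℝ)..s, p r) + ∑ n ∈ S, if τ n ≤ s then c n else 0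

/-- The left limit of `jumpPath` at time `s`. -/
def jumpPathLeft (x : ℝ) (p : ℝ → ℝ) (S : Finset ℕ) (τ c : ℕ → ℝ) (s : ℝ) : ℝ :=
  x + (∫ r in (0 : ℝ)..s, p r) + ∑ n ∈ S, if τ n < s then c n else 0

theorem intervalIntegrable_jumpPath_mul {t : ℝ} {x : ℝ} {p q : ℝ → ℝ} (S : Finset ℕ)
    (τ c : ℕ → ℝ) (hp : IntervalIntegrable p volume 0 t) (hq : IntervalIntegrable q volume 0 t) :
    IntervalIntegrable (fun s => jumpPath x p S τ c s * q s) volume 0 t := by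
  unfold jumpPath
  simp_rw [add_mul, Finset.sum_mul]
  refine IntervalIntegrable.add ?_ ?_
  · simp_rw [← add_mul]
    refine hq.continuousOn_mul ?_
    exact continuousOn_const.add (intervalIntegral.continuousOn_primitive_interval'
      hp Set.left_mem_uIcc)
  · have := IntervalIntegrable.sum (μ := volume) (a := (0 : ℝ)) (b := t) S
      (f := fun n s => (if τ n ≤ s then c n else 0) * q s)
      (fun n _ => intervalIntegrable_step_mul hq)
    refine this.congr fun s _ => ?_
    simp

theorem jumpPath_insert {x : ℝ} {p : ℝ → ℝ} {S : Finset ℕ} {τ c : ℕ → ℝ} {a : ℕ} (ha : a ∉ S)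
    (s : ℝ) : jumpPath x p (insert a S) τ c s =
      (if τ a ≤ s then c a else 0) + jumpPath x p S τ c s := by
  unfold jumpPath
  rw [Finset.sum_insert ha]; ring

theorem jumpPathLeft_insert {x : ℝ} {p : ℝ → ℝ} {S : Finset ℕ} {τ c : ℕ → ℝ} {a : ℕ} (ha : a ∉ S)
    (s : ℝ) : jumpPathLeft x p (insert a S) τ c s =
      (if τ a < s then c a else 0) + jumpPathLeft x p S τ c s := by
  unfold jumpPathLeft
  rw [Finset.sum_insert ha]; ring

/-- Splits a terminal value at a time where the path does not jump: past, later drift, later jumps.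
In the product formula σ is the time of the jump being inserted. -/
theorem jumpPath_eq_left_add {x : ℝ} {p : ℝ → ℝ} {S : Finset ℕ} {τ c : ℕ → ℝ} {t σ : ℝ}
    (hτ : ∀ n ∈ S, τ n ≤ t) (hσ : ∀ n ∈ S, τ n ≠ σ) :
    jumpPath x p S τ c t = jumpPathLeft x p S τ c σ +
      ((∫ r in (0 : ℝ)..t, p r) - ∫ r in (0 : ℝ)..σ, p r) +
      ∑ n ∈ S, if σ < τ n then c n else 0 := by
  unfold jumpPath jumpPathLeft
  have : ∑ n ∈ S, (if τ n ≤ t then c n else 0) =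
      ∑ n ∈ S, (if τ n < σ then c n else 0) + ∑ n ∈ S, (if σ < τ n then c n else 0) := by
    rw [← Finset.sum_add_distrib]
    refine Finset.sum_congr rfl fun n hn => ?_
    rw [if_pos (hτ n hn)]
    rcases lt_or_gt_of_ne (hσ n hn) with h | h
    · simp [h, h.le.not_gt]
    · simp [h, h.le.not_gt]
  rw [this]; ring

/-- The product formula for paths of finite variation with finitely many jumps. -/
theorem jumpPath_mul_jumpPath {t : ℝ} {p q : ℝ → ℝ} (x y : ℝ)
    (hp : IntervalIntegrable p volume 0 t) (hq : IntervalIntegrable q volume 0 t)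
    (τ c d : ℕ → ℝ) (S : Finset ℕ) (hτ : ∀ n ∈ S, 0 < τ n ∧ τ n ≤ t)
    (hinj : Set.InjOn τ S) :
    jumpPath x p S τ c t * jumpPath y q S τ d t = x * y +
      (∫ s in (0 : ℝ)..t, (jumpPath x p S τ c s * q s + jumpPath y q S τ d s * p s)) +
      ∑ n ∈ S, (jumpPathLeft x p S τ c (τ n) * d n + jumpPathLeft y q S τ d (τ n) * c n +
        c n * d n) := by
  -- Jumps are inserted in any order; integration by parts is the base case. If F and G are the old
  -- paths, a new jump at σ adds c_a G(t) + d_a F(t) + c_a d_a to the product. Splitting F(t) and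
  -- G(t) at σ matches this with the right side: the left values come from the new summand, the
  -- later drift from the integral, the later jumps from the old summands. Distinct jump times
  -- ensure that no old jump sits at σ.
  induction S using Finset.induction_on with
  | empty =>
    have := mul_eq_of_primitives (x := x) (y := y) hp hq
    simp only [jumpPath, Finset.sum_empty, add_zero, this]
    simp only [mul_comm (p _)]
  | insert a S ha ih =>
    have hτ' : ∀ n ∈ S, 0 < τ n ∧ τ n ≤ t := fun n hn => hτ n (Finset.mem_insert_of_mem hn)
    have hne : ∀ n ∈ S, τ n ≠ τ a := fun n hn h => by
      have := hinj (Finset.mem_coe.2 (Finset.mem_insert_of_mem hn))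
        (Finset.mem_coe.2 (Finset.mem_insert_self a S)) h
      exact ha (this ▸ hn)
    have ih' := ih hτ' (hinj.mono (by simp))
    obtain ⟨ha0, hat⟩ := hτ a (Finset.mem_insert_self a S)
    have hF := jumpPath_eq_left_add (x := x) (p := p) (c := c) (fun n hn => (hτ' n hn).2) hne
    have hG := jumpPath_eq_left_add (x := y) (p := q) (c := d) (fun n hn => (hτ' n hn).2) hne
    simp only [jumpPath_insert ha, jumpPathLeft_insert ha, Finset.sum_insert ha]
    have hint : ∫ s in (0 : ℝ)..t, (((if τ a ≤ s then c a else 0) + jumpPath x p S τ c s) * q s +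
        ((if τ a ≤ s then d a else 0) + jumpPath y q S τ d s) * p s) =
        (∫ s in (0 : ℝ)..t, (jumpPath x p S τ c s * q s + jumpPath y q S τ d s * p s)) +
        c a * ((∫ s in (0 : ℝ)..t, q s) - ∫ s in (0 : ℝ)..(τ a), q s) +
        d a * ((∫ s in (0 : ℝ)..t, p s) - ∫ s in (0 : ℝ)..(τ a), p s) := by
      rw [← integral_step_mul hq ha0.le hat, ← integral_step_mul hp ha0.le hat,
        ← intervalIntegral.integral_add
          ((intervalIntegrable_jumpPath_mul S τ c hp hq).add
            (intervalIntegrable_jumpPath_mul S τ d hq hp)) (intervalIntegrable_step_mul hq),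
        ← intervalIntegral.integral_add
          (((intervalIntegrable_jumpPath_mul S τ c hp hq).add
            (intervalIntegrable_jumpPath_mul S τ d hq hp)).add (intervalIntegrable_step_mul hq))
          (intervalIntegrable_step_mul hp)]
      refine intervalIntegral.integral_congr fun s _ => ?_
      ring
    rw [hint]
    have hsum : ∑ n ∈ S, (((if τ a < τ n then c a else 0) + jumpPathLeft x p S τ c (τ n)) * d n +
        ((if τ a < τ n then d a else 0) + jumpPathLeft y q S τ d (τ n)) * c n + c n * d n) =
        ∑ n ∈ S, (jumpPathLeft x p S τ c (τ n) * d n + jumpPathLeft y q S τ d (τ n) * c n +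
          c n * d n) + c a * ∑ n ∈ S, (if τ a < τ n then d n else 0) +
        d a * ∑ n ∈ S, (if τ a < τ n then c n else 0) := by
      rw [Finset.mul_sum, Finset.mul_sum, ← Finset.sum_add_distrib, ← Finset.sum_add_distrib]
      refine Finset.sum_congr rfl fun n _ => ?_
      split_ifs <;> ring
    rw [hsum, if_pos hat, if_pos hat, if_neg (lt_irrefl _), if_neg (lt_irrefl _)]
    linear_combination ih' + c a * hG + d a * hF

theorem tendsto_jumpPath_left {t : ℝ} {x : ℝ} {p : ℝ → ℝ} (S : Finset ℕ) (τ c : ℕ → ℝ)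
    (hp : IntervalIntegrable p volume 0 t) {s : ℝ} (hs : 0 < s) (hst : s ≤ t) :
    Tendsto (jumpPath x p S τ c) (𝓝[<] s) (𝓝 (jumpPathLeft x p S τ c s)) := by
  unfold jumpPath jumpPathLeft
  refine (tendsto_const_nhds.add ?_).add (tendsto_finsetSum _ fun n _ => ?_)
  · have h1 := intervalIntegral.continuousOn_primitive_interval' hp Set.left_mem_uIcc
    rw [Set.uIcc_of_le (hs.le.trans hst)] at h1
    refine (h1 s ⟨hs.le, hst⟩).mono_left ?_
    refine nhdsWithin_le_iff.2 ?_
    filter_upwards [Ioo_mem_nhdsLT hs] with r hr using ⟨hr.1.le, hr.2.le.trans hst⟩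
  · refine tendsto_const_nhds.congr' ?_
    rcases lt_or_ge (τ n) s with h | h
    · filter_upwards [Ioo_mem_nhdsLT h] with r hr
      simp [h, hr.1.le]
    · filter_upwards [self_mem_nhdsWithin] with r hr
      have hr' : r < s := hr
      simp [h.not_gt, (hr'.trans_le h).not_ge]

theorem jumpPathLeft_eq_jumpPath {x : ℝ} {p : ℝ → ℝ} {S : Finset ℕ} {τ c : ℕ → ℝ} {s : ℝ}
    (hs : ∀ n ∈ S, τ n ≠ s) : jumpPathLeft x p S τ c s = jumpPath x p S τ c s := by
  unfold jumpPath jumpPathLeft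
  congr 1
  refine Finset.sum_congr rfl fun n hn => ?_
  simp [(hs n hn).le_iff_lt]

end PathwiseProduct

/-! ### Gronwall's inequality in [0, ∞]. -/

section Gronwall

/-- A Gronwall inequality for bounded functions with values in `[0, ∞]`. -/
theorem le_of_le_add_mul_lintegral {u : ℝ → ℝ≥0∞} {a C : ℝ≥0∞} {K : ℝ} {t₀ : ℝ} (hK : 0 < K)
    (hC : C ≠ ⊤) (hb : ∀ t ∈ Set.Icc 0 t₀, u t ≤ C)
    (hu : ∀ t ∈ Set.Icc 0 t₀, u t ≤ a + ENNReal.ofReal K * ∫⁻ s in Set.Icc 0 t, u s) :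
    ∀ t ∈ Set.Icc 0 t₀, u t ≤ 2 * a * ENNReal.ofReal (Real.exp (2 * K * t)) := by
  -- For the supremum norm weighted with rate 2K, the integral operator with factor K has norm at
  -- most 1/2, which leads to S ≤ a + S/2. No measurability of u enters.
  set S : ℝ≥0∞ := ⨆ t ∈ Set.Icc 0 t₀, u t * ENNReal.ofReal (Real.exp (-(2 * K * t))) with hS
  have hSC : S ≤ C := by
    refine iSup₂_le fun t ht => ?_
    calc u t * ENNReal.ofReal (Real.exp (-(2 * K * t))) ≤ C * 1 := by
          gcongr
          · exact hb t ht
          · rw [← ENNReal.ofReal_one]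
            refine ENNReal.ofReal_le_ofReal (Real.exp_le_one_iff.2 ?_)
            have := ht.1
            nlinarith
      _ = C := mul_one C
  have hST : S ≠ ⊤ := ne_top_of_le_ne_top hC hSC
  have hexp : ∀ t : ℝ, ENNReal.ofReal (Real.exp (-(2 * K * t))) *
      ENNReal.ofReal (Real.exp (2 * K * t)) = 1 := by
    intro t
    rw [← ENNReal.ofReal_mul (Real.exp_pos _).le, ← Real.exp_add]
    simp
  have huS : ∀ t ∈ Set.Icc 0 t₀, u t ≤ S * ENNReal.ofReal (Real.exp (2 * K * t)) := by
    intro t ht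
    have h1 : u t * ENNReal.ofReal (Real.exp (-(2 * K * t))) ≤ S :=
      le_iSup₂ (f := fun t (_ : t ∈ Set.Icc 0 t₀) =>
        u t * ENNReal.ofReal (Real.exp (-(2 * K * t)))) t ht
    calc u t = u t * ENNReal.ofReal (Real.exp (-(2 * K * t))) *
          ENNReal.ofReal (Real.exp (2 * K * t)) := by rw [mul_assoc, hexp, mul_one]
      _ ≤ _ := by gcongr
  have hint : ∀ t, 0 ≤ t → ∫⁻ s in Set.Icc 0 t, ENNReal.ofReal (Real.exp (2 * K * s)) ≤
      ENNReal.ofReal (Real.exp (2 * K * t) / (2 * K)) := by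
    intro t ht
    rw [← ofReal_integral_eq_lintegral_ofReal]
    · refine ENNReal.ofReal_le_ofReal ?_
      rw [integral_Icc_eq_integral_Ioc, ← intervalIntegral.integral_of_le ht,
        intervalIntegral.integral_comp_mul_left (fun x => Real.exp x) (by positivity)]
      simp only [integral_exp, smul_eq_mul]
      rw [div_eq_inv_mul]
      gcongr
      simp
    · exact (by fun_prop : Continuous fun s => Real.exp (2 * K * s)).integrableOn_Icc
    · exact Eventually.of_forall fun s => (Real.exp_pos _).le
  have hmain : ∀ t ∈ Set.Icc 0 t₀, u t * ENNReal.ofReal (Real.exp (-(2 * K * t))) ≤ a + S / 2 := by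
    intro t ht
    have h1 : ENNReal.ofReal K * ∫⁻ s in Set.Icc 0 t, u s ≤
        S / 2 * ENNReal.ofReal (Real.exp (2 * K * t)) := by
      calc ENNReal.ofReal K * ∫⁻ s in Set.Icc 0 t, u s
          ≤ ENNReal.ofReal K * ∫⁻ s in Set.Icc 0 t, S * ENNReal.ofReal (Real.exp (2 * K * s)) := by
            gcongr 1
            exact setLIntegral_mono' measurableSet_Icc fun s hs => huS s ⟨hs.1, hs.2.trans ht.2⟩
        _ = S * (ENNReal.ofReal K * ∫⁻ s in Set.Icc 0 t, ENNReal.ofReal (Real.exp (2 * K * s))) := by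
            rw [lintegral_const_mul' _ _ hST]; ring
        _ ≤ S * (ENNReal.ofReal K * ENNReal.ofReal (Real.exp (2 * K * t) / (2 * K))) := by
            gcongr
            exact hint t ht.1
        _ = S / 2 * ENNReal.ofReal (Real.exp (2 * K * t)) := by
            rw [← ENNReal.ofReal_mul hK.le]
            have : K * (Real.exp (2 * K * t) / (2 * K)) = 2⁻¹ * Real.exp (2 * K * t) := by
              field_simp
            rw [this, ENNReal.ofReal_mul (by norm_num), ← mul_assoc, div_eq_mul_inv,
              ENNReal.ofReal_inv_of_pos (by norm_num)]
            simp
    calc u t * ENNReal.ofReal (Real.exp (-(2 * K * t)))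
        ≤ (a + S / 2 * ENNReal.ofReal (Real.exp (2 * K * t))) *
            ENNReal.ofReal (Real.exp (-(2 * K * t))) := by
          gcongr
          exact (hu t ht).trans (by gcongr)
      _ = a * ENNReal.ofReal (Real.exp (-(2 * K * t))) + S / 2 := by
          rw [add_mul, mul_assoc (S / 2), mul_comm (ENNReal.ofReal (Real.exp (2 * K * t))), hexp,
            mul_one]
      _ ≤ a * 1 + S / 2 := by
          gcongr
          rw [← ENNReal.ofReal_one]
          refine ENNReal.ofReal_le_ofReal (Real.exp_le_one_iff.2 ?_)
          have := ht.1
          nlinarith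
      _ = _ := by rw [mul_one]
  have hS2 : S ≤ 2 * a := by
    have h1 : S / 2 + S / 2 ≤ a + S / 2 := by
      rw [ENNReal.add_halves]
      exact iSup₂_le hmain
    -- Cancelling S/2 needs S finite. This is the only role of the a priori bound C, which does not
    -- appear in the conclusion.
    have h2 : S / 2 ≤ a := (ENNReal.add_le_add_iff_right (ENNReal.div_ne_top hST (by simp))).1 h1
    calc S = 2 * (S / 2) := by rw [two_mul, ENNReal.add_halves]
      _ ≤ 2 * a := by gcongr
  intro t ht
  exact (huS t ht).trans (by gcongr)

end Gronwall

/-! ### Predictability, measurability of event sums, and the compensation formula with marks. -/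

section Measurability

variable {Ω : Type*} {d : ℕ} [mΩ : MeasurableSpace Ω] {P : Measure Ω} {𝓕 : Filtration ℝ≥0 mΩ}
  {μ : ℝ≥0 → (Fin d → ℝ) → (Fin d → ℝ)} {B : Matrix (Fin d) (Fin d) ℝ}
  {κ : Fin d → Kernel (Fin d → ℝ) ℝ} {l : Fin d → ℝ} {T : ℕ → Ω → ℝ≥0∞} {X : ℕ → Ω → Fin d}
  {Y : ℕ → Ω → ℝ} {lam : ℝ≥0 → Ω → Fin d → ℝ}

theorem predictable_le_prod (𝓕 : Filtration ℝ≥0 mΩ) :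
    𝓕.predictable ≤ (inferInstance : MeasurableSpace (ℝ≥0 × Ω)) :=
  measurableSpace_le_predictable_of_measurableSet
    (fun A hA => (measurableSet_singleton _).prod (𝓕.le _ A hA))
    (fun _ A hA => measurableSet_Ioi.prod (𝓕.le _ A hA))

theorem measurable_fst_predictable (𝓕 : Filtration ℝ≥0 mΩ) :
    Measurable[𝓕.predictable] (Prod.fst : ℝ≥0 × Ω → ℝ≥0) := by
  refine @measurable_of_Ioi _ _ _ _ _ 𝓕.predictable _ _ _ _ fun a => ?_
  have : (Prod.fst : ℝ≥0 × Ω → ℝ≥0) ⁻¹' Set.Ioi a = Set.Ioi a ×ˢ Set.univ := by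
    ext; simp
  rw [this]
  exact measurableSet_predictable_Ioi_prod MeasurableSet.univ

/-- A process `1_{s > r} Z` with `Z` measurable at time `r` is predictable. -/
theorem measurable_predictable_indicator {β : Type*} [MeasurableSpace β] [Zero β] {r : ℝ≥0}
    {Z : Ω → β} (hZ : Measurable[𝓕 r] Z) :
    Measurable[𝓕.predictable] (fun p : ℝ≥0 × Ω => (Set.Ioi r).indicator (fun _ => Z p.2) p.1) := by
  classical
  intro D hD
  have h0 : MeasurableSet[𝓕.predictable] ((Set.Ioi r : Set ℝ≥0) ×ˢ (Set.univ : Set Ω)) :=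
    measurableSet_predictable_Ioi_prod MeasurableSet.univ
  have h1 : MeasurableSet[𝓕.predictable] (Set.Ioi r ×ˢ (Z ⁻¹' D)) :=
    measurableSet_predictable_Ioi_prod (hZ hD)
  by_cases h : (0 : β) ∈ D
  · convert @MeasurableSet.union _ 𝓕.predictable _ _ h1 (@MeasurableSet.compl _ _ 𝓕.predictable h0)
      using 1
    ext ⟨s, ω⟩
    by_cases hs : r < s <;> simp [hs, h, Set.indicator]
  · convert h1 using 1
    ext ⟨s, ω⟩
    by_cases hs : r < s <;> simp [hs, h, Set.indicator]

/-- The process of left limits is predictable. -/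
theorem measurable_leftLim_predictable (hA : ∀ t, Measurable[𝓕 t] (lam t))
    (hL : ∀ ω t, ∃ x, Tendsto (fun s => lam s ω) (𝓝[<] t) (𝓝 x)) :
    Measurable[𝓕.predictable]
      (fun p : ℝ≥0 × Ω => Function.leftLim (fun s => lam s p.2) p.1) := by
  -- For s > 0 this is the last point of the grid of mesh 1/(n+1) strictly before s; the ceiling
  -- minus one, rather than the floor, gives strictness. Sampling λ there yields a process constant
  -- on left-open, right-closed grid intervals, hence predictable, and converging to the left limit.
  -- At s = 0 truncated subtraction gives the point 0, in accordance with the convention that the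
  -- left limit there is the value itself.
  let r : ℕ → ℝ≥0 → ℝ≥0 := fun n s => ((⌈s * (n + 1)⌉₊ - 1 : ℕ) : ℝ≥0) / (n + 1)
  have hr0 : ∀ n, r n 0 = 0 := fun n => by simp [r]
  have hrlt : ∀ n s, 0 < s → r n s < s := by
    intro n s hs
    have hpos : 0 < s * (n + 1) := by positivity
    have h1 : ((⌈s * (n + 1)⌉₊ - 1 : ℕ) : ℝ≥0) < s * (n + 1) := by
      rw [← Nat.lt_ceil]
      have := Nat.ceil_pos.2 hpos
      omega
    exact (div_lt_iff₀ (by positivity)).2 h1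
  have hrge : ∀ n s, s ≤ r n s + 1 / (n + 1) := by
    intro n s
    have h1 : s * (n + 1) ≤ ((⌈s * (n + 1)⌉₊ - 1 : ℕ) : ℝ≥0) + 1 := by
      refine (Nat.le_ceil _).trans ?_
      have : ⌈s * (n + 1)⌉₊ ≤ ⌈s * (n + 1)⌉₊ - 1 + 1 := by omega
      exact_mod_cast this
    simp only [r]
    rw [← add_div]
    exact (le_div_iff₀ (by positivity)).2 h1
  have hrt : ∀ s, 0 < s → Tendsto (fun n => r n s) atTop (𝓝[<] s) := by
    intro s hs
    refine tendsto_nhdsWithin_iff.2 ⟨?_, Eventually.of_forall fun n => hrlt n s hs⟩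
    have h1 : Tendsto (fun n : ℕ => s - 1 / ((n : ℝ≥0) + 1)) atTop (𝓝 (s - 0)) :=
      tendsto_const_nhds.sub tendsto_one_div_add_atTop_nhds_zero_nat
    rw [tsub_zero] at h1
    exact tendsto_of_tendsto_of_tendsto_of_le_of_le h1 tendsto_const_nhds
      (fun n => tsub_le_iff_right.2 (hrge n s)) (fun n => (hrlt n s hs).le)
  refine @measurable_of_tendsto_metrizable _ _ 𝓕.predictable _ _ _ _
    (fun n p => lam (r n p.1) p.2) _ (fun n => ?_) ?_
  · intro D hD
    have hset : (fun p : ℝ≥0 × Ω => lam (r n p.1) p.2) ⁻¹' D =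
        ({⊥} ×ˢ (lam 0 ⁻¹' D)) ∪ ⋃ j : ℕ, Set.Ioc ((j : ℝ≥0) / (n + 1)) (((j + 1 : ℕ) : ℝ≥0) / (n + 1))
          ×ˢ (lam ((j : ℝ≥0) / (n + 1)) ⁻¹' D) := by
      ext ⟨s, ω⟩
      have hj : ∀ j : ℕ, s ∈ Set.Ioc ((j : ℝ≥0) / (n + 1)) (((j + 1 : ℕ) : ℝ≥0) / (n + 1)) →
          r n s = (j : ℝ≥0) / (n + 1) := by
        intro j hj
        have h1 := (div_lt_iff₀ (by positivity)).1 hj.1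
        have h2 := (le_div_iff₀ (by positivity)).1 hj.2
        have : ⌈s * (n + 1)⌉₊ = j + 1 := by
          rw [Nat.ceil_eq_iff (by omega)]
          exact ⟨by simpa using h1, h2⟩
        simp [r, this]
      simp only [Set.mem_preimage, Set.mem_union, Set.mem_prod, Set.mem_singleton_iff,
        Set.mem_iUnion]
      constructor
      · intro h
        rcases eq_zero_or_pos s with rfl | hs
        · left; rw [hr0] at h; exact ⟨rfl, h⟩
        · right
          refine ⟨⌈s * (n + 1)⌉₊ - 1, ⟨hrlt n s hs, ?_⟩, h⟩
          have := hrge n s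
          simpa [r, add_div] using this
      · rintro (⟨rfl, h⟩ | ⟨j, hjs, h⟩)
        · simpa [bot_eq_zero, hr0] using h
        · rw [hj j hjs]; exact h
    rw [hset]
    refine @MeasurableSet.union _ 𝓕.predictable _ _
      (measurableSet_predictable_singleton_bot_prod (hA 0 hD))
      (@MeasurableSet.iUnion _ _ 𝓕.predictable _ _ fun j =>
        measurableSet_predictable_Ioc_prod _ _ (hA _ hD))
  · refine tendsto_pi_nhds.2 fun p => ?_
    rcases eq_zero_or_pos p.1 with h | h
    · rw [leftLim_eq_of_isBot (by rw [h]; exact fun a => zero_le)]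
      simp_rw [h, hr0]
      exact tendsto_const_nhds
    · obtain ⟨x, hx⟩ := hL p.2 p.1
      have : (𝓝[<] p.1).NeBot := nhdsLT_neBot_of_exists_lt ⟨0, h⟩
      rw [leftLim_eq_of_tendsto hx]
      exact hx.comp (hrt _ h)

theorem measurable_time
    (hev : ∀ (n : ℕ) (t : ℝ≥0) (k : Fin d) (D : Set ℝ), MeasurableSet D →
      MeasurableSet[𝓕 t] {ω | T n ω ≤ t ∧ X n ω = k ∧ Y n ω ∈ D}) (n : ℕ) : Measurable (T n) := by
  refine measurable_of_Iic fun a => ?_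
  induction a using ENNReal.recTopCoe with
  | top => simp
  | coe t =>
    have : T n ⁻¹' Set.Iic (t : ℝ≥0∞) = ⋃ k, {ω | T n ω ≤ t ∧ X n ω = k ∧ Y n ω ∈ Set.univ} := by
      ext; simp
    rw [this]
    exact MeasurableSet.iUnion fun k => 𝓕.le t _ (hev n t k _ MeasurableSet.univ)

theorem measurableSet_isEvent_inter
    (hev : ∀ (n : ℕ) (t : ℝ≥0) (k : Fin d) (D : Set ℝ), MeasurableSet D →
      MeasurableSet[𝓕 t] {ω | T n ω ≤ t ∧ X n ω = k ∧ Y n ω ∈ D}) (k : Fin d) (n : ℕ)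
    {D : Set ℝ} (hD : MeasurableSet D) :
    MeasurableSet {ω | IsEvent T X k n ω ∧ Y n ω ∈ D} := by
  have : {ω | IsEvent T X k n ω ∧ Y n ω ∈ D} =
      ⋃ N : ℕ, {ω | T n ω ≤ ((N : ℝ≥0) : ℝ≥0∞) ∧ X n ω = k ∧ Y n ω ∈ D} := by
    ext ω
    simp only [IsEvent, Set.mem_ofPred_eq, Set.mem_iUnion, exists_and_right]
    constructor
    · rintro ⟨⟨h1, h2⟩, h3⟩
      obtain ⟨N, hN⟩ := ENNReal.exists_nat_gt h1
      exact ⟨⟨N, by simpa using hN.le⟩, h2, h3⟩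
    · rintro ⟨⟨N, hN⟩, h2, h3⟩
      exact ⟨⟨ne_top_of_le_ne_top ENNReal.coe_ne_top hN, h2⟩, h3⟩
  rw [this]
  exact MeasurableSet.iUnion fun N => 𝓕.le _ _ (hev n N k D hD)

open Classical in
theorem measurable_event_term
    (hev : ∀ (n : ℕ) (t : ℝ≥0) (k : Fin d) (D : Set ℝ), MeasurableSet D →
      MeasurableSet[𝓕 t] {ω | T n ω ≤ t ∧ X n ω = k ∧ Y n ω ∈ D}) (k : Fin d) (n : ℕ)
    {f : ℝ≥0 × Ω → ℝ≥0∞} (hf : Measurable f) {g : ℝ → ℝ≥0∞} (hg : Measurable g) :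
    Measurable fun ω => if IsEvent T X k n ω then f ((T n ω).toNNReal, ω) * g (Y n ω) else 0 := by
  have hE : MeasurableSet {ω | IsEvent T X k n ω} := by
    simpa using measurableSet_isEvent_inter hev k n MeasurableSet.univ
  -- Adaptedness of the events controls `Y n` only where `T n` is finite. Replacing it by 0 off the
  -- event does not change the term.
  have hY : Measurable fun ω => if IsEvent T X k n ω then Y n ω else 0 := by
    intro D hD
    have h1 := measurableSet_isEvent_inter hev k n hD
    by_cases h : (0 : ℝ) ∈ D
    · convert h1.union hE.compl using 1
      ext ω
      by_cases hω : IsEvent T X k n ω <;> simp [hω, h]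
    · convert h1 using 1
      ext ω
      by_cases hω : IsEvent T X k n ω <;> simp [hω, h]
  have hT := measurable_time hev n
  have : (fun ω => if IsEvent T X k n ω then f ((T n ω).toNNReal, ω) * g (Y n ω) else 0) =
      fun ω => if IsEvent T X k n ω then f ((T n ω).toNNReal, ω) *
        g (if IsEvent T X k n ω then Y n ω else 0) else 0 := by
    ext ω
    split_ifs <;> rfl
  rw [this]
  exact Measurable.ite hE ((hf.comp (hT.ennreal_toNNReal.prodMk measurable_id)).mul
    (hg.comp hY)) measurable_const

theorem measurable_eventSum
    (hev : ∀ (n : ℕ) (t : ℝ≥0) (k : Fin d) (D : Set ℝ), MeasurableSet D →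
      MeasurableSet[𝓕 t] {ω | T n ω ≤ t ∧ X n ω = k ∧ Y n ω ∈ D}) (k : Fin d)
    {f : ℝ≥0 × Ω → ℝ≥0∞} (hf : Measurable f) {g : ℝ → ℝ≥0∞} (hg : Measurable g) :
    Measurable (eventSum T X k f fun n ω => g (Y n ω)) :=
  Measurable.tsum fun n => measurable_event_term hev k n hf hg

/-- Marks with a law that does not depend on the past are independent of predictable integrands. -/
theorem lintegral_eventSum_mark (ν : Fin d → Measure ℝ)
    (hproc : IsSelfExcitingProcess P 𝓕 μ B (fun k => Kernel.const (Fin d → ℝ) (ν k)) l T X Y lam)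
    (k : Fin d) {f : ℝ≥0 × Ω → ℝ≥0∞} (hf : Measurable[𝓕.predictable] f)
    {g : ℝ → ℝ≥0∞} (hg : Measurable g) :
    ∫⁻ ω, eventSum T X k f (fun n ω => g (Y n ω)) ω ∂P =
      (∫⁻ x, g x ∂(ν k)) * ∫⁻ ω, (∫⁻ s in Set.Ici (0 : ℝ),
        f (s.toNNReal, ω) * ENNReal.ofReal (lam s.toNNReal ω k)) ∂P := by
  classical
  have hf' : Measurable f := hf.mono (predictable_le_prod 𝓕) le_rfl
  have hev := hproc.adapted_events
  rw [← hproc.intensity k f hf]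
  -- For indicators g the claim is the law of the sizes, whose kernel is constant; sums and monotone
  -- limits give every measurable g.
  refine Measurable.ennreal_induction (motive := fun g =>
    ∫⁻ ω, eventSum T X k f (fun n ω => g (Y n ω)) ω ∂P =
      (∫⁻ x, g x ∂(ν k)) * ∫⁻ ω, eventSum T X k f (fun _ _ => 1) ω ∂P) ?_ ?_ ?_ hg
  · intro c D hD
    have h1 : ∀ ω, eventSum T X k f (fun n ω => D.indicator (fun _ => c) (Y n ω)) ω =
        c * eventSum T X k f (fun n ω => D.indicator 1 (Y n ω)) ω := by
      intro ω
      unfold eventSum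
      rw [← ENNReal.tsum_mul_left]
      refine tsum_congr fun n => ?_
      by_cases hY : Y n ω ∈ D <;> split_ifs <;> simp [hY, mul_comm]
    have h2 : ∀ ω, eventSum T X k f (fun n ω => (fun k => Kernel.const (Fin d → ℝ) (ν k)) k
        (Function.leftLim (fun s => lam s ω) (T n ω).toNNReal) D) ω =
        ν k D * eventSum T X k f (fun _ _ => 1) ω := by
      intro ω
      unfold eventSum
      rw [← ENNReal.tsum_mul_left]
      refine tsum_congr fun n => ?_
      split_ifs <;> simp [mul_comm]
    have hm1 : Measurable (eventSum T X k f fun n ω => D.indicator 1 (Y n ω)) :=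
      measurable_eventSum hev k hf' (measurable_one.indicator hD)
    have hm2 : Measurable (eventSum T X k f fun _ _ => 1) :=
      measurable_eventSum hev k hf' (g := fun _ => 1) measurable_const
    simp_rw [h1]
    rw [lintegral_const_mul _ hm1, hproc.size_law k f hf D hD]
    simp_rw [h2]
    rw [lintegral_const_mul _ hm2, lintegral_indicator_const hD, mul_assoc]
  · intro g₁ g₂ _ hg₁ hg₂ ih₁ ih₂
    have h1 : ∀ ω, eventSum T X k f (fun n ω => (g₁ + g₂) (Y n ω)) ω =
        eventSum T X k f (fun n ω => g₁ (Y n ω)) ω +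
          eventSum T X k f (fun n ω => g₂ (Y n ω)) ω := by
      intro ω
      unfold eventSum
      rw [← ENNReal.tsum_add]
      refine tsum_congr fun n => ?_
      split_ifs <;> simp [mul_add]
    simp_rw [h1]
    rw [lintegral_add_left (measurable_eventSum hev k hf' hg₁), ih₁, ih₂, ← add_mul]
    simp only [Pi.add_apply]
    rw [lintegral_add_left hg₁]
  · intro g hg hmono ih
    have h1 : ∀ ω, eventSum T X k f (fun n ω => (⨆ m, g m (Y n ω))) ω =
        ⨆ m, eventSum T X k f (fun n ω => g m (Y n ω)) ω := by
      intro ω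
      unfold eventSum
      -- Written as an integral for the counting measure, the sum exchanges with the supremum by
      -- monotone convergence.
      simp_rw [← lintegral_count]
      rw [← lintegral_iSup (fun m => measurable_from_top)]
      · refine lintegral_congr fun n => ?_
        split_ifs
        · rw [ENNReal.mul_iSup]
        · simp
      · intro m m' hm n
        simp only
        split_ifs
        · gcongr
          exact hmono hm _
        · exact le_rfl
    simp_rw [h1]
    rw [lintegral_iSup (fun m => measurable_eventSum hev k hf' (hg m)), lintegral_iSup hg hmono,
      ENNReal.iSup_mul]
    · simp_rw [ih]
    · intro m m' hm ω
      unfold eventSum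
      refine ENNReal.tsum_le_tsum fun n => ?_
      split_ifs
      · gcongr
        exact hmono hm _
      · exact le_rfl

end Measurability

/-! ### Path properties of the intensity and of its left limits. -/

section Pathwise

section

variable {Ω : Type*} {d : ℕ} {l : Fin d → ℝ} {T : ℕ → Ω → ℝ≥0∞} {X : ℕ → Ω → Fin d}
  {lam : ℝ≥0 → Ω → Fin d → ℝ}

/-- The process of left limits `λ(t-)` of the intensity. -/
def leftIntensity (lam : ℝ≥0 → Ω → Fin d → ℝ) (s : ℝ≥0) (ω : Ω) : Fin d → ℝ :=
  Function.leftLim (fun r => lam r ω) s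

/-- The restriction of a process to the times up to `t`. -/
def upTo (t : ℝ≥0) (f : ℝ≥0 × Ω → ℝ≥0∞) (p : ℝ≥0 × Ω) : ℝ≥0∞ :=
  if p.1 ≤ t then f p else 0

theorem leftIntensity_zero (ω : Ω) : leftIntensity lam 0 ω = lam 0 ω :=
  leftLim_eq_of_isBot fun _ => zero_le

theorem leftIntensity_eq_jumpPathLeft {ω : Ω} {t : ℝ≥0} {S : Finset ℕ} {p : Fin d → ℝ → ℝ}
    {τ : ℕ → ℝ} {c : Fin d → ℕ → ℝ} (hp : ∀ i, IntervalIntegrable (p i) volume 0 t)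
    (h : ∀ s : ℝ≥0, s ≤ t → ∀ i, lam s ω i = jumpPath (l i) (p i) S τ (c i) s)
    {s : ℝ≥0} (hs : 0 < s) (hst : s ≤ t) (i : Fin d) :
    leftIntensity lam s ω i = jumpPathLeft (l i) (p i) S τ (c i) s := by
  have : (𝓝[<] s).NeBot := nhdsLT_neBot_of_exists_lt ⟨0, hs⟩
  have hlim : Tendsto (fun r => lam r ω) (𝓝[<] s)
      (𝓝 fun i => jumpPathLeft (l i) (p i) S τ (c i) s) := by
    refine tendsto_pi_nhds.2 fun i => ?_
    have h1 := tendsto_jumpPath_left (x := l i) S τ (c i) (hp i) (s := (s : ℝ))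
      (by exact_mod_cast hs) (by exact_mod_cast hst)
    have h2 : Tendsto (fun r : ℝ≥0 => (r : ℝ)) (𝓝[<] s) (𝓝[<] (s : ℝ)) := by
      refine tendsto_nhdsWithin_iff.2 ⟨?_, ?_⟩
      · exact (NNReal.continuous_coe.tendsto s).mono_left nhdsWithin_le_nhds
      · filter_upwards [self_mem_nhdsWithin] with r hr
        exact_mod_cast hr
    refine (h1.comp h2).congr' ?_
    filter_upwards [self_mem_nhdsWithin] with r hr
    exact (h r ((le_of_lt hr).trans hst) i).symm
  unfold leftIntensity
  rw [leftLim_eq_of_tendsto hlim]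

/-- Links the real-valued path identities with the compensation formulas, which live in [0, ∞]. -/
theorem eventSum_eq_ofReal {ω : Ω} {t : ℝ≥0} {S : Finset ℕ} (hS : ∀ n, n ∈ S ↔ T n ω ≤ t)
    {k : Fin d} {f : ℝ≥0 × Ω → ℝ≥0∞} {w : ℕ → Ω → ℝ≥0∞} {g : ℝ≥0 → ℝ} {h : ℕ → ℝ}
    (hg : ∀ s, 0 ≤ g s) (hh : ∀ n, 0 ≤ h n) (hf : ∀ s, f (s, ω) = ENNReal.ofReal (g s))
    (hw : ∀ n, w n ω = ENNReal.ofReal (h n)) :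
    eventSum T X k (upTo t f) w ω =
      ENNReal.ofReal (∑ n ∈ S, if X n ω = k then g (T n ω).toNNReal * h n else 0) := by
  classical
  unfold eventSum
  rw [tsum_eq_sum (s := S), ENNReal.ofReal_sum_of_nonneg]
  · refine Finset.sum_congr rfl fun n hn => ?_
    have hT := (hS n).1 hn
    have hne : T n ω ≠ ⊤ := ne_top_of_le_ne_top ENNReal.coe_ne_top hT
    by_cases hX : X n ω = k
    · have hle : (T n ω).toNNReal ≤ t := ENNReal.coe_le_coe.1 ((ENNReal.coe_toNNReal hne).le.trans hT)
      simp [IsEvent, hne, hX, upTo, hle, hf, hw, ENNReal.ofReal_mul (hg _)]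
    · simp [IsEvent, hX]
  · intro n _
    split_ifs
    · exact mul_nonneg (hg _) (hh n)
    · exact le_rfl
  · intro n hn
    rw [hS] at hn
    split_ifs with hE
    · have hle : ¬ (T n ω).toNNReal ≤ t := fun h => hn (by
        rw [← ENNReal.coe_toNNReal hE.1]; exact_mod_cast h)
      simp [upTo, hle]
    · rfl

end

variable {Ω : Type*} {d : ℕ} [mΩ : MeasurableSpace Ω] {P : Measure Ω} {𝓕 : Filtration ℝ≥0 mΩ}
  {μ : ℝ≥0 → (Fin d → ℝ) → (Fin d → ℝ)} {B : Matrix (Fin d) (Fin d) ℝ}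
  {κ : Fin d → Kernel (Fin d → ℝ) ℝ} {l : Fin d → ℝ} {T : ℕ → Ω → ℝ≥0∞} {X : ℕ → Ω → Fin d}
  {Y : ℕ → Ω → ℝ} {lam : ℝ≥0 → Ω → Fin d → ℝ}

theorem measurable_upTo (t : ℝ≥0) {f : ℝ≥0 × Ω → ℝ≥0∞} (hf : Measurable[𝓕.predictable] f) :
    Measurable[𝓕.predictable] (upTo t f) :=
  Measurable.ite (measurable_fst_predictable 𝓕 measurableSet_Iic) hf measurable_const

/-- Until any finite time, the paths of the intensity have finitely many jumps. -/
theorem ae_eq_jumpPath (hproc : IsSelfExcitingProcess P 𝓕 μ B κ l T X Y lam) :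
    ∀ᵐ ω ∂P, ∀ t : ℝ≥0, ∃ S : Finset ℕ, (∀ n, n ∈ S ↔ T n ω ≤ t) ∧
      (∀ n ∈ S, 0 < (T n ω).toReal ∧ (T n ω).toReal ≤ t) ∧
      Set.InjOn (fun n => (T n ω).toReal) S ∧
      (∀ i, IntervalIntegrable (fun r : ℝ => μ r.toNNReal (lam r.toNNReal ω) i) volume 0 t) ∧
      ∀ s : ℝ≥0, s ≤ t → ∀ i, lam s ω i =
        jumpPath (l i) (fun r => μ r.toNNReal (lam r.toNNReal ω) i) S (fun n => (T n ω).toReal)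
          (fun n => B i (X n ω) * Y n ω) s := by
  filter_upwards [hproc.time_pos, hproc.time_mono, hproc.time_strict, hproc.nonexplosive,
    hproc.drift_integrable, hproc.equation] with ω hpos hmono hstrict hexp hdrift heq t
  have hfin : {n | T n ω ≤ t}.Finite := by
    obtain ⟨N, hN⟩ := eventually_atTop.1
      (hexp.eventually (lt_mem_nhds (ENNReal.coe_lt_top (r := t))))
    refine (Set.finite_lt_nat N).subset fun n hn => ?_
    by_contra h
    exact absurd (hN n (not_lt.1 h)) (not_lt.2 hn)
  have hS : ∀ n, n ∈ hfin.toFinset ↔ T n ω ≤ t := fun n => by simp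
  have hne : ∀ n ∈ hfin.toFinset, T n ω ≠ ⊤ := fun n hn =>
    ne_top_of_le_ne_top ENNReal.coe_ne_top ((hS n).1 hn)
  have hcomp : ∀ i (s : ℝ≥0),
      IntervalIntegrable (fun r : ℝ => μ r.toNNReal (lam r.toNNReal ω) i) volume 0 s := by
    intro i s
    have := hdrift s
    exact ⟨(ContinuousLinearMap.proj (R := ℝ) (φ := fun _ : Fin d => ℝ) i).integrable_comp this.1,
      (ContinuousLinearMap.proj (R := ℝ) (φ := fun _ : Fin d => ℝ) i).integrable_comp this.2⟩
  refine ⟨hfin.toFinset, hS, ?_, ?_, fun i => hcomp i t, ?_⟩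
  · intro n hn
    have h0 : 0 < T n ω := hpos.trans_le (hmono (Nat.zero_le n))
    exact ⟨ENNReal.toReal_pos h0.ne' (hne n hn),
      ENNReal.toReal_le_coe_of_le_coe ((hS n).1 hn)⟩
  · have hlt : ∀ m n, m < n → n ∈ hfin.toFinset → T m ω < T n ω := by
      intro m n hmn hn
      have h1 : T (m + 1) ω ≤ T n ω := hmono hmn
      have h2 : T m ω ≠ ⊤ := ne_top_of_le_ne_top (hne n hn) (hmono hmn.le)
      exact (hstrict m h2).trans_le h1
    intro m hm n hn h
    rw [ENNReal.toReal_eq_toReal_iff' (hne m hm) (hne n hn)] at h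
    by_contra hmn
    rcases lt_or_gt_of_ne hmn with h' | h'
    · exact (hlt m n h' hn).ne h
    · exact (hlt n m h' hm).ne' h
  · intro s hs i
    have h1 := congrFun (heq s) i
    rw [h1]
    simp only [Pi.add_apply, jumpPath]
    congr 1
    · congr 1
      exact ((ContinuousLinearMap.proj (R := ℝ) (φ := fun _ : Fin d => ℝ)
        i).intervalIntegral_comp_comm (hdrift s)).symm
    · classical
      have hcs : ∀ k, compound T X Y s ω k =
          ∑ n ∈ hfin.toFinset, if T n ω ≤ s ∧ X n ω = k then Y n ω else 0 := by
        intro k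
        unfold compound
        rw [tsum_eq_sum (s := hfin.toFinset)]
        intro n hn
        rw [hS] at hn
        rw [if_neg]
        exact fun h => hn (h.1.trans (by exact_mod_cast hs))
      simp only [Matrix.mulVec, dotProduct, hcs, Finset.mul_sum]
      rw [Finset.sum_comm]
      refine Finset.sum_congr rfl fun n hn => ?_
      have hiff : (T n ω).toReal ≤ s ↔ T n ω ≤ s := by
        rw [← ENNReal.coe_toReal, ENNReal.toReal_le_toReal (hne n hn) ENNReal.coe_ne_top]
      simp only [hiff]
      by_cases hle : T n ω ≤ s
      · simp [hle]
      · simp [hle]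

theorem tendsto_leftIntensity (hproc : IsSelfExcitingProcess P 𝓕 μ B κ l T X Y lam) (ω : Ω)
    {s : ℝ≥0} (hs : 0 < s) :
    Tendsto (fun r => lam r ω) (𝓝[<] s) (𝓝 (leftIntensity lam s ω)) := by
  obtain ⟨x, hx⟩ := hproc.left_limits ω s
  have : (𝓝[<] s).NeBot := nhdsLT_neBot_of_exists_lt ⟨0, hs⟩
  unfold leftIntensity
  rwa [leftLim_eq_of_tendsto hx]

theorem leftIntensity_mem (hproc : IsSelfExcitingProcess P 𝓕 μ B κ l T X Y lam) {ω : Ω}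
    {s : ℝ≥0} {C : Set (Fin d → ℝ)} (hC : IsClosed C) (h0 : s = 0 → lam 0 ω ∈ C)
    (h : ∀ r < s, lam r ω ∈ C) : leftIntensity lam s ω ∈ C := by
  rcases eq_zero_or_pos s with rfl | hs
  · rw [leftIntensity_zero]; exact h0 rfl
  · have : (𝓝[<] s).NeBot := nhdsLT_neBot_of_exists_lt ⟨0, hs⟩
    refine hC.mem_of_tendsto (tendsto_leftIntensity hproc ω hs) ?_
    filter_upwards [self_mem_nhdsWithin] with r hr using h r hr

theorem ae_leftIntensity_nonneg (hproc : IsSelfExcitingProcess P 𝓕 μ B κ l T X Y lam) :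
    ∀ᵐ ω ∂P, ∀ s i, 0 ≤ leftIntensity lam s ω i := by
  filter_upwards [hproc.intensity_nonneg] with ω h s i
  have hC : IsClosed {x : Fin d → ℝ | 0 ≤ x i} := isClosed_le continuous_const (continuous_apply i)
  exact leftIntensity_mem hproc hC (fun _ => h 0 i) (fun r _ => h r i)

theorem ae_leftIntensity_eq_of_ne (hproc : IsSelfExcitingProcess P 𝓕 μ B κ l T X Y lam) :
    ∀ᵐ ω ∂P, ∀ s : ℝ≥0, (∀ n, T n ω ≠ s) → leftIntensity lam s ω = lam s ω := by
  filter_upwards [ae_eq_jumpPath hproc] with ω h s hs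
  rcases eq_zero_or_pos s with rfl | hs0
  · exact leftIntensity_zero ω
  · obtain ⟨S, hS, -, -, hp, hpath⟩ := h s
    ext i
    rw [leftIntensity_eq_jumpPathLeft hp hpath hs0 le_rfl, hpath s le_rfl,
      jumpPathLeft_eq_jumpPath]
    intro n hn hτ
    refine hs n ?_
    have hne : T n ω ≠ ⊤ := ne_top_of_le_ne_top ENNReal.coe_ne_top ((hS n).1 hn)
    rw [← ENNReal.ofReal_toReal hne, hτ, ENNReal.ofReal_coe_nnreal]

/-- A path jumps only at its countably many event times. Hence λ(s) may be replaced by λ(s-) in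
every integral over time. -/
theorem ae_ae_leftIntensity_eq (hproc : IsSelfExcitingProcess P 𝓕 μ B κ l T X Y lam) :
    ∀ᵐ ω ∂P, ∀ᵐ s : ℝ, leftIntensity lam s.toNNReal ω = lam s.toNNReal ω := by
  filter_upwards [ae_leftIntensity_eq_of_ne hproc] with ω h
  have hc : (Set.range fun n => (T n ω).toReal).Countable := Set.countable_range _
  filter_upwards [hc.ae_notMem volume] with s hs
  rcases le_or_gt s 0 with h0 | h0
  · rw [Real.toNNReal_of_nonpos h0, leftIntensity_zero]
  · refine h _ fun n hn => hs ⟨n, ?_⟩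
    simp only [hn, ENNReal.coe_toReal]
    exact Real.coe_toNNReal s h0.le

/-- The intensity formula for the indicator of the single time s integrates over a Lebesgue null
set, so the expected number of events at s is zero and almost surely there is no jump at s. -/
theorem ae_leftIntensity_eq (hproc : IsSelfExcitingProcess P 𝓕 μ B κ l T X Y lam) (s : ℝ≥0) :
    ∀ᵐ ω ∂P, leftIntensity lam s ω = lam s ω := by
  classical
  have hf : Measurable[𝓕.predictable] fun p : ℝ≥0 × Ω => if p.1 = s then (1 : ℝ≥0∞) else 0 :=
    Measurable.ite (measurable_fst_predictable 𝓕 (measurableSet_singleton s)) measurable_const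
      measurable_const
  have hzero : ∀ k, ∀ᵐ ω ∂P, eventSum T X k (fun p => if p.1 = s then (1 : ℝ≥0∞) else 0)
      (fun _ _ => 1) ω = 0 := by
    intro k
    have hm : Measurable (eventSum T X k (fun p : ℝ≥0 × Ω => if p.1 = s then (1 : ℝ≥0∞) else 0)
        fun _ _ => 1) :=
      measurable_eventSum hproc.adapted_events k (hf.mono (predictable_le_prod 𝓕) le_rfl)
        (g := fun _ => 1) measurable_const
    refine (lintegral_eq_zero_iff hm).1 ?_
    rw [hproc.intensity k _ hf]
    refine (lintegral_congr fun ω => ?_).trans lintegral_zero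
    refine (setLIntegral_congr_fun_ae (g := fun _ => 0) measurableSet_Ici ?_).trans lintegral_zero
    filter_upwards [(Set.countable_singleton (s : ℝ)).ae_notMem volume] with r hr hr0
    have : r.toNNReal ≠ s := fun h => hr (by
      rw [Set.mem_singleton_iff, ← h, Real.coe_toNNReal r hr0])
    simp [this]
  filter_upwards [ae_leftIntensity_eq_of_ne hproc, ae_all_iff.2 hzero] with ω h h0
  refine h s fun n hn => ?_
  have h1 := ENNReal.tsum_eq_zero.1 (h0 (X n ω)) n
  simp [IsEvent, hn] at h1

/-- The product formula for the components of the intensity. -/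
theorem ae_intensity_mul_intensity (hproc : IsSelfExcitingProcess P 𝓕 μ B κ l T X Y lam) :
    ∀ᵐ ω ∂P, ∀ (t : ℝ≥0) (i j : Fin d), lam t ω i * lam t ω j = l i * l j +
      (∫ s in (0 : ℝ)..t, (lam s.toNNReal ω i * μ s.toNNReal (lam s.toNNReal ω) j +
        lam s.toNNReal ω j * μ s.toNNReal (lam s.toNNReal ω) i)) +
      ∑ k, (B j k * (eventSum T X k (upTo t fun p => ENNReal.ofReal (leftIntensity lam p.1 p.2 i))
            (fun n ω => ENNReal.ofReal (Y n ω)) ω).toReal +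
          B i k * (eventSum T X k (upTo t fun p => ENNReal.ofReal (leftIntensity lam p.1 p.2 j))
            (fun n ω => ENNReal.ofReal (Y n ω)) ω).toReal +
          B i k * B j k * (eventSum T X k (upTo t fun _ => 1)
            (fun n ω => ENNReal.ofReal (Y n ω ^ 2)) ω).toReal) := by
  filter_upwards [ae_eq_jumpPath hproc, ae_leftIntensity_nonneg hproc, hproc.size_nonneg]
    with ω h hL hY t i j
  obtain ⟨S, hS, hτ, hinj, hp, hpath⟩ := h t
  have hprod := jumpPath_mul_jumpPath (l i) (l j) (hp i) (hp j) (fun n => (T n ω).toReal)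
    (fun n => B i (X n ω) * Y n ω) (fun n => B j (X n ω) * Y n ω) S hτ hinj
  rw [← hpath t le_rfl i, ← hpath t le_rfl j] at hprod
  rw [hprod]
  congr 1
  · congr 1
    refine intervalIntegral.integral_congr fun s hs => ?_
    rw [Set.uIcc_of_le t.coe_nonneg] at hs
    have hst : s.toNNReal ≤ t := Real.toNNReal_le_iff_le_coe.2 hs.2
    have hs' : ((s.toNNReal : ℝ≥0) : ℝ) = s := Real.coe_toNNReal s hs.1
    simp only [hpath _ hst i, hpath _ hst j, hs']
  · have e1 : ∀ (i k : Fin d), (eventSum T X k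
        (upTo t fun p => ENNReal.ofReal (leftIntensity lam p.1 p.2 i))
        (fun n ω => ENNReal.ofReal (Y n ω)) ω).toReal =
        ∑ n ∈ S, if X n ω = k then leftIntensity lam (T n ω).toNNReal ω i * Y n ω else 0 := by
      intro i k
      rw [eventSum_eq_ofReal hS (g := fun s => leftIntensity lam s ω i) (h := fun n => Y n ω)
        (fun s => hL s i) hY (fun _ => rfl) (fun _ => rfl), ENNReal.toReal_ofReal]
      refine Finset.sum_nonneg fun n _ => ?_
      split_ifs
      · exact mul_nonneg (hL _ i) (hY n)
      · exact le_rfl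
    have e2 : ∀ k : Fin d, (eventSum T X k (upTo t fun _ => 1)
        (fun n ω => ENNReal.ofReal (Y n ω ^ 2)) ω).toReal =
        ∑ n ∈ S, if X n ω = k then Y n ω ^ 2 else 0 := by
      intro k
      rw [eventSum_eq_ofReal hS (g := fun _ => 1) (h := fun n => Y n ω ^ 2)
        (fun _ => zero_le_one) (fun n => sq_nonneg _) (fun _ => by simp) (fun _ => rfl),
        ENNReal.toReal_ofReal]
      · simp only [one_mul]
      · refine Finset.sum_nonneg fun n _ => ?_
        split_ifs <;> positivity
    simp only [e1, e2, Finset.mul_sum, ← Finset.sum_add_distrib]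
    rw [Finset.sum_comm]
    refine Finset.sum_congr rfl fun n hn => ?_
    have hne : T n ω ≠ ⊤ := ne_top_of_le_ne_top ENNReal.coe_ne_top ((hS n).1 hn)
    have hleft : ∀ i, leftIntensity lam (T n ω).toNNReal ω i =
        jumpPathLeft (l i) (fun r => μ r.toNNReal (lam r.toNNReal ω) i) S
          (fun n => (T n ω).toReal) (fun n => B i (X n ω) * Y n ω) (T n ω).toReal := by
      intro i
      exact leftIntensity_eq_jumpPathLeft hp hpath
        (by exact_mod_cast (hτ n hn).1) (by exact_mod_cast (hτ n hn).2) i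
    simp only [← hleft]
    rw [Finset.sum_eq_single (X n ω)]
    · simp only [if_true]; ring
    · intro k _ hk
      simp [hk.symm]
    · simp

/-- Finitely many events up to t make the sums finite, so that their real parts in the product
formula can be turned back into elements of [0, ∞] without loss. -/
theorem ae_eventSum_ne_top (hproc : IsSelfExcitingProcess P 𝓕 μ B κ l T X Y lam) :
    ∀ᵐ ω ∂P, ∀ (t : ℝ≥0) (k i : Fin d),
      eventSum T X k (upTo t fun p => ENNReal.ofReal (leftIntensity lam p.1 p.2 i))
        (fun n ω => ENNReal.ofReal (Y n ω)) ω ≠ ⊤ ∧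
      eventSum T X k (upTo t fun _ => 1) (fun n ω => ENNReal.ofReal (Y n ω ^ 2)) ω ≠ ⊤ := by
  filter_upwards [ae_eq_jumpPath hproc, ae_leftIntensity_nonneg hproc, hproc.size_nonneg]
    with ω h hL hY t k i
  obtain ⟨S, hS, -, -, -, -⟩ := h t
  rw [eventSum_eq_ofReal hS (g := fun s => leftIntensity lam s ω i) (h := fun n => Y n ω)
        (fun s => hL s i) hY (fun _ => rfl) (fun _ => rfl),
      eventSum_eq_ofReal hS (g := fun _ => 1) (h := fun n => Y n ω ^ 2)
        (fun _ => zero_le_one) (fun n => sq_nonneg _) (fun _ => by simp) (fun _ => rfl)]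
  exact ⟨ENNReal.ofReal_ne_top, ENNReal.ofReal_ne_top⟩

/-- The increments of the intensity, weighted with a nonnegative random variable. -/
theorem ae_mul_intensity_sub (hproc : IsSelfExcitingProcess P 𝓕 μ B κ l T X Y lam)
    (r : ℝ≥0) {Z : Ω → ℝ} (hZ : ∀ᵐ ω ∂P, 0 ≤ Z ω) :
    ∀ᵐ ω ∂P, ∀ t : ℝ≥0, r ≤ t → ∀ i : Fin d, Z ω * lam t ω i = Z ω * lam r ω i +
      (∫ s in (r : ℝ)..t, Z ω * μ s.toNNReal (lam s.toNNReal ω) i) +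
      ∑ k, B i k * (eventSum T X k
        (upTo t fun p => (Set.Ioi r).indicator (fun _ => ENNReal.ofReal (Z p.2)) p.1)
        (fun n ω => ENNReal.ofReal (Y n ω)) ω).toReal := by
  filter_upwards [ae_eq_jumpPath hproc, hZ, hproc.size_nonneg] with ω h hZ hY t hrt i
  obtain ⟨S, hS, -, -, hp, hpath⟩ := h t
  have e1 : ∀ k, (eventSum T X k
        (upTo t fun p => (Set.Ioi r).indicator (fun _ => ENNReal.ofReal (Z p.2)) p.1)
        (fun n ω => ENNReal.ofReal (Y n ω)) ω).toReal =
        ∑ n ∈ S, if X n ω = k then (Set.Ioi r).indicator (fun _ => Z ω) (T n ω).toNNReal * Y n ω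
          else 0 := by
    intro k
    rw [eventSum_eq_ofReal hS (g := (Set.Ioi r).indicator (fun _ => Z ω)) (h := fun n => Y n ω)
      (fun s => Set.indicator_nonneg (fun _ _ => hZ) s) hY ?_ (fun _ => rfl),
      ENNReal.toReal_ofReal]
    · refine Finset.sum_nonneg fun n _ => ?_
      split_ifs
      · exact mul_nonneg (Set.indicator_nonneg (fun _ _ => hZ) _) (hY n)
      · exact le_rfl
    · intro s
      by_cases hs : r < s <;> simp [hs, Set.indicator]
  have hrt' : (r : ℝ) ≤ t := by exact_mod_cast hrt
  have hr : IntervalIntegrable (fun s : ℝ => μ s.toNNReal (lam s.toNNReal ω) i) volume 0 r :=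
    (hp i).mono_set (Set.uIcc_subset_uIcc_left (by
      rw [Set.uIcc_of_le t.coe_nonneg]; exact ⟨r.2, hrt'⟩))
  rw [intervalIntegral.integral_const_mul, hpath t le_rfl i, hpath r hrt i,
    ← intervalIntegral.integral_interval_sub_left (hp i) hr]
  simp only [e1, Finset.mul_sum, jumpPath]
  rw [Finset.sum_comm]
  have hsum : ∀ n ∈ S, ∑ k, B i k * (if X n ω = k then
      (Set.Ioi r).indicator (fun _ => Z ω) (T n ω).toNNReal * Y n ω else 0) =
      Z ω * (if (T n ω).toReal ≤ t then B i (X n ω) * Y n ω else 0) -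
        Z ω * (if (T n ω).toReal ≤ r then B i (X n ω) * Y n ω else 0) := by
    intro n hn
    have hle : (T n ω).toReal ≤ t := ENNReal.toReal_le_coe_of_le_coe ((hS n).1 hn)
    rw [Finset.sum_eq_single (X n ω), if_pos rfl, if_pos hle]
    · by_cases hnr : (T n ω).toReal ≤ r
      · have : ¬ r < (T n ω).toNNReal := not_lt.2 (by exact_mod_cast hnr)
        simp [hnr, Set.indicator, this]
      · have : r < (T n ω).toNNReal := by
          rw [not_le] at hnr
          exact_mod_cast hnr
        simp [hnr, Set.indicator, this]
        ring
    · intro k _ hk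
      simp [hk.symm]
    · simp
  rw [Finset.sum_congr rfl hsum, Finset.sum_sub_distrib, ← Finset.mul_sum, ← Finset.mul_sum]
  ring

end Pathwise

/-! ### Compensation up to a fixed time, and localization to a bounded past. -/

section Localization

variable {Ω : Type*} {d : ℕ} [mΩ : MeasurableSpace Ω] {P : Measure Ω} {𝓕 : Filtration ℝ≥0 mΩ}
  {μ : ℝ≥0 → (Fin d → ℝ) → (Fin d → ℝ)} {A B : Matrix (Fin d) (Fin d) ℝ}
  {κ : Fin d → Kernel (Fin d → ℝ) ℝ} {l₀ l : Fin d → ℝ} {ν : Fin d → Measure ℝ}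
  {T : ℕ → Ω → ℝ≥0∞} {X : ℕ → Ω → Fin d} {Y : ℕ → Ω → ℝ} {lam : ℝ≥0 → Ω → Fin d → ℝ}

theorem measurable_leftIntensity_predictable
    (hproc : IsSelfExcitingProcess P 𝓕 μ B κ l T X Y lam) :
    Measurable[𝓕.predictable] (fun p : ℝ≥0 × Ω => leftIntensity lam p.1 p.2) :=
  measurable_leftLim_predictable hproc.adapted_intensity hproc.left_limits

theorem measurable_leftIntensity (hproc : IsSelfExcitingProcess P 𝓕 μ B κ l T X Y lam) :
    Measurable (fun p : ℝ≥0 × Ω => leftIntensity lam p.1 p.2) :=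
  (measurable_leftIntensity_predictable hproc).mono (predictable_le_prod 𝓕) le_rfl

theorem measurable_leftIntensity_apply (hproc : IsSelfExcitingProcess P 𝓕 μ B κ l T X Y lam)
    (i : Fin d) : Measurable (fun p : ℝ≥0 × Ω => leftIntensity lam p.1 p.2 i) :=
  (measurable_pi_apply i).comp (measurable_leftIntensity hproc)

/-- The compensation formula with marks, on a bounded time interval. -/
theorem lintegral_eventSum_upTo [SFinite P]
    (hproc : IsSelfExcitingProcess P 𝓕 μ B (fun k => Kernel.const (Fin d → ℝ) (ν k)) l T X Y lam)
    (k : Fin d) (t : ℝ≥0) {f : ℝ≥0 × Ω → ℝ≥0∞} (hf : Measurable[𝓕.predictable] f)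
    {g : ℝ → ℝ≥0∞} (hg : Measurable g) :
    ∫⁻ ω, eventSum T X k (upTo t f) (fun n ω => g (Y n ω)) ω ∂P =
      (∫⁻ x, g x ∂(ν k)) * ∫⁻ s in Set.Icc (0 : ℝ) t, ∫⁻ ω,
        f (s.toNNReal, ω) * ENNReal.ofReal (leftIntensity lam s.toNNReal ω k) ∂P := by
  rw [lintegral_eventSum_mark ν hproc k (measurable_upTo t hf) hg]
  congr 1
  have hf' : Measurable f := hf.mono (predictable_le_prod 𝓕) le_rfl
  -- The passage to left limits also serves Tonelli's theorem: being predictable, λ(s-) is jointly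
  -- measurable in time and ω.
  have h1 : ∀ᵐ ω ∂P, ∫⁻ s in Set.Ici (0 : ℝ),
        upTo t f (s.toNNReal, ω) * ENNReal.ofReal (lam s.toNNReal ω k) =
      ∫⁻ s in Set.Icc (0 : ℝ) t,
        f (s.toNNReal, ω) * ENNReal.ofReal (leftIntensity lam s.toNNReal ω k) := by
    filter_upwards [ae_ae_leftIntensity_eq hproc] with ω hω
    rw [← lintegral_indicator measurableSet_Ici, ← lintegral_indicator measurableSet_Icc]
    refine lintegral_congr_ae ?_
    filter_upwards [hω] with s hs
    by_cases h0 : 0 ≤ s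
    · by_cases hst : s ≤ t
      · have : s.toNNReal ≤ t := Real.toNNReal_le_iff_le_coe.2 hst
        simp [h0, hst, upTo, this, hs]
      · have : ¬ s.toNNReal ≤ t := fun h => hst (Real.toNNReal_le_iff_le_coe.1 h)
        simp [h0, hst, upTo, this]
    · simp [h0]
  rw [lintegral_congr_ae h1, lintegral_lintegral_swap]
  have hφ : Measurable fun p : Ω × ℝ => (p.2.toNNReal, p.1) :=
    (measurable_real_toNNReal.comp measurable_snd).prodMk measurable_fst
  exact ((hf'.comp hφ).mul
    ((measurable_leftIntensity_apply hproc k).comp hφ).ennreal_ofReal).aemeasurable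

/-- Right continuity and left limits bound the path near each time; compactness of the time interval
does the rest. -/
theorem exists_norm_le_of_le (hproc : IsSelfExcitingProcess P 𝓕 μ B κ l T X Y lam) (ω : Ω)
    (t : ℝ≥0) : ∃ C : ℝ, ∀ s ≤ t, ‖lam s ω‖ ≤ C := by
  have h : ∃ C : ℝ, ∀ s ∈ Set.Icc 0 t, ‖lam s ω‖ ≤ C := by
    refine (isCompact_Icc (a := (0 : ℝ≥0)) (b := t)).induction_on
      (p := fun s => ∃ C : ℝ, ∀ r ∈ s, ‖lam r ω‖ ≤ C) ⟨0, by simp⟩ ?_ ?_ ?_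
    · rintro s s' hss ⟨C, hC⟩
      exact ⟨C, fun r hr => hC r (hss hr)⟩
    · rintro s s' ⟨C, hC⟩ ⟨C', hC'⟩
      refine ⟨max C C', fun r hr => ?_⟩
      rcases hr with hr | hr
      · exact (hC r hr).trans (le_max_left _ _)
      · exact (hC' r hr).trans (le_max_right _ _)
    · intro s _
      obtain ⟨x, hx⟩ := hproc.left_limits ω s
      have h1 : ∀ᶠ r in 𝓝[<] s, ‖lam r ω‖ < ‖x‖ + 1 :=
        hx.norm.eventually (gt_mem_nhds (lt_add_one _))
      have h2 : ∀ᶠ r in 𝓝[≥] s, ‖lam r ω‖ < ‖lam s ω‖ + 1 :=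
        (hproc.right_continuous ω s).norm.eventually (gt_mem_nhds (lt_add_one _))
      have h3 : ∀ᶠ r in 𝓝 s, ‖lam r ω‖ ≤ max (‖x‖ + 1) (‖lam s ω‖ + 1) := by
        rw [← nhdsLT_sup_nhdsGE, eventually_sup]
        exact ⟨h1.mono fun r hr => hr.le.trans (le_max_left _ _),
          h2.mono fun r hr => hr.le.trans (le_max_right _ _)⟩
      exact ⟨_, mem_nhdsWithin_of_mem_nhds h3, _, fun r hr => hr⟩
  obtain ⟨C, hC⟩ := h
  exact ⟨C, fun s hs => hC s ⟨zero_le, hs⟩⟩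

/-- The time-state pairs up to which the intensity has been bounded by `m`. -/
def boundedPast (lam : ℝ≥0 → Ω → Fin d → ℝ) (m : ℕ) : Set (ℝ≥0 × Ω) :=
  {p | ‖leftIntensity lam p.1 p.2‖ ≤ m ∧ ∀ r < p.1, ‖lam r p.2‖ ≤ m}

/-- By right continuity, a bound at the times of a countable dense set before s gives the bound at
all times before s. The separate condition on λ(s-) follows from that bound if s > 0; it matters at
s = 0, where there is no earlier time. -/
theorem measurableSet_boundedPast (hproc : IsSelfExcitingProcess P 𝓕 μ B κ l T X Y lam) (m : ℕ) :
    MeasurableSet[𝓕.predictable] (boundedPast lam m) := by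
  have hset : boundedPast lam m = {p | ‖leftIntensity lam p.1 p.2‖ ≤ m} ∩
      ⋂ n : ℕ, (Set.Ioi (TopologicalSpace.denseSeq ℝ≥0 n) ×ˢ
        {ω | (m : ℝ) < ‖lam (TopologicalSpace.denseSeq ℝ≥0 n) ω‖})ᶜ := by
    ext ⟨s, ω⟩
    simp only [boundedPast, Set.mem_ofPred_eq, Set.mem_inter_iff, Set.mem_iInter, Set.mem_compl_iff,
      Set.mem_prod, Set.mem_Ioi, not_and, not_lt]
    refine and_congr_right fun _ => ⟨fun h n hn => h _ hn, fun h r hr => ?_⟩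
    have hC : IsClosed {x : Fin d → ℝ | ‖x‖ ≤ m} := isClosed_le continuous_norm continuous_const
    have hc : Tendsto (fun s => lam s ω) (𝓝[>] r) (𝓝 (lam r ω)) :=
      (hproc.right_continuous ω r).mono_left (nhdsWithin_mono _ Set.Ioi_subset_Ici_self)
    change lam r ω ∈ {x : Fin d → ℝ | ‖x‖ ≤ m}
    refine hC.mem_of_frequently_of_tendsto ?_ hc
    rw [Filter.frequently_iff]
    intro U hU
    obtain ⟨b, hb, hbU⟩ := (mem_nhdsGT_iff_exists_Ioo_subset' hr).1 hU
    obtain ⟨x, ⟨n, rfl⟩, hx⟩ := (TopologicalSpace.denseRange_denseSeq ℝ≥0).exists_between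
      (lt_min hb hr)
    exact ⟨_, hbU ⟨hx.1, hx.2.trans_le (min_le_left _ _)⟩,
      h n (hx.2.trans_le (min_le_right _ _))⟩
  rw [hset]
  refine @MeasurableSet.inter _ 𝓕.predictable _ _ ?_
    (@MeasurableSet.iInter _ _ 𝓕.predictable _ _ fun n =>
      @MeasurableSet.compl _ _ 𝓕.predictable (measurableSet_predictable_Ioi_prod ?_))
  · have : MeasurableSet {x : Fin d → ℝ | ‖x‖ ≤ m} := measurableSet_le measurable_norm measurable_const
    exact measurable_leftIntensity_predictable hproc this
  · have : MeasurableSet {x : Fin d → ℝ | (m : ℝ) < ‖x‖} :=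
      measurableSet_lt measurable_const measurable_norm
    exact hproc.adapted_intensity _ this

/-- For each ω the admissible times form an initial interval, so membership at t controls the whole
history. The bound on the left limit is inherited because a closed ball is closed. -/
theorem boundedPast_of_le (hproc : IsSelfExcitingProcess P 𝓕 μ B κ l T X Y lam) {m : ℕ}
    {s t : ℝ≥0} {ω : Ω} (hst : s ≤ t) (ht : (t, ω) ∈ boundedPast lam m) :
    (s, ω) ∈ boundedPast lam m := by
  rcases hst.eq_or_lt with rfl | hlt
  · exact ht
  · refine ⟨?_, fun r hr => ht.2 r (hr.trans hlt)⟩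
    have hC : IsClosed {x : Fin d → ℝ | ‖x‖ ≤ m} := isClosed_le continuous_norm continuous_const
    exact leftIntensity_mem hproc hC (fun h => ht.2 0 (h ▸ hlt)) fun r hr => ht.2 r (hr.trans hlt)

theorem eventually_mem_boundedPast (hproc : IsSelfExcitingProcess P 𝓕 μ B κ l T X Y lam)
    (t : ℝ≥0) (ω : Ω) : ∀ᶠ m in atTop, (t, ω) ∈ boundedPast lam m := by
  obtain ⟨C, hC⟩ := exists_norm_le_of_le hproc ω t
  filter_upwards [eventually_ge_atTop ⌈C⌉₊] with m hm
  have hCm : C ≤ m := (Nat.le_ceil C).trans (by exact_mod_cast hm)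
  have hcl : IsClosed {x : Fin d → ℝ | ‖x‖ ≤ m} := isClosed_le continuous_norm continuous_const
  exact ⟨leftIntensity_mem hproc hcl (fun _ => (hC 0 zero_le).trans hCm)
    fun r hr => (hC r hr.le).trans hCm, fun r hr => (hC r hr.le).trans hCm⟩

end Localization

/-! ### Square integrability of the intensity. -/

section SecondMomentBound

section

variable {Ω : Type*} {d : ℕ} {lam : ℝ≥0 → Ω → Fin d → ℝ}

/-- The squared Euclidean norm of `λ(s-)`. -/
def energy (lam : ℝ≥0 → Ω → Fin d → ℝ) (p : ℝ≥0 × Ω) : ℝ≥0∞ :=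
  ∑ i, ENNReal.ofReal (leftIntensity lam p.1 p.2 i ^ 2)

theorem energy_eq (p : ℝ≥0 × Ω) :
    energy lam p = ENNReal.ofReal (∑ i, leftIntensity lam p.1 p.2 i ^ 2) :=
  (ENNReal.ofReal_sum_of_nonneg fun _ _ => sq_nonneg _).symm

theorem ofReal_mul_ofReal_le_energy (p : ℝ≥0 × Ω) (i j : Fin d) :
    ENNReal.ofReal (leftIntensity lam p.1 p.2 i) * ENNReal.ofReal (leftIntensity lam p.1 p.2 j) ≤
      energy lam p := by
  have hsq : ∀ i, ENNReal.ofReal (leftIntensity lam p.1 p.2 i) *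
      ENNReal.ofReal (leftIntensity lam p.1 p.2 i) ≤ energy lam p := by
    intro i
    refine le_trans ?_ (Finset.single_le_sum
      (f := fun i => ENNReal.ofReal (leftIntensity lam p.1 p.2 i ^ 2))
      (fun i _ => zero_le) (Finset.mem_univ i))
    rcases le_total 0 (leftIntensity lam p.1 p.2 i) with h | h
    · rw [← ENNReal.ofReal_mul h, sq]
    · simp [ENNReal.ofReal_of_nonpos h]
  rcases le_total (ENNReal.ofReal (leftIntensity lam p.1 p.2 i))
    (ENNReal.ofReal (leftIntensity lam p.1 p.2 j)) with h | h
  · exact (mul_le_mul_left h _).trans (hsq j)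
  · exact (mul_le_mul_right h _).trans (hsq i)

theorem ofReal_le_one_add_energy (p : ℝ≥0 × Ω) (i : Fin d) :
    ENNReal.ofReal (leftIntensity lam p.1 p.2 i) ≤ 1 + energy lam p := by
  rcases le_total (ENNReal.ofReal (leftIntensity lam p.1 p.2 i)) 1 with h | h
  · exact h.trans le_self_add
  · calc ENNReal.ofReal (leftIntensity lam p.1 p.2 i)
        = ENNReal.ofReal (leftIntensity lam p.1 p.2 i) * 1 := (mul_one _).symm
      _ ≤ ENNReal.ofReal (leftIntensity lam p.1 p.2 i) *
          ENNReal.ofReal (leftIntensity lam p.1 p.2 i) := by gcongr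
      _ ≤ energy lam p := ofReal_mul_ofReal_le_energy p i i
      _ ≤ 1 + energy lam p := le_add_self

/-- The energy, as long as the intensity has been bounded by `m`. -/
def boundedEnergy (lam : ℝ≥0 → Ω → Fin d → ℝ) (m : ℕ) (p : ℝ≥0 × Ω) : ℝ≥0∞ :=
  (boundedPast lam m).indicator (energy lam) p

/-- An affine drift contributes at most quadratically to the squares of the components. The left
side is the drift term of the product formula with equal indices. -/
theorem exists_drift_bound (A : Matrix (Fin d) (Fin d) ℝ) (l₀ : Fin d → ℝ) :
    ∃ K : ℝ, 0 < K ∧ ∀ (x : Fin d → ℝ) (i : Fin d),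
      |x i * (A *ᵥ (x - l₀)) i + x i * (A *ᵥ (x - l₀)) i| ≤ K * (1 + ∑ j, x j ^ 2) := by
  -- The leading 1 keeps the constant positive even if A vanishes.
  refine ⟨1 + ∑ i, ∑ j, |A i j| * (2 + l₀ j ^ 2), by positivity, fun x i => ?_⟩
  have hx : ∀ j, x j ^ 2 ≤ ∑ j, x j ^ 2 := fun j =>
    Finset.single_le_sum (f := fun j => x j ^ 2) (fun j _ => sq_nonneg _) (Finset.mem_univ j)
  have h0 : 0 ≤ ∑ j, x j ^ 2 := Finset.sum_nonneg fun j _ => sq_nonneg _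
  have h1 : x i * (A *ᵥ (x - l₀)) i + x i * (A *ᵥ (x - l₀)) i =
      ∑ j, A i j * (2 * (x i * (x j - l₀ j))) := by
    simp only [Matrix.mulVec, dotProduct, Pi.sub_apply, Finset.mul_sum, ← Finset.sum_add_distrib]
    exact Finset.sum_congr rfl fun j _ => by ring
  have h2 : ∀ j, |2 * (x i * (x j - l₀ j))| ≤ (2 + l₀ j ^ 2) * (1 + ∑ j, x j ^ 2) := by
    intro j
    have hi := hx i
    have hj := hx j
    have hl := mul_nonneg (sq_nonneg (l₀ j)) h0
    rw [abs_le]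
    constructor
    · by_cases hij : i = j
      · subst hij; nlinarith [sq_nonneg (x i - l₀ i), sq_nonneg (x i + l₀ i)]
      · have hxx : x i ^ 2 + x j ^ 2 ≤ ∑ j, x j ^ 2 := by
          rw [← Finset.sum_pair hij (f := fun j => x j ^ 2)]
          exact Finset.sum_le_sum_of_subset_of_nonneg (Finset.subset_univ _)
            fun j _ _ => sq_nonneg _
        nlinarith [sq_nonneg (x i - l₀ j), sq_nonneg (x i + x j)]
    · by_cases hij : i = j
      · subst hij; nlinarith [sq_nonneg (x i - l₀ i), sq_nonneg (x i + l₀ i)]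
      · have hxx : x i ^ 2 + x j ^ 2 ≤ ∑ j, x j ^ 2 := by
          rw [← Finset.sum_pair hij (f := fun j => x j ^ 2)]
          exact Finset.sum_le_sum_of_subset_of_nonneg (Finset.subset_univ _)
            fun j _ _ => sq_nonneg _
        nlinarith [sq_nonneg (x i + l₀ j), sq_nonneg (x i - x j)]
  rw [h1]
  calc |∑ j, A i j * (2 * (x i * (x j - l₀ j)))|
      ≤ ∑ j, |A i j * (2 * (x i * (x j - l₀ j)))| := Finset.abs_sum_le_sum_abs _ _
    _ ≤ ∑ j, |A i j| * (2 + l₀ j ^ 2) * (1 + ∑ j, x j ^ 2) := by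
        refine Finset.sum_le_sum fun j _ => ?_
        rw [abs_mul, mul_assoc]
        exact mul_le_mul_of_nonneg_left (h2 j) (abs_nonneg _)
    _ = (∑ j, |A i j| * (2 + l₀ j ^ 2)) * (1 + ∑ j, x j ^ 2) := by rw [Finset.sum_mul]
    _ ≤ _ := by
        gcongr
        have := Finset.single_le_sum (f := fun i => ∑ j, |A i j| * (2 + l₀ j ^ 2))
          (fun i _ => Finset.sum_nonneg fun j _ => by positivity) (Finset.mem_univ i)
        linarith

end

variable {Ω : Type*} {d : ℕ} [mΩ : MeasurableSpace Ω] {P : Measure Ω} {𝓕 : Filtration ℝ≥0 mΩ}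
  {μ : ℝ≥0 → (Fin d → ℝ) → (Fin d → ℝ)} {A B : Matrix (Fin d) (Fin d) ℝ}
  {κ : Fin d → Kernel (Fin d → ℝ) ℝ} {l₀ l : Fin d → ℝ} {ν : Fin d → Measure ℝ}
  {T : ℕ → Ω → ℝ≥0∞} {X : ℕ → Ω → Fin d} {Y : ℕ → Ω → ℝ} {lam : ℝ≥0 → Ω → Fin d → ℝ}

theorem measurable_energy (hproc : IsSelfExcitingProcess P 𝓕 μ B κ l T X Y lam) :
    Measurable (energy lam) :=
  Finset.measurable_sum _ fun i _ => ((measurable_leftIntensity_apply hproc i).pow_const 2).ennreal_ofReal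

/-- A pathwise bound of the squared norm of the intensity. -/
theorem ae_sum_sq_intensity_le {K : ℝ} (hK : 0 < K)
    (hdrift : ∀ (x : Fin d → ℝ) (i : Fin d),
      |x i * (A *ᵥ (x - l₀)) i + x i * (A *ᵥ (x - l₀)) i| ≤ K * (1 + ∑ j, x j ^ 2))
    (hproc : IsSelfExcitingProcess P 𝓕 (fun _ x => A *ᵥ (x - l₀)) B κ l T X Y lam) :
    ∀ᵐ ω ∂P, ∀ t : ℝ≥0, ∑ i, ENNReal.ofReal (lam t ω i ^ 2) ≤
      ∑ i, (ENNReal.ofReal (l i ^ 2) +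
        (∫⁻ s in Set.Icc (0 : ℝ) t, ENNReal.ofReal K * (1 + energy lam (s.toNNReal, ω))) +
        ∑ k, (ENNReal.ofReal (2 * |B i k|) * eventSum T X k
            (upTo t fun p => ENNReal.ofReal (leftIntensity lam p.1 p.2 i))
            (fun n ω => ENNReal.ofReal (Y n ω)) ω +
          ENNReal.ofReal (B i k ^ 2) * eventSum T X k (upTo t fun _ => 1)
            (fun n ω => ENNReal.ofReal (Y n ω ^ 2)) ω)) := by
  filter_upwards [ae_intensity_mul_intensity hproc, ae_eventSum_ne_top hproc,
    ae_ae_leftIntensity_eq hproc] with ω hprod hfin hae t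
  refine Finset.sum_le_sum fun i _ => ?_
  rw [sq, hprod t i i]
  refine ENNReal.ofReal_add_le.trans (add_le_add (ENNReal.ofReal_add_le.trans
    (add_le_add (by rw [sq]) ?_)) ?_)
  · refine (Real.ofReal_le_enorm _).trans ?_
    rw [intervalIntegral.integral_of_le t.coe_nonneg]
    refine (enorm_integral_le_lintegral_enorm _).trans
      ((lintegral_mono_ae ?_).trans (lintegral_mono_set Set.Ioc_subset_Icc_self))
    filter_upwards [ae_restrict_of_ae hae] with s hs
    rw [energy_eq]
    simp only [hs]
    rw [← ENNReal.ofReal_one, ← ENNReal.ofReal_add zero_le_one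
      (Finset.sum_nonneg fun _ _ => sq_nonneg _), ← ENNReal.ofReal_mul hK.le,
      Real.enorm_eq_ofReal_abs]
    exact ENNReal.ofReal_le_ofReal (hdrift _ i)
  · refine (ENNReal.ofReal_le_ofReal (Finset.sum_le_sum (g := fun k =>
      2 * |B i k| * (eventSum T X k
            (upTo t fun p => ENNReal.ofReal (leftIntensity lam p.1 p.2 i))
            (fun n ω => ENNReal.ofReal (Y n ω)) ω).toReal +
          B i k ^ 2 * (eventSum T X k (upTo t fun _ => 1)
            (fun n ω => ENNReal.ofReal (Y n ω ^ 2)) ω).toReal) fun k _ => ?_)).trans ?_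
    · have h1 := le_abs_self (B i k)
      set e := (eventSum T X k
            (upTo t fun p => ENNReal.ofReal (leftIntensity lam p.1 p.2 i))
            (fun n ω => ENNReal.ofReal (Y n ω)) ω).toReal with he
      have h2 : 0 ≤ e := ENNReal.toReal_nonneg
      nlinarith
    · rw [ENNReal.ofReal_sum_of_nonneg fun k _ => by positivity]
      refine Finset.sum_le_sum fun k _ => ?_
      rw [ENNReal.ofReal_add (by positivity) (by positivity), ENNReal.ofReal_mul (p := 2 * |B i k|) (by positivity),
        ENNReal.ofReal_mul (p := B i k ^ 2) (by positivity), ENNReal.ofReal_toReal (hfin t k i).1,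
        ENNReal.ofReal_toReal (hfin t k i).2]

/-- If the past is bounded at t, it was bounded at every earlier event. Truncation at the terminal
time can therefore be moved into the integrand, where it is predictable and the compensation formula
applies. -/
theorem indicator_mul_eventSum_le (hproc : IsSelfExcitingProcess P 𝓕 μ B κ l T X Y lam)
    (m : ℕ) (t : ℝ≥0) (ω : Ω) (k : Fin d) (f : ℝ≥0 × Ω → ℝ≥0∞) (w : ℕ → Ω → ℝ≥0∞) :
    (boundedPast lam m).indicator 1 (t, ω) * eventSum T X k (upTo t f) w ω ≤
      eventSum T X k (upTo t ((boundedPast lam m).indicator f)) w ω := by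
  unfold eventSum
  rw [← ENNReal.tsum_mul_left]
  refine ENNReal.tsum_le_tsum fun n => ?_
  split_ifs with h
  · by_cases ht : (t, ω) ∈ boundedPast lam m
    · by_cases hn : (T n ω).toNNReal ≤ t
      · simp [ht, upTo, hn, boundedPast_of_le hproc hn ht]
      · simp [upTo, hn]
    · simp [ht]
  · simp

/-- Expectation of the truncated pathwise bound. Compensation turns the jump terms into size moments
times integrals of λ_i λ_k or λ_k, each dominated by 1 + energy. The constants do not depend on m.
-/
theorem lintegral_boundedEnergy_le [IsProbabilityMeasure P] {K : ℝ} (hK : 0 < K)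
    (hdrift : ∀ (x : Fin d → ℝ) (i : Fin d),
      |x i * (A *ᵥ (x - l₀)) i + x i * (A *ᵥ (x - l₀)) i| ≤ K * (1 + ∑ j, x j ^ 2))
    (hproc : IsSelfExcitingProcess P 𝓕 (fun _ x => A *ᵥ (x - l₀)) B
      (fun k => Kernel.const (Fin d → ℝ) (ν k)) l T X Y lam) (m : ℕ) (t : ℝ≥0) :
    ∫⁻ ω, boundedEnergy lam m (t, ω) ∂P ≤ (∑ i, ENNReal.ofReal (l i ^ 2)) +
      (∑ i, (ENNReal.ofReal K + ∑ k, (ENNReal.ofReal (2 * |B i k|) * ∫⁻ x, ENNReal.ofReal x ∂(ν k) +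
        ENNReal.ofReal (B i k ^ 2) * ∫⁻ x, ENNReal.ofReal (x ^ 2) ∂(ν k)))) *
      ∫⁻ s in Set.Icc (0 : ℝ) t, (1 + ∫⁻ ω, boundedEnergy lam m (s.toNNReal, ω) ∂P) := by
  have hH := measurableSet_boundedPast hproc m
  have hH' : MeasurableSet (boundedPast lam m) := predictable_le_prod 𝓕 _ hH
  have hφ : Measurable fun p : Ω × ℝ => (p.2.toNNReal, p.1) :=
    (measurable_real_toNNReal.comp measurable_snd).prodMk measurable_fst
  have hbe : Measurable (boundedEnergy lam m) := (measurable_energy hproc).indicator hH'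
  set I : ℝ≥0∞ := ∫⁻ s in Set.Icc (0 : ℝ) t,
    (1 + ∫⁻ ω, boundedEnergy lam m (s.toNNReal, ω) ∂P) with hI
  have hI' : I = ∫⁻ s in Set.Icc (0 : ℝ) t, ∫⁻ ω,
      (1 + boundedEnergy lam m (s.toNNReal, ω)) ∂P := by
    refine lintegral_congr fun s => ?_
    rw [lintegral_add_left measurable_const]
    simp
  have hev1 : ∀ i, Measurable[𝓕.predictable] ((boundedPast lam m).indicator
      fun p => ENNReal.ofReal (leftIntensity lam p.1 p.2 i)) := fun i =>
    Measurable.indicator (ENNReal.measurable_ofReal.comp ((measurable_pi_apply i).comp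
      (measurable_leftIntensity_predictable hproc))) hH
  have hev2 : Measurable[𝓕.predictable] ((boundedPast lam m).indicator fun _ => (1 : ℝ≥0∞)) :=
    Measurable.indicator measurable_const hH
  have hY1 : Measurable fun x : ℝ => ENNReal.ofReal x := ENNReal.measurable_ofReal
  have hY2 : Measurable fun x : ℝ => ENNReal.ofReal (x ^ 2) :=
    ENNReal.measurable_ofReal.comp (measurable_id.pow_const 2)
  have hmes : ∀ {f : ℝ≥0 × Ω → ℝ≥0∞}, Measurable[𝓕.predictable] f → ∀ {g : ℝ → ℝ≥0∞},
      Measurable g → ∀ k, Measurable (eventSum T X k (upTo t f) fun n ω => g (Y n ω)) :=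
    fun hf _ hg k => measurable_eventSum hproc.adapted_events k
      ((measurable_upTo t hf).mono (predictable_le_prod 𝓕) le_rfl) hg
  have hpath : ∀ᵐ ω ∂P, boundedEnergy lam m (t, ω) ≤
      ∑ i, (ENNReal.ofReal (l i ^ 2) +
        (∫⁻ s in Set.Icc (0 : ℝ) t,
          ENNReal.ofReal K * (1 + boundedEnergy lam m (s.toNNReal, ω))) +
        ∑ k, (ENNReal.ofReal (2 * |B i k|) * eventSum T X k
            (upTo t ((boundedPast lam m).indicator
              fun p => ENNReal.ofReal (leftIntensity lam p.1 p.2 i)))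
            (fun n ω => ENNReal.ofReal (Y n ω)) ω +
          ENNReal.ofReal (B i k ^ 2) * eventSum T X k
            (upTo t ((boundedPast lam m).indicator fun _ => 1))
            (fun n ω => ENNReal.ofReal (Y n ω ^ 2)) ω)) := by
    filter_upwards [ae_sum_sq_intensity_le hK hdrift hproc, ae_leftIntensity_eq hproc t]
      with ω h1 h2
    by_cases ht : (t, ω) ∈ boundedPast lam m
    · have e1 : boundedEnergy lam m (t, ω) = ∑ i, ENNReal.ofReal (lam t ω i ^ 2) := by
        simp [boundedEnergy, ht, energy, h2]
      have e2 : ∀ (k : Fin d) (f : ℝ≥0 × Ω → ℝ≥0∞) (w : ℕ → Ω → ℝ≥0∞),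
          eventSum T X k (upTo t f) w ω ≤
            eventSum T X k (upTo t ((boundedPast lam m).indicator f)) w ω := by
        intro k f w
        simpa [ht] using indicator_mul_eventSum_le hproc m t ω k f w
      rw [e1]
      refine (h1 t).trans (Finset.sum_le_sum fun i _ => ?_)
      refine add_le_add (add_le_add le_rfl ?_) (Finset.sum_le_sum fun k _ => ?_)
      · refine setLIntegral_mono' measurableSet_Icc fun s hs => ?_
        have : (s.toNNReal, ω) ∈ boundedPast lam m :=
          boundedPast_of_le hproc (Real.toNNReal_le_iff_le_coe.2 hs.2) ht
        simp [boundedEnergy, this]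
      · exact add_le_add (mul_le_mul_right (e2 _ _ _) _) (mul_le_mul_right (e2 _ _ _) _)
    · simp [boundedEnergy, ht]
  have hE1 : ∀ i k, ∫⁻ ω, eventSum T X k (upTo t ((boundedPast lam m).indicator
      fun p => ENNReal.ofReal (leftIntensity lam p.1 p.2 i)))
      (fun n ω => ENNReal.ofReal (Y n ω)) ω ∂P ≤ (∫⁻ x, ENNReal.ofReal x ∂(ν k)) * I := by
    intro i k
    rw [lintegral_eventSum_upTo hproc k t (hev1 i) hY1, hI']
    gcongr with s ω
    by_cases h : (s.toNNReal, ω) ∈ boundedPast lam m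
    · simp only [h, Set.indicator_of_mem, boundedEnergy]
      exact (ofReal_mul_ofReal_le_energy (s.toNNReal, ω) i k).trans le_add_self
    · simp [h]
  have hE2 : ∀ k, ∫⁻ ω, eventSum T X k (upTo t ((boundedPast lam m).indicator fun _ => 1))
      (fun n ω => ENNReal.ofReal (Y n ω ^ 2)) ω ∂P ≤
      (∫⁻ x, ENNReal.ofReal (x ^ 2) ∂(ν k)) * I := by
    intro k
    rw [lintegral_eventSum_upTo hproc k t hev2 hY2, hI']
    gcongr with s ω
    by_cases h : (s.toNNReal, ω) ∈ boundedPast lam m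
    · simp only [h, Set.indicator_of_mem, boundedEnergy, one_mul]
      exact ofReal_le_one_add_energy (s.toNNReal, ω) k
    · simp [h]
  have hint : ∫⁻ ω, (∫⁻ s in Set.Icc (0 : ℝ) t,
      ENNReal.ofReal K * (1 + boundedEnergy lam m (s.toNNReal, ω))) ∂P = ENNReal.ofReal K * I := by
    rw [hI', lintegral_lintegral_swap]
    · rw [← lintegral_const_mul' _ _ ENNReal.ofReal_ne_top]
      refine lintegral_congr fun s => ?_
      rw [lintegral_const_mul' _ _ ENNReal.ofReal_ne_top]
    · exact (measurable_const.mul (measurable_const.add (hbe.comp hφ))).aemeasurable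
  have hintm : Measurable fun ω => ∫⁻ s in Set.Icc (0 : ℝ) t,
      ENNReal.ofReal K * (1 + boundedEnergy lam m (s.toNNReal, ω)) :=
    (measurable_const.mul (measurable_const.add (hbe.comp hφ))).lintegral_prod_right'
  refine (lintegral_mono_ae hpath).trans ?_
  have hterm : ∀ i k, Measurable fun ω => ENNReal.ofReal (2 * |B i k|) * eventSum T X k
            (upTo t ((boundedPast lam m).indicator
              fun p => ENNReal.ofReal (leftIntensity lam p.1 p.2 i)))
            (fun n ω => ENNReal.ofReal (Y n ω)) ω +
          ENNReal.ofReal (B i k ^ 2) * eventSum T X k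
            (upTo t ((boundedPast lam m).indicator fun _ => 1))
            (fun n ω => ENNReal.ofReal (Y n ω ^ 2)) ω := fun i k =>
    ((hmes (hev1 i) hY1 k).const_mul _).add ((hmes hev2 hY2 k).const_mul _)
  have hconst : ∀ i, Measurable fun ω => ENNReal.ofReal (l i ^ 2) +
      ∫⁻ s in Set.Icc (0 : ℝ) t, ENNReal.ofReal K * (1 + boundedEnergy lam m (s.toNNReal, ω)) :=
    fun i => measurable_const.add hintm
  rw [lintegral_finsetSum]
  swap
  · exact fun i _ => (hconst i).add (Finset.measurable_sum _ fun k _ => hterm i k)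
  rw [Finset.sum_mul, ← Finset.sum_add_distrib]
  refine Finset.sum_le_sum fun i _ => ?_
  rw [lintegral_add_left (hconst i), lintegral_add_left measurable_const, hint,
    lintegral_finsetSum _ fun k _ => hterm i k, add_mul, Finset.sum_mul, ← add_assoc]
  refine add_le_add (add_le_add (by simp) le_rfl) (Finset.sum_le_sum fun k _ => ?_)
  rw [lintegral_add_left ((hmes (hev1 i) hY1 k).const_mul _),
    lintegral_const_mul _ (hmes (hev1 i) hY1 k), lintegral_const_mul _ (hmes hev2 hY2 k), add_mul,
    mul_assoc, mul_assoc]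
  exact add_le_add (mul_le_mul_right (hE1 i k) _) (mul_le_mul_right (hE2 k) _)

/-- The truncated energy is at most d m², which is the a priori finiteness required by Gronwall's
inequality; the resulting bound is uniform in m. -/
theorem exists_lintegral_energy_le [IsProbabilityMeasure P] [∀ k, IsProbabilityMeasure (ν k)]
    (hν : ∀ k, Integrable (fun x => x ^ 2) (ν k))
    (hproc : IsSelfExcitingProcess P 𝓕 (fun _ x => A *ᵥ (x - l₀)) B
      (fun k => Kernel.const (Fin d → ℝ) (ν k)) l T X Y lam) (t₀ : ℝ≥0) :
    ∃ C : ℝ≥0∞, C ≠ ⊤ ∧ ∀ t ≤ t₀, ∫⁻ ω, energy lam (t, ω) ∂P ≤ C := by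
  obtain ⟨K, hK, hdrift⟩ := exists_drift_bound A l₀
  have hν1 : ∀ k, ∫⁻ x, ENNReal.ofReal x ∂(ν k) ≠ ⊤ := by
    intro k
    have : MemLp (fun x : ℝ => x) 2 (ν k) :=
      (memLp_two_iff_integrable_sq measurable_id.aestronglyMeasurable).2 (hν k)
    exact (this.integrable one_le_two).lintegral_lt_top.ne
  have hν2 : ∀ k, ∫⁻ x, ENNReal.ofReal (x ^ 2) ∂(ν k) ≠ ⊤ := fun k => (hν k).lintegral_lt_top.ne
  set a : ℝ≥0∞ := ∑ i, ENNReal.ofReal (l i ^ 2)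
  have ha : a ≠ ⊤ := ENNReal.sum_ne_top.2 fun i _ => ENNReal.ofReal_ne_top
  set K' : ℝ≥0∞ := ∑ i, (ENNReal.ofReal K + ∑ k,
    (ENNReal.ofReal (2 * |B i k|) * ∫⁻ x, ENNReal.ofReal x ∂(ν k) +
        ENNReal.ofReal (B i k ^ 2) * ∫⁻ x, ENNReal.ofReal (x ^ 2) ∂(ν k)))
  have hK'top : K' ≠ ⊤ := ENNReal.sum_ne_top.2 fun i _ => ENNReal.add_ne_top.2
    ⟨ENNReal.ofReal_ne_top, ENNReal.sum_ne_top.2 fun k _ => ENNReal.add_ne_top.2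
      ⟨ENNReal.mul_ne_top ENNReal.ofReal_ne_top (hν1 k),
        ENNReal.mul_ne_top ENNReal.ofReal_ne_top (hν2 k)⟩⟩
  -- Gronwall's inequality above asks for a strictly positive constant.
  set K₁ : ℝ := K'.toReal + 1
  have hK₁ : 0 < K₁ := by positivity
  have hKK : K' ≤ ENNReal.ofReal K₁ := by
    rw [← ENNReal.ofReal_toReal hK'top]
    exact ENNReal.ofReal_le_ofReal (by simp [K₁])
  -- Absorbs the constant 1 of the integrand into the initial value.
  set a' : ℝ≥0∞ := a + ENNReal.ofReal K₁ * t₀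
  have ha' : a' ≠ ⊤ := ENNReal.add_ne_top.2
    ⟨ha, ENNReal.mul_ne_top ENNReal.ofReal_ne_top ENNReal.coe_ne_top⟩
  have hloc : ∀ m : ℕ, ∀ t ∈ Set.Icc (0 : ℝ) t₀, ∫⁻ ω, boundedEnergy lam m (t.toNNReal, ω) ∂P ≤
      2 * a' * ENNReal.ofReal (Real.exp (2 * K₁ * t)) := by
    intro m
    refine le_of_le_add_mul_lintegral (C := ENNReal.ofReal (∑ _i : Fin d, (m : ℝ) ^ 2)) hK₁
      ENNReal.ofReal_ne_top ?_ ?_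
    · intro t _
      calc ∫⁻ ω, boundedEnergy lam m (t.toNNReal, ω) ∂P
          ≤ ∫⁻ _, ENNReal.ofReal (∑ _i : Fin d, (m : ℝ) ^ 2) ∂P := by
            refine lintegral_mono fun ω => ?_
            by_cases h : (t.toNNReal, ω) ∈ boundedPast lam m
            · simp only [boundedEnergy, h, Set.indicator_of_mem, energy_eq]
              refine ENNReal.ofReal_le_ofReal (Finset.sum_le_sum fun i _ => ?_)
              have := (norm_le_pi_norm (leftIntensity lam t.toNNReal ω) i).trans h.1
              rw [← sq_abs]
              exact pow_le_pow_left₀ (abs_nonneg _) this 2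
            · simp [boundedEnergy, h]
        _ = _ := by simp
    · intro t ht
      have h1 := lintegral_boundedEnergy_le hK hdrift hproc m t.toNNReal
      rw [Real.coe_toNNReal t ht.1, lintegral_add_left measurable_const] at h1
      refine h1.trans ?_
      have h2 : ∫⁻ _ in Set.Icc (0 : ℝ) t, (1 : ℝ≥0∞) ≤ t₀ := by
        simp only [lintegral_const, one_mul, Measure.restrict_apply_univ, Real.volume_Icc, sub_zero]
        exact ENNReal.ofReal_le_of_le_toReal (by simpa using ht.2)
      calc _ ≤ a + ENNReal.ofReal K₁ * (t₀ + ∫⁻ s in Set.Icc (0 : ℝ) t,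
            ∫⁻ ω, boundedEnergy lam m (s.toNNReal, ω) ∂P) := by gcongr
        _ = _ := by rw [mul_add, ← add_assoc]
  refine ⟨2 * a' * ENNReal.ofReal (Real.exp (2 * K₁ * t₀)),
    ENNReal.mul_ne_top (ENNReal.mul_ne_top (by simp) ha') ENNReal.ofReal_ne_top, fun t ht => ?_⟩
  have hm : ∀ m : ℕ, Measurable fun ω => boundedEnergy lam m (t, ω) := fun m =>
    ((measurable_energy hproc).indicator (predictable_le_prod 𝓕 _
      (measurableSet_boundedPast hproc m))).comp measurable_prodMk_left
  have ht' : (t : ℝ) ≤ t₀ := by exact_mod_cast ht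
  calc ∫⁻ ω, energy lam (t, ω) ∂P
      = ∫⁻ ω, liminf (fun m => boundedEnergy lam m (t, ω)) atTop ∂P := by
        refine lintegral_congr fun ω => ?_
        have : Tendsto (fun m => boundedEnergy lam m (t, ω)) atTop (𝓝 (energy lam (t, ω))) := by
          refine tendsto_const_nhds.congr' ?_
          filter_upwards [eventually_mem_boundedPast hproc t ω] with m hm
          simp [boundedEnergy, hm]
        exact this.liminf_eq.symm
    _ ≤ liminf (fun m => ∫⁻ ω, boundedEnergy lam m (t, ω) ∂P) atTop := lintegral_liminf_le hm
    _ ≤ 2 * a' * ENNReal.ofReal (Real.exp (2 * K₁ * t₀)) := by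
        refine liminf_le_of_frequently_le' (Frequently.of_forall fun m => ?_)
        have := hloc m t ⟨t.coe_nonneg, ht'⟩
        rw [Real.toNNReal_coe] at this
        refine this.trans ?_
        gcongr

end SecondMomentBound

section MomentEquations

variable {Ω : Type*} {d : ℕ} [mΩ : MeasurableSpace Ω] {P : Measure Ω} {𝓕 : Filtration ℝ≥0 mΩ}
  {μ : ℝ≥0 → (Fin d → ℝ) → (Fin d → ℝ)} {A B : Matrix (Fin d) (Fin d) ℝ}
  {κ : Fin d → Kernel (Fin d → ℝ) ℝ} {l₀ l : Fin d → ℝ} {ν : Fin d → Measure ℝ}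
  {T : ℕ → Ω → ℝ≥0∞} {X : ℕ → Ω → Fin d} {Y : ℕ → Ω → ℝ} {lam : ℝ≥0 → Ω → Fin d → ℝ}

theorem memLp_leftIntensity_prod [IsProbabilityMeasure P] [∀ k, IsProbabilityMeasure (ν k)]
    (hν : ∀ k, Integrable (fun x => x ^ 2) (ν k))
    (hproc : IsSelfExcitingProcess P 𝓕 (fun _ x => A *ᵥ (x - l₀)) B
      (fun k => Kernel.const (Fin d → ℝ) (ν k)) l T X Y lam) (t : ℝ≥0) (i : Fin d) :
    MemLp (fun p : ℝ × Ω => leftIntensity lam p.1.toNNReal p.2 i) 2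
      ((volume.restrict (Set.Ioc (0 : ℝ) t)).prod P) := by
  obtain ⟨C, hC, hCle⟩ := exists_lintegral_energy_le hν hproc t
  have hφ : Measurable fun p : ℝ × Ω => (p.1.toNNReal, p.2) :=
    (measurable_real_toNNReal.comp measurable_fst).prodMk measurable_snd
  have hm : Measurable fun p : ℝ × Ω => leftIntensity lam p.1.toNNReal p.2 i :=
    (measurable_leftIntensity_apply hproc i).comp hφ
  rw [memLp_two_iff_integrable_sq hm.aestronglyMeasurable]
  refine ⟨(hm.pow_const 2).aestronglyMeasurable, ?_⟩
  rw [hasFiniteIntegral_iff_ofReal (Eventually.of_forall fun p => sq_nonneg _),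
    lintegral_prod _ (hm.pow_const 2).ennreal_ofReal.aemeasurable]
  calc ∫⁻ s in Set.Ioc (0 : ℝ) t,
        ∫⁻ ω, ENNReal.ofReal (leftIntensity lam s.toNNReal ω i ^ 2) ∂P
      ≤ ∫⁻ _ in Set.Ioc (0 : ℝ) t, C := by
        refine setLIntegral_mono' measurableSet_Ioc fun s hs => ?_
        refine le_trans (lintegral_mono fun ω => ?_)
          (hCle s.toNNReal (Real.toNNReal_le_iff_le_coe.2 hs.2))
        exact Finset.single_le_sum
          (f := fun i => ENNReal.ofReal (leftIntensity lam s.toNNReal ω i ^ 2))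
          (fun i _ => zero_le) (Finset.mem_univ i)
    _ < ⊤ := by
        simp only [lintegral_const, Measure.restrict_apply_univ, Real.volume_Ioc]
        exact ENNReal.mul_lt_top hC.lt_top ENNReal.ofReal_lt_top

theorem memLp_leftIntensity [IsProbabilityMeasure P] [∀ k, IsProbabilityMeasure (ν k)]
    (hν : ∀ k, Integrable (fun x => x ^ 2) (ν k))
    (hproc : IsSelfExcitingProcess P 𝓕 (fun _ x => A *ᵥ (x - l₀)) B
      (fun k => Kernel.const (Fin d → ℝ) (ν k)) l T X Y lam) (t : ℝ≥0) (i : Fin d) :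
    MemLp (fun ω => leftIntensity lam t ω i) 2 P := by
  obtain ⟨C, hC, hCle⟩ := exists_lintegral_energy_le hν hproc t
  have hm : Measurable fun ω => leftIntensity lam t ω i :=
    (measurable_leftIntensity_apply hproc i).comp measurable_prodMk_left
  rw [memLp_two_iff_integrable_sq hm.aestronglyMeasurable]
  refine ⟨(hm.pow_const 2).aestronglyMeasurable, ?_⟩
  rw [hasFiniteIntegral_iff_ofReal (Eventually.of_forall fun p => sq_nonneg _)]
  refine lt_of_le_of_lt (le_trans (lintegral_mono fun ω => ?_) (hCle t le_rfl)) hC.lt_top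
  exact Finset.single_le_sum
    (f := fun i => ENNReal.ofReal (leftIntensity lam t ω i ^ 2))
    (fun i _ => zero_le) (Finset.mem_univ i)

theorem memLp_intensity [IsProbabilityMeasure P] [∀ k, IsProbabilityMeasure (ν k)]
    (hν : ∀ k, Integrable (fun x => x ^ 2) (ν k))
    (hproc : IsSelfExcitingProcess P 𝓕 (fun _ x => A *ᵥ (x - l₀)) B
      (fun k => Kernel.const (Fin d → ℝ) (ν k)) l T X Y lam) (t : ℝ≥0) (i : Fin d) :
    MemLp (fun ω => lam t ω i) 2 P := by
  refine (memLp_congr_ae ?_).1 (memLp_leftIntensity hν hproc t i)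
  filter_upwards [ae_leftIntensity_eq hproc t] with ω h
  rw [h]

theorem integral_intervalIntegral_swap [SFinite P] {f : ℝ → Ω → ℝ} {a b : ℝ} (hab : a ≤ b)
    (hf : Integrable (fun p : ℝ × Ω => f p.1 p.2) ((volume.restrict (Set.Ioc a b)).prod P)) :
    Integrable (fun ω => ∫ s in a..b, f s ω) P ∧
      IntervalIntegrable (fun s => ∫ ω, f s ω ∂P) volume a b ∧
      ∫ ω, (∫ s in a..b, f s ω) ∂P = ∫ s in a..b, ∫ ω, f s ω ∂P := by
  simp only [intervalIntegral.integral_of_le hab]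
  refine ⟨hf.integral_prod_right, ?_, (integral_integral_swap hf).symm⟩
  exact (intervalIntegrable_iff_integrableOn_Ioc_of_le hab).2 hf.integral_prod_left

/-- The compensation formula with marks, for integrable processes. -/
theorem integral_eventSum_upTo [IsProbabilityMeasure P]
    (hproc : IsSelfExcitingProcess P 𝓕 μ B (fun k => Kernel.const (Fin d → ℝ) (ν k)) l T X Y lam)
    (k : Fin d) (t : ℝ≥0) {G : ℝ≥0 × Ω → ℝ} (hG : Measurable[𝓕.predictable] G)
    (hG0 : ∀ᵐ ω ∂P, ∀ s, 0 ≤ G (s, ω)) {g : ℝ → ℝ} (hg : Measurable g)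
    (hg0 : ∀ x, 0 ≤ x → 0 ≤ g x) (hgi : Integrable g (ν k))
    (hint : Integrable (fun p : ℝ × Ω => G (p.1.toNNReal, p.2) *
      leftIntensity lam p.1.toNNReal p.2 k) ((volume.restrict (Set.Ioc (0 : ℝ) t)).prod P)) :
    Integrable (fun ω => (eventSum T X k (upTo t fun p => ENNReal.ofReal (G p))
      (fun n ω => ENNReal.ofReal (g (Y n ω))) ω).toReal) P ∧
    ∫ ω, (eventSum T X k (upTo t fun p => ENNReal.ofReal (G p))
      (fun n ω => ENNReal.ofReal (g (Y n ω))) ω).toReal ∂P =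
      (∫ x, g x ∂(ν k)) * ∫ s in (0 : ℝ)..t, ∫ ω, G (s.toNNReal, ω) *
        leftIntensity lam s.toNNReal ω k ∂P := by
  set f : ℝ≥0 × Ω → ℝ≥0∞ := fun p => ENNReal.ofReal (G p)
  have hf : Measurable[𝓕.predictable] f := ENNReal.measurable_ofReal.comp hG
  have hf' : Measurable (upTo t f) :=
    (measurable_upTo t hf).mono (predictable_le_prod 𝓕) le_rfl
  have hgm : Measurable fun x => ENNReal.ofReal (g x) := hg.ennreal_ofReal
  set c : ℝ≥0∞ := ∫⁻ s in Set.Icc (0 : ℝ) t, ∫⁻ ω,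
        f (s.toNNReal, ω) * ENNReal.ofReal (leftIntensity lam s.toNNReal ω k) ∂P with hc
  have hGq : ∀ᵐ ω ∂P, ∀ s, 0 ≤ G (s, ω) * leftIntensity lam s ω k := by
    filter_upwards [hG0, ae_leftIntensity_nonneg hproc] with ω h1 h2 s
    exact mul_nonneg (h1 s) (h2 s k)
  have hcof : c = ENNReal.ofReal (∫ s in (0 : ℝ)..t, ∫ ω, G (s.toNNReal, ω) *
        leftIntensity lam s.toNNReal ω k ∂P) := by
    have hnn : ∀ᵐ p ∂((volume.restrict (Set.Ioc (0 : ℝ) t)).prod P),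
        0 ≤ G (p.1.toNNReal, p.2) * leftIntensity lam p.1.toNNReal p.2 k := by
      have := (Measure.quasiMeasurePreserving_snd
        (μ := volume.restrict (Set.Ioc (0 : ℝ) t)) (ν := P)).ae hGq
      filter_upwards [this] with p hp using hp _
    rw [intervalIntegral.integral_of_le t.coe_nonneg, ← integral_prod _ hint,
      ofReal_integral_eq_lintegral_ofReal hint hnn, lintegral_prod _
        hint.aestronglyMeasurable.aemeasurable.ennreal_ofReal, hc,
      Measure.restrict_congr_set Ioc_ae_eq_Icc]
    refine lintegral_congr fun s => lintegral_congr_ae ?_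
    filter_upwards [hG0] with ω hω
    rw [ENNReal.ofReal_mul (hω _)]
  have hcT : c ≠ ⊤ := by rw [hcof]; exact ENNReal.ofReal_ne_top
  have hI0 : 0 ≤ ∫ s in (0 : ℝ)..t, ∫ ω, G (s.toNNReal, ω) *
        leftIntensity lam s.toNNReal ω k ∂P := by
    refine intervalIntegral.integral_nonneg t.coe_nonneg fun s _ => integral_nonneg_of_ae ?_
    filter_upwards [hGq] with ω h using h _
  have hE := lintegral_eventSum_upTo hproc k t hf hgm
  rw [← hc] at hE
  have hEm : Measurable (eventSum T X k (upTo t f) fun n ω => ENNReal.ofReal (g (Y n ω))) :=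
    measurable_eventSum hproc.adapted_events k hf' hgm
  have hET : ∫⁻ ω, eventSum T X k (upTo t f) (fun n ω => ENNReal.ofReal (g (Y n ω))) ω ∂P ≠ ⊤ := by
    rw [hE]
    exact ENNReal.mul_ne_top hgi.lintegral_lt_top.ne hcT
  refine ⟨integrable_toReal_of_lintegral_ne_top hEm.aemeasurable hET, ?_⟩
  rw [integral_toReal hEm.aemeasurable (ae_lt_top hEm hET), hE, ENNReal.toReal_mul]
  have hneg : ν k (Set.Iio 0) * c = 0 := by
    have h1 := lintegral_eventSum_upTo hproc k t hf
      (g := (Set.Iio (0 : ℝ)).indicator 1) (measurable_one.indicator measurableSet_Iio)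
    rw [lintegral_indicator_one measurableSet_Iio, ← hc] at h1
    rw [← h1]
    refine (lintegral_congr_ae ?_).trans lintegral_zero
    filter_upwards [hproc.size_nonneg] with ω hY
    refine ENNReal.tsum_eq_zero.2 fun n => ?_
    simp [(hY n).not_gt]
  rcases mul_eq_zero.1 hneg with h0 | h0
  · have hgn : 0 ≤ᵐ[ν k] g := by
      have : ∀ᵐ x ∂(ν k), x ∉ Set.Iio (0 : ℝ) := measure_eq_zero_iff_ae_notMem.1 h0
      filter_upwards [this] with x hx using hg0 x (not_lt.1 hx)
    rw [integral_eq_lintegral_of_nonneg_ae hgn hg.aestronglyMeasurable, hcof,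
      ENNReal.toReal_ofReal hI0]
  · rw [h0] at hcof
    have : ∫ s in (0 : ℝ)..t, ∫ ω, G (s.toNNReal, ω) *
        leftIntensity lam s.toNNReal ω k ∂P = 0 :=
      le_antisymm (ENNReal.ofReal_eq_zero.1 hcof.symm) hI0
    rw [this, h0]; simp

end MomentEquations

section MomentEquations

variable {Ω : Type*} {d : ℕ} [mΩ : MeasurableSpace Ω] {P : Measure Ω} {𝓕 : Filtration ℝ≥0 mΩ}
  {μ : ℝ≥0 → (Fin d → ℝ) → (Fin d → ℝ)} {A B : Matrix (Fin d) (Fin d) ℝ}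
  {κ : Fin d → Kernel (Fin d → ℝ) ℝ} {l₀ l : Fin d → ℝ} {ν : Fin d → Measure ℝ}
  {T : ℕ → Ω → ℝ≥0∞} {X : ℕ → Ω → Fin d} {Y : ℕ → Ω → ℝ} {lam : ℝ≥0 → Ω → Fin d → ℝ}

theorem driftMatrix_mulVec (A B : Matrix (Fin d) (Fin d) ℝ) (ν : Fin d → Measure ℝ)
    (x : Fin d → ℝ) (i : Fin d) : (driftMatrix A B ν *ᵥ x) i =
      ∑ j, (A i j * x j + B i j * ((∫ y, y ∂(ν j)) * x j)) := by
  simp only [driftMatrix, Matrix.mulVec, dotProduct, Matrix.add_apply, Matrix.mul_diagonal]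
  exact Finset.sum_congr rfl fun j _ => by ring

theorem mulVec_sub_apply (A : Matrix (Fin d) (Fin d) ℝ) (x y : Fin d → ℝ) (i : Fin d) :
    (A *ᵥ (x - y)) i = ∑ j, A i j * x j - (A *ᵥ y) i := by
  rw [Matrix.mulVec_sub, Pi.sub_apply]; rfl

theorem intervalIntegral_sum_mul {ι : Type*} [Fintype ι] {a b : ℝ} (c : ι → ℝ) (f : ι → ℝ → ℝ)
    (hf : ∀ i, IntervalIntegrable (f i) volume a b) :
    IntervalIntegrable (fun s => ∑ i, c i * f i s) volume a b ∧
      ∫ s in a..b, ∑ i, c i * f i s = ∑ i, c i * ∫ s in a..b, f i s := by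
  constructor
  · have := IntervalIntegrable.sum Finset.univ (f := fun i s => c i * f i s)
      fun i _ => (hf i).const_mul (c i)
    refine this.congr fun s _ => ?_
    simp
  · rw [intervalIntegral.integral_finsetSum fun i _ => (hf i).const_mul (c i)]
    simp only [intervalIntegral.integral_const_mul]

/-- The linear equation of the conditional first moments. -/
theorem integral_mul_intensity [IsProbabilityMeasure P] [∀ k, IsProbabilityMeasure (ν k)]
    (hν : ∀ k, Integrable (fun x => x ^ 2) (ν k))
    (hproc : IsSelfExcitingProcess P 𝓕 (fun _ x => A *ᵥ (x - l₀)) B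
      (fun k => Kernel.const (Fin d → ℝ) (ν k)) l T X Y lam) {r t : ℝ≥0} (hrt : r ≤ t)
    {Z : Ω → ℝ} (hZm : Measurable[𝓕 r] Z) (hZ0 : ∀ᵐ ω ∂P, 0 ≤ Z ω) (hZ2 : MemLp Z 2 P) :
    (∀ i, IntervalIntegrable (fun s : ℝ => ∫ ω, Z ω * leftIntensity lam s.toNNReal ω i ∂P)
      volume r t) ∧
    ∀ i, ∫ ω, Z ω * lam t ω i ∂P = (∫ ω, Z ω * lam r ω i ∂P) +
      ∫ s in (r : ℝ)..t, ((driftMatrix A B ν *ᵥ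
        fun j => ∫ ω, Z ω * leftIntensity lam s.toNNReal ω j ∂P) i -
          (∫ ω, Z ω ∂P) * (A *ᵥ l₀) i) := by
  have hrt' : (r : ℝ) ≤ t := by exact_mod_cast hrt
  have hν1 : ∀ k, Integrable (fun x : ℝ => x) (ν k) := fun k =>
    ((memLp_two_iff_integrable_sq measurable_id.aestronglyMeasurable).2 (hν k)).integrable
      one_le_two
  have hle : volume.restrict (Set.Ioc (r : ℝ) t) ≤ volume.restrict (Set.Ioc (0 : ℝ) t) :=
    Measure.restrict_mono (Set.Ioc_subset_Ioc_left r.coe_nonneg) le_rfl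
  have hq0 : ∀ i, Integrable (fun p : ℝ × Ω => Z p.2 * leftIntensity lam p.1.toNNReal p.2 i)
      ((volume.restrict (Set.Ioc (0 : ℝ) t)).prod P) := fun i =>
    (hZ2.comp_snd _).integrable_mul (memLp_leftIntensity_prod hν hproc t i)
  have hq : ∀ i, Integrable (fun p : ℝ × Ω => Z p.2 * leftIntensity lam p.1.toNNReal p.2 i)
      ((volume.restrict (Set.Ioc (r : ℝ) t)).prod P) := fun i =>
    (hq0 i).mono_measure (Measure.prod_mono hle le_rfl)
  have hZi : Integrable Z P := hZ2.integrable one_le_two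
  have hZq : Integrable (fun p : ℝ × Ω => Z p.2)
      ((volume.restrict (Set.Ioc (r : ℝ) t)).prod P) := hZi.comp_snd _
  have hzI : ∀ i, IntervalIntegrable
      (fun s : ℝ => ∫ ω, Z ω * leftIntensity lam s.toNNReal ω i ∂P) volume r t := fun i =>
    (integral_intervalIntegral_swap hrt' (hq i)).2.1
  refine ⟨hzI, fun i => ?_⟩
  have hdq : Integrable (fun p : ℝ × Ω => ∑ j, A i j * (Z p.2 *
      leftIntensity lam p.1.toNNReal p.2 j) - Z p.2 * (A *ᵥ l₀) i)
      ((volume.restrict (Set.Ioc (r : ℝ) t)).prod P) :=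
    (integrable_finsetSum _ fun j _ => (hq j).const_mul (A i j)).sub (hZq.mul_const _)
  obtain ⟨hd1, -, hd3⟩ := integral_intervalIntegral_swap
    (f := fun s ω => ∑ j, A i j * (Z ω *
      leftIntensity lam s.toNNReal ω j) - Z ω * (A *ᵥ l₀) i) hrt' hdq
  have hG : Measurable[𝓕.predictable]
      (fun p : ℝ≥0 × Ω => (Set.Ioi r).indicator (fun _ => Z p.2) p.1) :=
    measurable_predictable_indicator hZm
  have hJ := fun k => integral_eventSum_upTo hproc k t hG
    (by filter_upwards [hZ0] with ω h s using Set.indicator_nonneg (fun _ _ => h) s)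
    measurable_id (fun x hx => hx) (hν1 k) (by
      have hs : MeasurableSet {p : ℝ × Ω | r < p.1.toNNReal} :=
        measurableSet_lt measurable_const (measurable_real_toNNReal.comp measurable_fst)
      refine ((hq0 k).indicator hs).congr (Eventually.of_forall fun p => ?_)
      by_cases h : r < p.1.toNNReal <;> simp [h, Set.indicator])
  simp only [id] at hJ
  have hJint : ∀ k, ∫ s in (0 : ℝ)..t, ∫ ω, (Set.Ioi r).indicator (fun _ => Z ω) s.toNNReal *
        leftIntensity lam s.toNNReal ω k ∂P =
      ∫ s in (r : ℝ)..t, ∫ ω, Z ω * leftIntensity lam s.toNNReal ω k ∂P := by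
    intro k
    rw [intervalIntegral.integral_of_le t.coe_nonneg, intervalIntegral.integral_of_le hrt']
    have : ∀ s : ℝ, (∫ ω, (Set.Ioi r).indicator (fun _ => Z ω) s.toNNReal *
        leftIntensity lam s.toNNReal ω k ∂P) = (Set.Ioi (r : ℝ)).indicator
          (fun s => ∫ ω, Z ω * leftIntensity lam s.toNNReal ω k ∂P) s := by
      intro s
      by_cases h : (r : ℝ) < s
      · have : r < s.toNNReal := Real.lt_toNNReal_iff_coe_lt.2 h
        simp [h, this]
      · have : ¬ r < s.toNNReal := fun h' => h (Real.lt_toNNReal_iff_coe_lt.1 h')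
        simp [h, this]
    simp only [this]
    rw [setIntegral_indicator measurableSet_Ioi, Set.Ioc_inter_Ioi, max_eq_right r.coe_nonneg]
  have hpath : ∀ᵐ ω ∂P, Z ω * lam t ω i = Z ω * lam r ω i +
      (∫ s in (r : ℝ)..t, (∑ j, A i j * (Z ω * leftIntensity lam s.toNNReal ω j) -
        Z ω * (A *ᵥ l₀) i)) +
      ∑ k, B i k * (eventSum T X k
        (upTo t fun p => ENNReal.ofReal ((Set.Ioi r).indicator (fun _ => Z p.2) p.1))
        (fun n ω => ENNReal.ofReal (Y n ω)) ω).toReal := by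
    filter_upwards [ae_mul_intensity_sub hproc r hZ0, ae_ae_leftIntensity_eq hproc] with ω h1 h2
    rw [h1 t hrt i]
    congr 1
    · congr 1
      refine intervalIntegral.integral_congr_ae ?_
      filter_upwards [h2] with s hs _
      rw [mulVec_sub_apply, hs, mul_sub, Finset.mul_sum]
      congr 1
      exact Finset.sum_congr rfl fun j _ => by ring
    · refine Finset.sum_congr rfl fun k _ => ?_
      congr 3
      ext p
      by_cases h : r < p.1 <;> simp [upTo, h, Set.indicator]
  have hZl : ∀ s : ℝ≥0, Integrable (fun ω => Z ω * lam s ω i) P := fun s =>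
    hZ2.integrable_mul (memLp_intensity hν hproc s i)
  rw [integral_congr_ae hpath, integral_add, integral_add (hZl r) hd1, hd3,
    integral_finsetSum, add_assoc]
  rotate_left
  · exact fun k _ => (hJ k).1.const_mul _
  · exact (hZl r).add hd1
  · exact integrable_finsetSum _ fun k _ => (hJ k).1.const_mul _
  congr 1
  simp only [integral_const_mul, (hJ _).2, hJint]
  have e1 : ∀ s : ℝ, ∫ ω, (∑ j, A i j * (Z ω * leftIntensity lam s.toNNReal ω j) -
      Z ω * (A *ᵥ l₀) i) ∂P = ∑ j, A i j * (∫ ω, Z ω * leftIntensity lam s.toNNReal ω j ∂P) -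
        (∫ ω, Z ω ∂P) * (A *ᵥ l₀) i := by
    intro s
    have hi : ∀ j, Integrable (fun ω => Z ω * leftIntensity lam s.toNNReal ω j) P := fun j =>
      hZ2.integrable_mul (memLp_leftIntensity hν hproc s.toNNReal j)
    rw [integral_sub, integral_finsetSum, integral_mul_const]
    · simp only [integral_const_mul]
    · exact fun j _ => (hi j).const_mul _
    · exact integrable_finsetSum _ fun j _ => (hi j).const_mul _
    · exact hZi.mul_const _
  simp only [e1, driftMatrix_mulVec, Finset.sum_add_distrib]
  obtain ⟨hA1, hA2⟩ := intervalIntegral_sum_mul (A i) _ hzI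
  obtain ⟨hB1, hB2⟩ := intervalIntegral_sum_mul (fun j => B i j * ∫ y, y ∂(ν j)) _ hzI
  simp only [← mul_assoc]
  rw [intervalIntegral.integral_sub hA1 intervalIntegrable_const,
    intervalIntegral.integral_sub (hA1.add hB1) intervalIntegrable_const,
    intervalIntegral.integral_add hA1 hB1, hA2, hB2]
  ring

/-- The linear equation of the second moments. -/
theorem integral_intensity_mul_intensity [IsProbabilityMeasure P]
    [∀ k, IsProbabilityMeasure (ν k)] (hν : ∀ k, Integrable (fun x => x ^ 2) (ν k))
    (hproc : IsSelfExcitingProcess P 𝓕 (fun _ x => A *ᵥ (x - l₀)) B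
      (fun k => Kernel.const (Fin d → ℝ) (ν k)) l T X Y lam) (t : ℝ≥0) :
    (∀ i j, IntervalIntegrable (fun s : ℝ => ∫ ω, leftIntensity lam s.toNNReal ω i *
      leftIntensity lam s.toNNReal ω j ∂P) volume 0 t) ∧
    (∀ i, IntervalIntegrable (fun s : ℝ => ∫ ω, leftIntensity lam s.toNNReal ω i ∂P)
      volume 0 t) ∧
    ∀ i j, ∫ ω, lam t ω i * lam t ω j ∂P = l i * l j + ∫ s in (0 : ℝ)..t,
      ((driftMatrix A B ν *ᵥ fun k => ∫ ω, leftIntensity lam s.toNNReal ω i *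
          leftIntensity lam s.toNNReal ω k ∂P) j +
        (driftMatrix A B ν *ᵥ fun k => ∫ ω, leftIntensity lam s.toNNReal ω j *
          leftIntensity lam s.toNNReal ω k ∂P) i +
        (∑ k, (B i k * B j k * ∫ x, x ^ 2 ∂(ν k)) * (∫ ω, leftIntensity lam s.toNNReal ω k ∂P) -
          (A *ᵥ l₀) j * (∫ ω, leftIntensity lam s.toNNReal ω i ∂P) -
          (A *ᵥ l₀) i * (∫ ω, leftIntensity lam s.toNNReal ω j ∂P))) := by
  have hν1 : ∀ k, Integrable (fun x : ℝ => x) (ν k) := fun k =>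
    ((memLp_two_iff_integrable_sq measurable_id.aestronglyMeasurable).2 (hν k)).integrable
      one_le_two
  have hq : ∀ i j, Integrable (fun p : ℝ × Ω => leftIntensity lam p.1.toNNReal p.2 i *
      leftIntensity lam p.1.toNNReal p.2 j) ((volume.restrict (Set.Ioc (0 : ℝ) t)).prod P) :=
    fun i j => (memLp_leftIntensity_prod hν hproc t i).integrable_mul
      (memLp_leftIntensity_prod hν hproc t j)
  have hq1 : ∀ i, Integrable (fun p : ℝ × Ω => leftIntensity lam p.1.toNNReal p.2 i)
      ((volume.restrict (Set.Ioc (0 : ℝ) t)).prod P) :=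
    fun i => (memLp_leftIntensity_prod hν hproc t i).integrable one_le_two
  have hvI : ∀ i j, IntervalIntegrable (fun s : ℝ => ∫ ω, leftIntensity lam s.toNNReal ω i *
      leftIntensity lam s.toNNReal ω j ∂P) volume 0 t := fun i j =>
    (integral_intervalIntegral_swap t.coe_nonneg (hq i j)).2.1
  have hyI : ∀ i, IntervalIntegrable (fun s : ℝ => ∫ ω, leftIntensity lam s.toNNReal ω i ∂P)
      volume 0 t := fun i => (integral_intervalIntegral_swap t.coe_nonneg (hq1 i)).2.1
  refine ⟨hvI, hyI, fun i j => ?_⟩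
  have hdq : Integrable (fun p : ℝ × Ω =>
      (∑ k, A j k * (leftIntensity lam p.1.toNNReal p.2 i * leftIntensity lam p.1.toNNReal p.2 k) -
        (A *ᵥ l₀) j * leftIntensity lam p.1.toNNReal p.2 i) +
      (∑ k, A i k * (leftIntensity lam p.1.toNNReal p.2 j * leftIntensity lam p.1.toNNReal p.2 k) -
        (A *ᵥ l₀) i * leftIntensity lam p.1.toNNReal p.2 j))
      ((volume.restrict (Set.Ioc (0 : ℝ) t)).prod P) :=
    ((integrable_finsetSum _ fun k _ => (hq i k).const_mul (A j k)).sub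
      ((hq1 i).const_mul _)).add
    ((integrable_finsetSum _ fun k _ => (hq j k).const_mul (A i k)).sub ((hq1 j).const_mul _))
  obtain ⟨hd1, -, hd3⟩ := integral_intervalIntegral_swap (f := fun s ω =>
      (∑ k, A j k * (leftIntensity lam s.toNNReal ω i * leftIntensity lam s.toNNReal ω k) -
        (A *ᵥ l₀) j * leftIntensity lam s.toNNReal ω i) +
      (∑ k, A i k * (leftIntensity lam s.toNNReal ω j * leftIntensity lam s.toNNReal ω k) -
        (A *ᵥ l₀) i * leftIntensity lam s.toNNReal ω j)) t.coe_nonneg hdq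
  have hL0 := ae_leftIntensity_nonneg hproc
  have hJ := fun i k => integral_eventSum_upTo hproc k t
    (G := fun p => leftIntensity lam p.1 p.2 i)
    ((measurable_pi_apply i).comp (measurable_leftIntensity_predictable hproc))
    (by filter_upwards [hL0] with ω h s using h s i)
    measurable_id (fun x hx => hx) (hν1 k) (hq i k)
  have hJ2 := fun k => integral_eventSum_upTo hproc k t (G := fun _ => 1) measurable_const
    (Eventually.of_forall fun _ _ => zero_le_one) (g := fun x => x ^ 2)
    (measurable_id.pow_const 2) (fun x _ => sq_nonneg x) (hν k) (by simpa using hq1 k)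
  simp only [ENNReal.ofReal_one, one_mul, id] at hJ hJ2
  have hpath : ∀ᵐ ω ∂P, lam t ω i * lam t ω j = l i * l j +
      (∫ s in (0 : ℝ)..t, ((∑ k, A j k * (leftIntensity lam s.toNNReal ω i *
          leftIntensity lam s.toNNReal ω k) - (A *ᵥ l₀) j * leftIntensity lam s.toNNReal ω i) +
        (∑ k, A i k * (leftIntensity lam s.toNNReal ω j * leftIntensity lam s.toNNReal ω k) -
          (A *ᵥ l₀) i * leftIntensity lam s.toNNReal ω j))) +
      ∑ k, (B j k * (eventSum T X k (upTo t fun p => ENNReal.ofReal (leftIntensity lam p.1 p.2 i))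
            (fun n ω => ENNReal.ofReal (Y n ω)) ω).toReal +
          B i k * (eventSum T X k (upTo t fun p => ENNReal.ofReal (leftIntensity lam p.1 p.2 j))
            (fun n ω => ENNReal.ofReal (Y n ω)) ω).toReal +
          B i k * B j k * (eventSum T X k (upTo t fun _ => 1)
            (fun n ω => ENNReal.ofReal (Y n ω ^ 2)) ω).toReal) := by
    filter_upwards [ae_intensity_mul_intensity hproc, ae_ae_leftIntensity_eq hproc] with ω h1 h2
    rw [h1 t i j]
    congr 2
    refine intervalIntegral.integral_congr_ae ?_
    filter_upwards [h2] with s hs _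
    rw [mulVec_sub_apply, mulVec_sub_apply, hs, mul_sub, mul_sub, Finset.mul_sum, Finset.mul_sum]
    congr 1
    · congr 1
      · exact Finset.sum_congr rfl fun j _ => by ring
      · ring
    · congr 1
      · exact Finset.sum_congr rfl fun j _ => by ring
      · ring
  have hJi : ∀ k, Integrable (fun ω => B j k * (eventSum T X k
        (upTo t fun p => ENNReal.ofReal (leftIntensity lam p.1 p.2 i))
            (fun n ω => ENNReal.ofReal (Y n ω)) ω).toReal +
          B i k * (eventSum T X k (upTo t fun p => ENNReal.ofReal (leftIntensity lam p.1 p.2 j))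
            (fun n ω => ENNReal.ofReal (Y n ω)) ω).toReal) P := fun k =>
    ((hJ i k).1.const_mul _).add ((hJ j k).1.const_mul _)
  have hJii : ∀ k, Integrable (fun ω => B j k * (eventSum T X k
        (upTo t fun p => ENNReal.ofReal (leftIntensity lam p.1 p.2 i))
            (fun n ω => ENNReal.ofReal (Y n ω)) ω).toReal +
          B i k * (eventSum T X k (upTo t fun p => ENNReal.ofReal (leftIntensity lam p.1 p.2 j))
            (fun n ω => ENNReal.ofReal (Y n ω)) ω).toReal +
          B i k * B j k * (eventSum T X k (upTo t fun _ => 1)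
            (fun n ω => ENNReal.ofReal (Y n ω ^ 2)) ω).toReal) P := fun k =>
    (hJi k).add ((hJ2 k).1.const_mul _)
  rw [integral_congr_ae hpath, integral_add, integral_add (integrable_const _) hd1, hd3,
    integral_finsetSum, add_assoc]
  rotate_left
  · exact fun k _ => hJii k
  · exact (integrable_const _).add hd1
  · exact integrable_finsetSum _ fun k _ => hJii k
  congr 1
  · simp
  have e2 : ∀ k, ∫ ω, (B j k * (eventSum T X k
        (upTo t fun p => ENNReal.ofReal (leftIntensity lam p.1 p.2 i))
            (fun n ω => ENNReal.ofReal (Y n ω)) ω).toReal +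
          B i k * (eventSum T X k (upTo t fun p => ENNReal.ofReal (leftIntensity lam p.1 p.2 j))
            (fun n ω => ENNReal.ofReal (Y n ω)) ω).toReal +
          B i k * B j k * (eventSum T X k (upTo t fun _ => 1)
            (fun n ω => ENNReal.ofReal (Y n ω ^ 2)) ω).toReal) ∂P =
      (B j k * ∫ y, y ∂(ν k)) * (∫ s in (0 : ℝ)..t, ∫ ω, leftIntensity lam s.toNNReal ω i *
          leftIntensity lam s.toNNReal ω k ∂P) +
      (B i k * ∫ y, y ∂(ν k)) * (∫ s in (0 : ℝ)..t, ∫ ω, leftIntensity lam s.toNNReal ω j *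
          leftIntensity lam s.toNNReal ω k ∂P) +
      (B i k * B j k * ∫ x, x ^ 2 ∂(ν k)) *
        (∫ s in (0 : ℝ)..t, ∫ ω, leftIntensity lam s.toNNReal ω k ∂P) := by
    intro k
    rw [integral_add (hJi k) ((hJ2 k).1.const_mul _),
      integral_add ((hJ i k).1.const_mul _) ((hJ j k).1.const_mul _)]
    simp only [integral_const_mul, (hJ _ _).2, (hJ2 _).2]
    ring
  have e1 : ∀ s : ℝ, ∫ ω, ((∑ k, A j k * (leftIntensity lam s.toNNReal ω i *
          leftIntensity lam s.toNNReal ω k) - (A *ᵥ l₀) j * leftIntensity lam s.toNNReal ω i) +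
        (∑ k, A i k * (leftIntensity lam s.toNNReal ω j * leftIntensity lam s.toNNReal ω k) -
          (A *ᵥ l₀) i * leftIntensity lam s.toNNReal ω j)) ∂P =
      (∑ k, A j k * (∫ ω, leftIntensity lam s.toNNReal ω i *
          leftIntensity lam s.toNNReal ω k ∂P) -
        (A *ᵥ l₀) j * (∫ ω, leftIntensity lam s.toNNReal ω i ∂P)) +
      (∑ k, A i k * (∫ ω, leftIntensity lam s.toNNReal ω j *
          leftIntensity lam s.toNNReal ω k ∂P) -
        (A *ᵥ l₀) i * (∫ ω, leftIntensity lam s.toNNReal ω j ∂P)) := by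
    intro s
    have hi : ∀ i j, Integrable (fun ω => leftIntensity lam s.toNNReal ω i *
        leftIntensity lam s.toNNReal ω j) P := fun i j =>
      (memLp_leftIntensity hν hproc s.toNNReal i).integrable_mul
        (memLp_leftIntensity hν hproc s.toNNReal j)
    have hi1 : ∀ i, Integrable (fun ω => leftIntensity lam s.toNNReal ω i) P := fun i =>
      (memLp_leftIntensity hν hproc s.toNNReal i).integrable one_le_two
    have hs : ∀ i j, Integrable (fun ω => ∑ k, A j k * (leftIntensity lam s.toNNReal ω i *
        leftIntensity lam s.toNNReal ω k)) P := fun i j =>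
      integrable_finsetSum _ fun k _ => (hi i k).const_mul _
    have hs1 : ∀ i j, Integrable (fun ω => (A *ᵥ l₀) j * leftIntensity lam s.toNNReal ω i) P :=
      fun i j => (hi1 i).const_mul _
    rw [integral_add, integral_sub (hs i j) (hs1 i j), integral_sub (hs j i) (hs1 j i),
      integral_finsetSum, integral_finsetSum]
    · simp only [integral_const_mul]
    · exact fun k _ => (hi j k).const_mul _
    · exact fun k _ => (hi i k).const_mul _
    · exact (hs i j).sub (hs1 i j)
    · exact (hs j i).sub (hs1 j i)
  simp only [e1, e2]
  simp only [driftMatrix_mulVec, Finset.sum_add_distrib, ← mul_assoc]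
  obtain ⟨hA1, hA2⟩ := intervalIntegral_sum_mul (A j) _ (hvI i)
  obtain ⟨hA3, hA4⟩ := intervalIntegral_sum_mul (A i) _ (hvI j)
  obtain ⟨hB1, hB2⟩ := intervalIntegral_sum_mul (fun k => B j k * ∫ y, y ∂(ν k)) _ (hvI i)
  obtain ⟨hB3, hB4⟩ := intervalIntegral_sum_mul (fun k => B i k * ∫ y, y ∂(ν k)) _ (hvI j)
  obtain ⟨hC1, hC2⟩ := intervalIntegral_sum_mul
    (fun k => B i k * B j k * ∫ x, x ^ 2 ∂(ν k)) _ hyI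
  have hyi := (hyI i).const_mul ((A *ᵥ l₀) j)
  have hyj := (hyI j).const_mul ((A *ᵥ l₀) i)
  rw [intervalIntegral.integral_add (hA1.sub hyi) (hA3.sub hyj),
    intervalIntegral.integral_sub hA1 hyi, intervalIntegral.integral_sub hA3 hyj,
    intervalIntegral.integral_add ((hA1.add hB1).add (hA3.add hB3)) ((hC1.sub hyi).sub hyj),
    intervalIntegral.integral_add (hA1.add hB1) (hA3.add hB3),
    intervalIntegral.integral_add hA1 hB1, intervalIntegral.integral_add hA3 hB3,
    intervalIntegral.integral_sub (hC1.sub hyi) hyj, intervalIntegral.integral_sub hC1 hyi,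
    hA2, hA4, hB2, hB4, hC2]
  ring

end MomentEquations

section LinearSystems

theorem mul_apply_eq_mulVec_col {d : ℕ} (M N : Matrix (Fin d) (Fin d) ℝ) (i j : Fin d) :
    (M * N) i j = (M *ᵥ N.col j) i := rfl

theorem eq_exp_mulVec_add_of_integral_eq {d : ℕ} (M : Matrix (Fin d) (Fin d) ℝ)
    (x : ℝ → Fin d → ℝ) (x₀ c : Fin d → ℝ) {t : ℝ} (ht : 0 ≤ t)
    (hI : ∀ t, 0 ≤ t → ∀ i, IntervalIntegrable (fun s => x s i) volume 0 t)
    (hx : ∀ t, 0 ≤ t → ∀ i, x t i = x₀ i + ∫ s in (0 : ℝ)..t, ((M *ᵥ x s) i - (M *ᵥ c) i)) :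
    x t = NormedSpace.exp (t • M) *ᵥ (x₀ - c) + c := by
  have h := eq_exp_mulVec_of_integral_eq M (fun t => x t - c) (x₀ - c)
    (fun t ht i => (hI t ht i).sub intervalIntegrable_const) (fun t ht i => by
      simp only [Matrix.mulVec_sub, Pi.sub_apply, hx t ht i]; ring) ht
  rw [← h]; simp

theorem exists_eq_of_dissipative {ι : Type*} [Fintype ι] (L : (ι → ℝ) →ₗ[ℝ] ι → ℝ) {c : ℝ}
    (hc : 0 < c) (hL : ∀ x, x ⬝ᵥ L x ≤ -c * (x ⬝ᵥ x)) : Function.Surjective L := by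
  refine LinearMap.injective_iff_surjective.1 ((injective_iff_map_eq_zero L).2 fun x hx => ?_)
  have h1 := hL x
  rw [hx, dotProduct_zero] at h1
  have h2 : 0 ≤ x ⬝ᵥ x := Finset.sum_nonneg fun i _ => mul_self_nonneg _
  exact dotProduct_self_eq_zero.1 (le_antisymm (by nlinarith) h2)

/-- A linear system with a dissipative generator and a convergent inhomogeneity has a
convergent solution. -/
theorem exists_tendsto_of_dissipative {ι : Type*} [Fintype ι] (L : (ι → ℝ) →ₗ[ℝ] ι → ℝ) {c : ℝ}
    (hc : 0 < c) (hL : ∀ x, x ⬝ᵥ L x ≤ -c * (x ⬝ᵥ x)) (x g : ℝ → ι → ℝ) (x₀ g₀ : ι → ℝ)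
    (hI : ∀ t, 0 ≤ t → ∀ i, IntervalIntegrable (fun s => x s i) volume 0 t)
    (hgc : ∀ i, ContinuousOn (fun t => g t i) (Set.Ici 0))
    (hx : ∀ t, 0 ≤ t → ∀ i, x t i = x₀ i + ∫ s in (0 : ℝ)..t, (L (x s) i + g s i))
    (hg : ∀ i, Tendsto (fun t => g t i) atTop (𝓝 (g₀ i))) :
    ∃ y, L y = -g₀ ∧ ∀ i, ContinuousOn (fun t => x t i) (Set.Ici 0) ∧
      Tendsto (fun t => x t i) atTop (𝓝 (y i)) := by
  classical
  obtain ⟨y, hy⟩ := exists_eq_of_dissipative L hc hL (-g₀)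
  have hLi : ∀ i, Continuous fun v => L v i := fun i =>
    (continuous_apply i).comp (LinearMap.continuous_of_finiteDimensional L)
  have hLI : ∀ t, 0 ≤ t → ∀ i, IntervalIntegrable (fun s => L (x s) i) volume 0 t := by
    intro t ht i
    have h1 : (fun s => L (x s) i) =
        fun s => ∑ j, L (fun k => if j = k then 1 else 0) i * x s j := by
      ext s
      rw [LinearMap.pi_apply_eq_sum_univ L (x s), Finset.sum_apply]
      exact Finset.sum_congr rfl fun j _ => mul_comm _ _
    rw [h1]
    exact (intervalIntegral_sum_mul _ _ (hI t ht)).1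
  have hgI : ∀ t, 0 ≤ t → ∀ i, IntervalIntegrable (fun s => g s i) volume 0 t := by
    intro t ht i
    refine ContinuousOn.intervalIntegrable ?_
    rw [Set.uIcc_of_le ht]
    exact (hgc i).mono Set.Icc_subset_Ici_self
  have hxc : ∀ i, ContinuousOn (fun t => x t i) (Set.Ici 0) := fun i =>
    continuousOn_of_integral_eq (fun t ht => (hLI t ht i).add (hgI t ht i))
      (fun t ht => hx t ht i)
  have hxc' : ContinuousOn x (Set.Ici 0) := continuousOn_pi.2 hxc
  have hxd : ∀ t, 0 ≤ t → ∀ i, HasDerivWithinAt (fun t => x t i) (L (x t) i + g t i)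
      (Set.Ici t) t := fun t ht i =>
    hasDerivWithinAt_of_integral_eq (F := fun t => L (x t) i + g t i)
      (((hLi i).comp_continuousOn hxc').add (hgc i)) (fun t ht => hx t ht i) ht
  refine ⟨y, hy, fun i => ⟨hxc i, ?_⟩⟩
  have h0 := tendsto_zero_of_dissipative L hc hL (fun t => x t - y) (fun t => g t - g₀)
    (fun i => (hxc i).sub continuousOn_const) (fun t ht i => by
      refine ((hxd t ht i).sub_const (y i)).congr_deriv ?_
      rw [map_sub, hy]
      simp only [Pi.sub_apply, Pi.neg_apply]
      ring)
    (fun i => by simpa using (hg i).sub_const (g₀ i)) i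
  simpa using h0.add_const (y i)

/-- The operator `V ↦ M V + V Mᵀ`, on functions of pairs of indices. -/
def lyapunovMap {d : ℕ} (M : Matrix (Fin d) (Fin d) ℝ) :
    (Fin d × Fin d → ℝ) →ₗ[ℝ] Fin d × Fin d → ℝ where
  toFun w p := (M *ᵥ fun k => w (p.1, k)) p.2 + (M *ᵥ fun k => w (k, p.2)) p.1
  map_add' w w' := by
    ext p
    simp only [Matrix.mulVec, dotProduct, Pi.add_apply, mul_add, Finset.sum_add_distrib]
    ring
  map_smul' a w := by
    ext p
    simp only [Matrix.mulVec, dotProduct, Pi.smul_apply, smul_eq_mul, RingHom.id_apply,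
      mul_add, Finset.mul_sum]
    congr 1 <;> exact Finset.sum_congr rfl fun k _ => by ring

theorem dotProduct_lyapunovMap_le {d : ℕ} {M : Matrix (Fin d) (Fin d) ℝ} {c : ℝ}
    (hM : ∀ x : Fin d → ℝ, x ⬝ᵥ (M *ᵥ x) ≤ -c * (x ⬝ᵥ x)) (w : Fin d × Fin d → ℝ) :
    w ⬝ᵥ lyapunovMap M w ≤ -(2 * c) * (w ⬝ᵥ w) := by
  have h1 : w ⬝ᵥ lyapunovMap M w =
      ∑ i, ((fun k => w (i, k)) ⬝ᵥ (M *ᵥ fun k => w (i, k))) +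
      ∑ j, ((fun k => w (k, j)) ⬝ᵥ (M *ᵥ fun k => w (k, j))) := by
    have : w ⬝ᵥ lyapunovMap M w = ∑ i, ∑ j, (w (i, j) * (M *ᵥ fun k => w (i, k)) j) +
        ∑ i, ∑ j, (w (i, j) * (M *ᵥ fun k => w (k, j)) i) := by
      rw [← Finset.sum_add_distrib]
      simp only [dotProduct, Fintype.sum_prod_type, ← Finset.sum_add_distrib, lyapunovMap,
        LinearMap.coe_mk, AddHom.coe_mk, mul_add]
    rw [this, Finset.sum_comm (f := fun i j => w (i, j) * (M *ᵥ fun k => w (k, j)) i)]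
    rfl
  have h2 : w ⬝ᵥ w = ∑ i, ((fun k => w (i, k)) ⬝ᵥ fun k => w (i, k)) := by
    simp only [dotProduct, Fintype.sum_prod_type]
  have h3 : w ⬝ᵥ w = ∑ j, ((fun k => w (k, j)) ⬝ᵥ fun k => w (k, j)) := by
    rw [h2]
    simp only [dotProduct]
    rw [Finset.sum_comm]
  have h4 := Finset.sum_le_sum fun i (_ : i ∈ Finset.univ) => hM fun k => w (i, k)
  have h5 := Finset.sum_le_sum fun j (_ : j ∈ Finset.univ) => hM fun k => w (k, j)
  rw [← Finset.mul_sum] at h4 h5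
  rw [← h2] at h4
  rw [← h3] at h5
  rw [h1]
  linarith

/-- Convergence of a symmetric solution of a Lyapunov equation. -/
theorem exists_tendsto_of_lyapunov {d : ℕ} {M : Matrix (Fin d) (Fin d) ℝ} {c : ℝ} (hc : 0 < c)
    (hM : ∀ x : Fin d → ℝ, x ⬝ᵥ (M *ᵥ x) ≤ -c * (x ⬝ᵥ x))
    (v g : Fin d → Fin d → ℝ → ℝ) (v₀ g₀ : Fin d → Fin d → ℝ)
    (hsymm : ∀ i j t, v i j t = v j i t)
    (hI : ∀ t, 0 ≤ t → ∀ i j, IntervalIntegrable (v i j) volume 0 t)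
    (hgc : ∀ i j, ContinuousOn (g i j) (Set.Ici 0))
    (hv : ∀ t, 0 ≤ t → ∀ i j, v i j t = v₀ i j + ∫ s in (0 : ℝ)..t,
      ((M *ᵥ fun k => v i k s) j + (M *ᵥ fun k => v j k s) i + g i j s))
    (hg : ∀ i j, Tendsto (g i j) atTop (𝓝 (g₀ i j))) :
    ∃ L : Matrix (Fin d) (Fin d) ℝ, ∀ i j, Tendsto (v i j) atTop (𝓝 (L i j)) := by
  obtain ⟨w, -, hw⟩ := exists_tendsto_of_dissipative (lyapunovMap M) (mul_pos two_pos hc)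
    (dotProduct_lyapunovMap_le hM) (fun t p => v p.1 p.2 t) (fun t p => g p.1 p.2 t)
    (fun p => v₀ p.1 p.2) (fun p => g₀ p.1 p.2) (fun t ht p => hI t ht p.1 p.2)
    (fun p => hgc p.1 p.2) (fun t ht p => by
      rw [hv t ht]
      simp only [lyapunovMap, LinearMap.coe_mk, AddHom.coe_mk, hsymm p.2 _])
    (fun p => hg p.1 p.2)
  exact ⟨fun i j => w (i, j), fun i j => (hw (i, j)).2⟩

theorem exists_tendsto_of_lyapunov_forcing {d : ℕ} {M : Matrix (Fin d) (Fin d) ℝ} {a : ℝ}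
    (ha : 0 < a) (hM : ∀ x : Fin d → ℝ, x ⬝ᵥ (M *ᵥ x) ≤ -a * (x ⬝ᵥ x))
    (v : Fin d → Fin d → ℝ → ℝ) (y : Fin d → ℝ → ℝ) (v₀ : Fin d → Fin d → ℝ) (b c : Fin d → ℝ)
    (Q : Fin d → Fin d → Fin d → ℝ) (hsymm : ∀ i j t, v i j t = v j i t)
    (hI : ∀ t, 0 ≤ t → ∀ i j, IntervalIntegrable (v i j) volume 0 t)
    (hyc : ∀ i, ContinuousOn (y i) (Set.Ici 0)) (hy : ∀ i, Tendsto (y i) atTop (𝓝 (c i)))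
    (hv : ∀ t, 0 ≤ t → ∀ i j, v i j t = v₀ i j + ∫ s in (0 : ℝ)..t,
      ((M *ᵥ fun k => v i k s) j + (M *ᵥ fun k => v j k s) i +
        (∑ k, Q i j k * y k s - b j * y i s - b i * y j s))) :
    ∃ L : Matrix (Fin d) (Fin d) ℝ, ∀ i j, Tendsto (v i j) atTop (𝓝 (L i j)) :=
  exists_tendsto_of_lyapunov ha hM v
    (fun i j s => ∑ k, Q i j k * y k s - b j * y i s - b i * y j s) v₀
    (fun i j => ∑ k, Q i j k * c k - b j * c i - b i * c j) hsymm hI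
    (fun i j => ((continuousOn_finsetSum _ fun k _ => continuousOn_const.mul (hyc k)).sub
      (continuousOn_const.mul (hyc i))).sub (continuousOn_const.mul (hyc j)))
    hv
    (fun i j => ((tendsto_finsetSum _ fun k _ => (hy k).const_mul _).sub
      ((hy i).const_mul _)).sub ((hy j).const_mul _))

theorem isUnit_det_of_dissipative {d : ℕ} {M : Matrix (Fin d) (Fin d) ℝ} {c : ℝ} (hc : 0 < c)
    (hM : ∀ x : Fin d → ℝ, x ⬝ᵥ (M *ᵥ x) ≤ -c * (x ⬝ᵥ x)) : IsUnit M.det := by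
  rw [← Matrix.isUnit_iff_isUnit_det, ← Matrix.mulVec_surjective_iff_isUnit]
  exact exists_eq_of_dissipative (Matrix.toLin' M) hc hM

end LinearSystems

section Covariance

variable {Ω : Type*} {d : ℕ} [mΩ : MeasurableSpace Ω] {P : Measure Ω} {𝓕 : Filtration ℝ≥0 mΩ}
  {μ : ℝ≥0 → (Fin d → ℝ) → (Fin d → ℝ)} {A B : Matrix (Fin d) (Fin d) ℝ}
  {κ : Fin d → Kernel (Fin d → ℝ) ℝ} {l₀ l : Fin d → ℝ} {ν : Fin d → Measure ℝ}
  {T : ℕ → Ω → ℝ≥0∞} {X : ℕ → Ω → Fin d} {Y : ℕ → Ω → ℝ} {lam : ℝ≥0 → Ω → Fin d → ℝ}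

theorem ae_intensity_zero (hproc : IsSelfExcitingProcess P 𝓕 μ B κ l T X Y lam) :
    ∀ᵐ ω ∂P, lam 0 ω = l := by
  filter_upwards [ae_eq_jumpPath hproc] with ω h
  obtain ⟨S, -, hτ, -, -, hpath⟩ := h 0
  have hS : S = ∅ := Finset.eq_empty_of_forall_notMem fun n hn => by
    have h1 := (hτ n hn).1.trans_le (hτ n hn).2
    simp at h1
  ext i
  rw [hpath 0 le_rfl i, hS]
  simp [jumpPath]

theorem firstMoment_eq (hproc : IsSelfExcitingProcess P 𝓕 μ B κ l T X Y lam) (t : ℝ≥0)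
    (i : Fin d) : firstMoment P lam t i = ∫ ω, leftIntensity lam t ω i ∂P := by
  refine integral_congr_ae ?_
  filter_upwards [ae_leftIntensity_eq hproc t] with ω h
  rw [h]

theorem secondMoment_eq (hproc : IsSelfExcitingProcess P 𝓕 μ B κ l T X Y lam) (t : ℝ≥0)
    (i j : Fin d) : secondMoment P lam t i j =
      ∫ ω, leftIntensity lam t ω i * leftIntensity lam t ω j ∂P := by
  refine integral_congr_ae ?_
  filter_upwards [ae_leftIntensity_eq hproc t] with ω h
  rw [h]

/-- The conditional mean of the intensity. -/
theorem integral_mul_intensity_add [IsProbabilityMeasure P] [∀ k, IsProbabilityMeasure (ν k)]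
    (hν : ∀ k, Integrable (fun x => x ^ 2) (ν k))
    (hproc : IsSelfExcitingProcess P 𝓕 (fun _ x => A *ᵥ (x - l₀)) B
      (fun k => Kernel.const (Fin d → ℝ) (ν k)) l T X Y lam) {r : ℝ≥0}
    {Z : Ω → ℝ} (hZm : Measurable[𝓕 r] Z) (hZ0 : ∀ᵐ ω ∂P, 0 ≤ Z ω) (hZ2 : MemLp Z 2 P)
    {c : Fin d → ℝ} (hc : driftMatrix A B ν *ᵥ c = A *ᵥ l₀) (h : ℝ≥0) :
    (fun i => ∫ ω, Z ω * lam (r + h) ω i ∂P) =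
      NormedSpace.exp ((h : ℝ) • driftMatrix A B ν) *ᵥ
        ((fun i => ∫ ω, Z ω * lam r ω i ∂P) - (∫ ω, Z ω ∂P) • c) + (∫ ω, Z ω ∂P) • c := by
  have hlr : ∀ (s : ℝ≥0) i, ∫ ω, Z ω * lam s ω i ∂P = ∫ ω, Z ω * leftIntensity lam s ω i ∂P := by
    intro s i
    refine integral_congr_ae ?_
    filter_upwards [ae_leftIntensity_eq hproc s] with ω h
    rw [h]
  have hshift : ∀ s : ℝ, 0 ≤ s → ((r + s.toNNReal : ℝ≥0) : ℝ) = r + s := fun s hs => by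
    rw [NNReal.coe_add, Real.coe_toNNReal s hs]
  have hmain := eq_exp_mulVec_add_of_integral_eq (driftMatrix A B ν)
    (fun s i => ∫ ω, Z ω * leftIntensity lam (r + s).toNNReal ω i ∂P)
    (fun i => ∫ ω, Z ω * lam r ω i ∂P) ((∫ ω, Z ω ∂P) • c) h.coe_nonneg ?_ ?_
  · rw [← hmain]
    ext i
    rw [hlr, ← NNReal.coe_add, Real.toNNReal_coe]
  · intro s hs i
    have h1 := (integral_mul_intensity hν hproc (le_add_of_nonneg_right (zero_le (a := s.toNNReal)) :
      r ≤ r + s.toNNReal) hZm hZ0 hZ2).1 i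
    rw [hshift s hs] at h1
    simpa using h1.comp_add_left (c := (r : ℝ))
  · intro s hs i
    have h1 := (integral_mul_intensity hν hproc (le_add_of_nonneg_right (zero_le (a := s.toNNReal)) :
      r ≤ r + s.toNNReal) hZm hZ0 hZ2).2 i
    rw [hlr (r + s.toNNReal), hshift s hs] at h1
    have e : ((r : ℝ) + s).toNNReal = r + s.toNNReal := by
      rw [← hshift s hs, Real.toNNReal_coe]
    rw [e, h1]
    congr 1
    have h2 := intervalIntegral.integral_comp_add_left (a := 0) (b := s)
      (fun s : ℝ => ((driftMatrix A B ν *ᵥ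
        fun j => ∫ ω, Z ω * leftIntensity lam s.toNNReal ω j ∂P) i -
          (∫ ω, Z ω ∂P) * (A *ᵥ l₀) i)) (r : ℝ)
    rw [add_zero] at h2
    rw [← h2, Matrix.mulVec_smul, hc]
    rfl

theorem firstMoment_eq_exp [IsProbabilityMeasure P] [∀ k, IsProbabilityMeasure (ν k)]
    (hν : ∀ k, Integrable (fun x => x ^ 2) (ν k))
    (hproc : IsSelfExcitingProcess P 𝓕 (fun _ x => A *ᵥ (x - l₀)) B
      (fun k => Kernel.const (Fin d → ℝ) (ν k)) l T X Y lam)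
    {c : Fin d → ℝ} (hc : driftMatrix A B ν *ᵥ c = A *ᵥ l₀) (t : ℝ≥0) :
    firstMoment P lam t = NormedSpace.exp ((t : ℝ) • driftMatrix A B ν) *ᵥ (l - c) + c := by
  have h := integral_mul_intensity_add hν hproc (r := 0) (Z := fun _ => 1) measurable_const
    (Eventually.of_forall fun _ => zero_le_one) (memLp_const 1) hc t
  have h0 : (fun i => ∫ ω, lam 0 ω i ∂P) = l := by
    ext i
    rw [integral_congr_ae (g := fun _ => l i)]
    · simp
    · filter_upwards [ae_intensity_zero hproc] with ω h
      rw [h]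
  simp only [one_mul, zero_add, integral_const, probReal_univ, one_smul] at h
  rw [h0] at h
  exact h

/-- The autocovariance in terms of the first two moments. -/
theorem autocovariance_apply [IsProbabilityMeasure P] [∀ k, IsProbabilityMeasure (ν k)]
    (hν : ∀ k, Integrable (fun x => x ^ 2) (ν k))
    (hproc : IsSelfExcitingProcess P 𝓕 (fun _ x => A *ᵥ (x - l₀)) B
      (fun k => Kernel.const (Fin d → ℝ) (ν k)) l T X Y lam)
    {c : Fin d → ℝ} (hc : driftMatrix A B ν *ᵥ c = A *ᵥ l₀) (t h : ℝ≥0) (i j : Fin d) :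
    autocovariance P lam t h i j =
      (NormedSpace.exp ((h : ℝ) • driftMatrix A B ν) *ᵥ
        ((secondMoment P lam t).col j - firstMoment P lam t j • c)) i +
        firstMoment P lam t j * c i - firstMoment P lam (t + h) i * firstMoment P lam t j := by
  have hmem := memLp_intensity hν hproc
  have hZm : Measurable[𝓕 t] fun ω => lam t ω j :=
    (measurable_pi_apply j).comp (hproc.adapted_intensity t)
  have hZ0 : ∀ᵐ ω ∂P, 0 ≤ lam t ω j := by
    filter_upwards [hproc.intensity_nonneg] with ω h using h t j
  have h1 := congrFun (integral_mul_intensity_add hν hproc hZm hZ0 (hmem t j) hc h) i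
  have h2 : (fun i => ∫ ω, lam t ω j * lam t ω i ∂P) = (secondMoment P lam t).col j := by
    ext i
    simp only [secondMoment, Matrix.col_apply, Matrix.of_apply, mul_comm]
  have hp : Integrable (fun ω => lam t ω j * lam (t + h) ω i) P :=
    (hmem t j).integrable_mul (hmem (t + h) i)
  have hi : Integrable (fun ω => lam (t + h) ω i) P := (hmem (t + h) i).integrable one_le_two
  have hj : Integrable (fun ω => lam t ω j) P := (hmem t j).integrable one_le_two
  have h3 : autocovariance P lam t h i j = (∫ ω, lam t ω j * lam (t + h) ω i ∂P) -
      firstMoment P lam (t + h) i * firstMoment P lam t j := by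
    have e : ∀ ω, (lam (t + h) ω i - firstMoment P lam (t + h) i) *
        (lam t ω j - firstMoment P lam t j) = lam t ω j * lam (t + h) ω i -
        (firstMoment P lam t j * lam (t + h) ω i + firstMoment P lam (t + h) i * lam t ω j -
          firstMoment P lam (t + h) i * firstMoment P lam t j) := fun ω => by ring
    simp only [autocovariance, Matrix.of_apply, e]
    have h4 : Integrable (fun ω => firstMoment P lam t j * lam (t + h) ω i +
        firstMoment P lam (t + h) i * lam t ω j) P := (hi.const_mul _).add (hj.const_mul _)
    have h5 : Integrable (fun ω => firstMoment P lam t j * lam (t + h) ω i +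
        firstMoment P lam (t + h) i * lam t ω j -
          firstMoment P lam (t + h) i * firstMoment P lam t j) P := h4.sub (integrable_const _)
    rw [integral_sub hp h5, integral_sub h4 (integrable_const _),
      integral_add (hi.const_mul _) (hj.const_mul _), integral_const_mul, integral_const_mul,
      integral_const]
    simp only [firstMoment, probReal_univ, one_smul]
    ring
  rw [h3, h1, h2]
  simp only [Pi.add_apply, Pi.smul_apply, smul_eq_mul]
  rfl

theorem tendsto_firstMoment [IsProbabilityMeasure P] [∀ k, IsProbabilityMeasure (ν k)]
    (hν : ∀ k, Integrable (fun x => x ^ 2) (ν k))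
    (hproc : IsSelfExcitingProcess P 𝓕 (fun _ x => A *ᵥ (x - l₀)) B
      (fun k => Kernel.const (Fin d → ℝ) (ν k)) l T X Y lam)
    {a : ℝ} (ha : 0 < a)
    (hM : ∀ x : Fin d → ℝ, x ⬝ᵥ (driftMatrix A B ν *ᵥ x) ≤ -a * (x ⬝ᵥ x))
    {c : Fin d → ℝ} (hc : driftMatrix A B ν *ᵥ c = A *ᵥ l₀) (i : Fin d) :
    ContinuousOn (fun t : ℝ => ∫ ω, leftIntensity lam t.toNNReal ω i ∂P) (Set.Ici 0) ∧
    Tendsto (fun t : ℝ => ∫ ω, leftIntensity lam t.toNNReal ω i ∂P) atTop (𝓝 (c i)) := by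
  have hI : ∀ t : ℝ, 0 ≤ t → ∀ i, IntervalIntegrable
      (fun s : ℝ => ∫ ω, leftIntensity lam s.toNNReal ω i ∂P) volume 0 t := by
    intro t ht i
    have := (integral_intensity_mul_intensity hν hproc t.toNNReal).2.1 i
    rwa [Real.coe_toNNReal t ht] at this
  have hx : ∀ t : ℝ, 0 ≤ t → ∀ i, ∫ ω, leftIntensity lam t.toNNReal ω i ∂P = l i +
      ∫ s in (0 : ℝ)..t, (Matrix.toLin' (driftMatrix A B ν)
        (fun i => ∫ ω, leftIntensity lam s.toNNReal ω i ∂P) i + (-(A *ᵥ l₀)) i) := by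
    intro t ht i
    have h1 := (integral_mul_intensity hν hproc (zero_le (a := t.toNNReal)) (Z := fun _ => 1)
      measurable_const (Eventually.of_forall fun _ => zero_le_one) (memLp_const 1)).2 i
    have h0 : ∫ ω, lam 0 ω i ∂P = l i := by
      rw [integral_congr_ae (g := fun _ => l i)]
      · simp
      · filter_upwards [ae_intensity_zero hproc] with ω h
        rw [h]
    simp only [one_mul, integral_const, probReal_univ, one_smul, NNReal.coe_zero,
      Real.coe_toNNReal t ht, h0] at h1
    rw [← firstMoment_eq hproc]
    exact h1
  obtain ⟨y, hy, hlim⟩ := exists_tendsto_of_dissipative (Matrix.toLin' (driftMatrix A B ν)) ha hM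
    _ (fun _ => -(A *ᵥ l₀)) l (-(A *ᵥ l₀)) hI (fun i => continuousOn_const) hx
    (fun i => tendsto_const_nhds)
  have hyc : y = c := by
    refine sub_eq_zero.1 (dotProduct_self_eq_zero.1 (le_antisymm ?_ ?_))
    · have h1 := hM (y - c)
      rw [Matrix.mulVec_sub, ← Matrix.toLin'_apply, hy, neg_neg, hc, sub_self,
        dotProduct_zero] at h1
      nlinarith
    · exact Finset.sum_nonneg fun i _ => mul_self_nonneg _
  rw [← hyc]
  exact hlim i

/-- The second moments converge if the drift matrix is dissipative. -/
theorem exists_tendsto_secondMoment [IsProbabilityMeasure P] [∀ k, IsProbabilityMeasure (ν k)]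
    (hν : ∀ k, Integrable (fun x => x ^ 2) (ν k))
    (hproc : IsSelfExcitingProcess P 𝓕 (fun _ x => A *ᵥ (x - l₀)) B
      (fun k => Kernel.const (Fin d → ℝ) (ν k)) l T X Y lam)
    {a : ℝ} (ha : 0 < a)
    (hM : ∀ x : Fin d → ℝ, x ⬝ᵥ (driftMatrix A B ν *ᵥ x) ≤ -a * (x ⬝ᵥ x))
    {c : Fin d → ℝ} (hc : driftMatrix A B ν *ᵥ c = A *ᵥ l₀) :
    ∃ L : Matrix (Fin d) (Fin d) ℝ, Tendsto (fun t => secondMoment P lam t) atTop (𝓝 L) := by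
  have hy := tendsto_firstMoment hν hproc ha hM hc
  have hsymm : ∀ i j (t : ℝ), ∫ ω, leftIntensity lam t.toNNReal ω i *
      leftIntensity lam t.toNNReal ω j ∂P = ∫ ω, leftIntensity lam t.toNNReal ω j *
      leftIntensity lam t.toNNReal ω i ∂P := fun i j t => by
    congr 1
    ext ω
    exact mul_comm _ _
  have hI : ∀ t : ℝ, 0 ≤ t → ∀ i j, IntervalIntegrable (fun s : ℝ =>
      ∫ ω, leftIntensity lam s.toNNReal ω i * leftIntensity lam s.toNNReal ω j ∂P)
      volume 0 t := by
    intro t ht i j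
    have := (integral_intensity_mul_intensity hν hproc t.toNNReal).1 i j
    rwa [Real.coe_toNNReal t ht] at this
  obtain ⟨L, hL⟩ := exists_tendsto_of_lyapunov_forcing ha hM
    (fun i j (t : ℝ) => ∫ ω, leftIntensity lam t.toNNReal ω i *
      leftIntensity lam t.toNNReal ω j ∂P)
    (fun i (t : ℝ) => ∫ ω, leftIntensity lam t.toNNReal ω i ∂P)
    (fun i j => l i * l j) (A *ᵥ l₀) c (fun i j k => B i k * B j k * ∫ x, x ^ 2 ∂(ν k))
    hsymm hI (fun i => (hy i).1) (fun i => (hy i).2) (by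
      intro t ht i j
      have h1 := (integral_intensity_mul_intensity hν hproc t.toNNReal).2.2 i j
      rw [Real.coe_toNNReal t ht] at h1
      exact (secondMoment_eq hproc t.toNNReal i j).symm.trans h1)
  refine ⟨L, tendsto_pi_nhds.2 fun i => tendsto_pi_nhds.2 fun j => ?_⟩
  refine ((hL i j).comp (NNReal.tendsto_coe_atTop.2 tendsto_id)).congr fun t => ?_
  rw [secondMoment_eq hproc, Function.comp_apply, id, Real.toNNReal_coe]

end Covariance
end SelfExciting
end

theorem mainTheorem7 {Ω : Type*} [mΩ : MeasurableSpace Ω] (P : Measure Ω)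
    [IsProbabilityMeasure P] (𝓕 : Filtration ℝ≥0 mΩ) {d : ℕ}
    (A B : Matrix (Fin d) (Fin d) ℝ) (l₀ l : Fin d → ℝ) (hl₀ : 0 ≤ l₀) (hl : l₀ ≤ l)
    (ν : Fin d → Measure ℝ) [∀ k, IsProbabilityMeasure (ν k)]
    (hν : ∀ k, Integrable (fun x => x ^ 2) (ν k))
    (T : ℕ → Ω → ℝ≥0∞) (X : ℕ → Ω → Fin d) (Y : ℕ → Ω → ℝ) (lam : ℝ≥0 → Ω → Fin d → ℝ)
    (hproc : SelfExciting.IsSelfExcitingProcess P 𝓕 (fun _ x => A *ᵥ (x - l₀)) B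
      (fun k => Kernel.const (Fin d → ℝ) (ν k)) l T X Y lam)
    (M : Matrix (Fin d) (Fin d) ℝ) (hM : M = SelfExciting.driftMatrix A B ν) :
    (∀ t i, MemLp (fun ω => lam t ω i) 2 P) ∧
    (IsUnit M.det → ∀ t h : ℝ≥0,
      SelfExciting.autocovariance P lam t h =
        NormedSpace.exp ((h : ℝ) • M) *
          (SelfExciting.secondMoment P lam t
            - Matrix.vecMulVec (NormedSpace.exp ((t : ℝ) • M) *ᵥ l)
                (SelfExciting.firstMoment P lam t)
            + Matrix.vecMulVec ((NormedSpace.exp ((t : ℝ) • M) - 1) *ᵥ (M⁻¹ *ᵥ (A *ᵥ l₀)))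
                (SelfExciting.firstMoment P lam t))) ∧
    ((∀ γ : ℝ, Module.End.HasEigenvalue (Matrix.toLin' (M + Mᵀ)) γ → γ < 0) →
      IsUnit M.det ∧
      ∃ L : Matrix (Fin d) (Fin d) ℝ,
        Tendsto (fun t => SelfExciting.secondMoment P lam t) atTop (𝓝 L) ∧
        ∀ h : ℝ≥0, Tendsto (fun t => SelfExciting.autocovariance P lam t h) atTop
          (𝓝 (NormedSpace.exp ((h : ℝ) • M) *
            (L - Matrix.vecMulVec (M⁻¹ *ᵥ (A *ᵥ l₀)) (M⁻¹ *ᵥ (A *ᵥ l₀)))))) := by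
  have hcM : IsUnit M.det → SelfExciting.driftMatrix A B ν *ᵥ (M⁻¹ *ᵥ (A *ᵥ l₀)) = A *ᵥ l₀ := by
    intro hdet
    rw [← hM, Matrix.mulVec_mulVec, Matrix.mul_nonsing_inv _ hdet, Matrix.one_mulVec]
  generalize M⁻¹ *ᵥ (A *ᵥ l₀) = c at hcM ⊢
  refine ⟨SelfExciting.memLp_intensity hν hproc, fun hdet t h => ?_, fun hγ => ?_⟩
  · have hc := hcM hdet
    ext i j
    rw [SelfExciting.autocovariance_apply hν hproc hc t h i j,
      SelfExciting.firstMoment_eq_exp hν hproc hc (t + h), ← hM, SelfExciting.mul_apply_eq_mulVec_col]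
    have hexp : NormedSpace.exp (((t + h : ℝ≥0) : ℝ) • M) =
        NormedSpace.exp ((h : ℝ) • M) * NormedSpace.exp ((t : ℝ) • M) := by
      rw [← Matrix.exp_add_of_commute _ _ (((Commute.refl M).smul_left _).smul_right _),
        ← add_smul, NNReal.coe_add, add_comm]
    have hcol : (SelfExciting.secondMoment P lam t
            - Matrix.vecMulVec (NormedSpace.exp ((t : ℝ) • M) *ᵥ l)
                (SelfExciting.firstMoment P lam t)
            + Matrix.vecMulVec ((NormedSpace.exp ((t : ℝ) • M) - 1) *ᵥ c)
                (SelfExciting.firstMoment P lam t)).col j =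
        ((SelfExciting.secondMoment P lam t).col j - SelfExciting.firstMoment P lam t j • c) -
          SelfExciting.firstMoment P lam t j • (NormedSpace.exp ((t : ℝ) • M) *ᵥ (l - c)) := by
      ext k
      simp only [Matrix.col_apply, Matrix.add_apply, Matrix.sub_apply, Matrix.vecMulVec_apply,
        Matrix.sub_mulVec, Matrix.mulVec_sub, Matrix.one_mulVec, Pi.sub_apply, Pi.smul_apply,
        smul_eq_mul]
      ring
    rw [hcol, hexp, Matrix.mulVec_sub _ _ (_ • _ *ᵥ _), Matrix.mulVec_smul _ _ (_ *ᵥ _),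
      Matrix.mulVec_mulVec]
    simp only [Pi.sub_apply, Pi.add_apply, Pi.smul_apply, smul_eq_mul]
    ring
  · obtain ⟨a, ha, hdiss⟩ := SelfExciting.exists_pos_dotProduct_mulVec_le M hγ
    have hdet := SelfExciting.isUnit_det_of_dissipative ha hdiss
    have hc := hcM hdet
    rw [hM] at hdiss
    obtain ⟨L, hL⟩ := SelfExciting.exists_tendsto_secondMoment hν hproc ha hdiss hc
    refine ⟨hdet, L, hL, fun h => ?_⟩
    have hy : ∀ i, Tendsto (fun t => SelfExciting.firstMoment P lam t i) atTop (𝓝 (c i)) := by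
      intro i
      refine ((SelfExciting.tendsto_firstMoment hν hproc ha hdiss hc i).2.comp
        (NNReal.tendsto_coe_atTop.2 tendsto_id)).congr fun t => ?_
      rw [SelfExciting.firstMoment_eq hproc]
      simp
    have hyh : ∀ i, Tendsto (fun t => SelfExciting.firstMoment P lam (t + h) i) atTop
        (𝓝 (c i)) := fun i => (hy i).comp
          (tendsto_atTop_mono (fun t => le_add_of_nonneg_right (zero_le (a := h))) tendsto_id)
    refine tendsto_pi_nhds.2 fun i => tendsto_pi_nhds.2 fun j => ?_
    simp only [SelfExciting.autocovariance_apply hν hproc hc]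
    rw [← hM]
    have hcol : Tendsto (fun t => (SelfExciting.secondMoment P lam t).col j -
        SelfExciting.firstMoment P lam t j • c) atTop (𝓝 (L.col j - c j • c)) :=
      (tendsto_pi_nhds.2 fun k => tendsto_pi_nhds.1 (tendsto_pi_nhds.1 hL k) j).sub
        ((hy j).smul_const c)
    have hmul : Continuous fun v => (NormedSpace.exp ((h : ℝ) • M) *ᵥ v) i :=
      (continuous_apply i).comp (continuous_const.matrix_mulVec continuous_id)
    have hlim := (((hmul.tendsto _).comp hcol).add ((hy j).mul_const (c i))).sub
      ((hyh i).mul (hy j))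
    have e : (NormedSpace.exp ((h : ℝ) • M) * (L - Matrix.vecMulVec c c)) i j =
        (NormedSpace.exp ((h : ℝ) • M) *ᵥ (L.col j - c j • c)) i + c j * c i - c i * c j := by
      rw [SelfExciting.mul_apply_eq_mulVec_col]
      have : (L - Matrix.vecMulVec c c).col j = L.col j - c j • c := by
        ext k
        simp [Matrix.vecMulVec_apply, mul_comm]
      rw [this]
      ring
    rw [e]
    exact hlim
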